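/- Let $\mathbb{K}$ be a field and let $q\in\mathbb{K}^{\times}$ not be a root of unity. Let $U_q(\mathfrak{sl}_2)$ be the associative unital $\mathbb{K}$-algebra with generators $E,F,K,K^{-1}$ and relations $KK^{-1}=K^{-1}K=1$, $KE=q^2EK$, $KF=q^{-2}FK$, $[E,F]=\frac{K-K^{-1}}{q-q^{-1}}$, with coproduct $\Delta(E)=E\otimes 1+K\otimes E$, $\Delta(F)=F\otimes K^{-1}+1\otimes F$, $\Delta(K^{\pm1})=K^{\pm1}\otimes K^{\pm1}$, and Casimir element $\Lambda=(q-q^{-1})^2EF+q^{-1}K+qK^{-1}$. Let $\mathcal{I}_R\subset U_q(\mathfrak{sl}_2)$ be the subalgebra generated by $EK^{-1},F,K^{-1},\Lambda$; it satisfies $\Delta(\mathcal{I}_R)\subset U_q(\mathfrak{sl}_2)\otimes\mathcal{I}_R$. Let $\tau_R\colon\mathcal{I}_R\to U_q(\mathfrak{sl}_2)\otimes\mathcal{I}_R$ be the algebra morphism with $$\tau_R(EK^{-1})=K^{-1}\otimes EK^{-1},\qquad \tau_R(\Lambda)=1\otimes\Lambda,\qquad \tau_R(K^{-1})=1\otimes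 K^{-1}-q^{-1}(q-q^{-1})^2F\otimes EK^{-1},$$ $$\tau_R(F)=K\otimes F-q^{-3}(q-q^{-1})^2F^2K\otimes EK^{-1}+q^{-1}(q+q^{-1})FK\otimes K^{-1}-q^{-1}FK\otimes\Lambda .$$ For $n\in\mathbb{N}$ and $A\subseteq\{1,\dots,n\}$ define $\Lambda_A\in U_q(\mathfrak{sl}_2)^{\otimes n}$ as follows: $\Lambda_\varnothing=q+q^{-1}$, and for $A=\{a_1<\dots<a_m\}$ with $m\ge1$, $$\Lambda_A=1^{\otimes(a_1-1)}\otimes\big(\mu_m\mu_{m-1}\cdots\mu_2\big)(\Lambda)\otimes1^{\otimes(n-a_m)},$$ $$\mu_i=\big(1^{\otimes(a_i-a_1-1)}\otimes\tau_R\big)\cdots\big(1^{\otimes(a_{i-1}-a_1+1)}\otimes\tau_R\big)\big(1^{\otimes(a_{i-1}-a_1)}\otimes\Delta\big),$$ where the factors with $\tau_R$ are absent if $a_i=a_{i-1}+1$, and where, when the map is applied to an element, $1^{\otimes\ell}$ denotes the identity on the first $\ell$ tensor factors. (The $\Lambda_A$ generate the higher rank Askey–Wilson algebra $\mathrm{AW}(n)\subset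 U_q(\mathfrak{sl}_2)^{\otimes n}$.) **Theorem.** If $B\subseteq A\subseteq\{1,\dots,n\}$, then $\Lambda_A$ and $\Lambda_B$ commute in $U_q(\mathfrak{sl}_2)^{\otimes n}$. -/

import Mathlib

noncomputable section
set_option linter.unusedSimpArgs false

namespace AskeyWilson

open scoped TensorProduct

/-- The four generators `E`, `F`, `K`, `K⁻¹` of `U_q(sl₂)`. -/
inductive UqGen
  | E | F | K | Kinv

variable {𝕜 : Type*} [Field 𝕜]

open UqGen FreeAlgebra in
/-- The defining relations of `U_q(sl₂)` on the free algebra on `E`, `F`, `K`, `K⁻¹`. -/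
inductive UqRel (q : 𝕜ˣ) : FreeAlgebra 𝕜 UqGen → FreeAlgebra 𝕜 UqGen → Prop
  | K_mul_Kinv : UqRel q (ι 𝕜 K * ι 𝕜 Kinv) 1
  | Kinv_mul_K : UqRel q (ι 𝕜 Kinv * ι 𝕜 K) 1
  | K_mul_E : UqRel q (ι 𝕜 K * ι 𝕜 E) ((q : 𝕜) ^ 2 • (ι 𝕜 E * ι 𝕜 K))
  | K_mul_F : UqRel q (ι 𝕜 K * ι 𝕜 F) (((q : 𝕜)⁻¹) ^ 2 • (ι 𝕜 F * ι 𝕜 K))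
  | E_F : UqRel q (ι 𝕜 E * ι 𝕜 F - ι 𝕜 F * ι 𝕜 E)
      (((q : 𝕜) - (q : 𝕜)⁻¹)⁻¹ • (ι 𝕜 K - ι 𝕜 Kinv))

/-- The quantum group `U_q(sl₂)` over the field `𝕜`, as an associative algebra. -/
def Uq (q : 𝕜ˣ) : Type _ := RingQuot (UqRel q)

namespace Uq

instance (q : 𝕜ˣ) : Ring (Uq q) := inferInstanceAs (Ring (RingQuot (UqRel q)))

instance (q : 𝕜ˣ) : Algebra 𝕜 (Uq q) := inferInstanceAs (Algebra 𝕜 (RingQuot (UqRel q)))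

variable (q : 𝕜ˣ)

/-- The quotient map from the free algebra. -/
def mk : FreeAlgebra 𝕜 UqGen →ₐ[𝕜] Uq q := RingQuot.mkAlgHom 𝕜 (UqRel q)

lemma mk_rel {x y : FreeAlgebra 𝕜 UqGen} (h : UqRel q x y) : mk q x = mk q y :=
  RingQuot.mkAlgHom_rel 𝕜 h

/-- The images of the generators. -/
def gen (x : UqGen) : Uq q := mk q (FreeAlgebra.ι 𝕜 x)

abbrev E : Uq q := gen q .E
abbrev F : Uq q := gen q .F
abbrev K : Uq q := gen q .K
abbrev Kinv : Uq q := gen q .Kinv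

lemma K_mul_Kinv : K q * Kinv q = 1 := by
  have h := mk_rel q UqRel.K_mul_Kinv
  simp only [map_mul, map_one] at h
  exact h

lemma Kinv_mul_K : Kinv q * K q = 1 := by
  have h := mk_rel q UqRel.Kinv_mul_K
  simp only [map_mul, map_one] at h
  exact h

lemma K_mul_E : K q * E q = (q : 𝕜) ^ 2 • (E q * K q) := by
  have h := mk_rel q UqRel.K_mul_E
  simp only [map_mul, map_smul] at h
  exact h

lemma K_mul_F : K q * F q = ((q : 𝕜)⁻¹) ^ 2 • (F q * K q) := by
  have h := mk_rel q UqRel.K_mul_F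
  simp only [map_mul, map_smul] at h
  exact h

lemma E_F : E q * F q - F q * E q = ((q : 𝕜) - (q : 𝕜)⁻¹)⁻¹ • (K q - Kinv q) := by
  have h := mk_rel q UqRel.E_F
  simp only [map_mul, map_smul, map_sub] at h
  exact h

lemma F_mul_E : F q * E q = E q * F q - ((q : 𝕜) - (q : 𝕜)⁻¹)⁻¹ • (K q - Kinv q) := by
  rw [← E_F]; abel

lemma Kinv_mul_E : Kinv q * E q = ((q : 𝕜)⁻¹) ^ 2 • (E q * Kinv q) := by
  have h : Kinv q * (K q * E q) * Kinv q = (q : 𝕜) ^ 2 • (Kinv q * E q) := by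
    rw [K_mul_E]
    simp only [mul_smul_comm, smul_mul_assoc, mul_assoc, K_mul_Kinv, mul_one]
  rw [← mul_assoc (Kinv q), Kinv_mul_K, one_mul] at h
  rw [h, smul_smul, ← mul_pow, inv_mul_cancel₀ q.ne_zero, one_pow, one_smul]

lemma Kinv_mul_F : Kinv q * F q = (q : 𝕜) ^ 2 • (F q * Kinv q) := by
  have h : Kinv q * (K q * F q) * Kinv q = ((q : 𝕜)⁻¹) ^ 2 • (Kinv q * F q) := by
    rw [K_mul_F]
    simp only [mul_smul_comm, smul_mul_assoc, mul_assoc, K_mul_Kinv, mul_one]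
  rw [← mul_assoc (Kinv q), Kinv_mul_K, one_mul] at h
  rw [h, smul_smul, ← mul_pow, mul_inv_cancel₀ q.ne_zero, one_pow, one_smul]

/-- Elements satisfying the defining relations give an algebra morphism out of `U_q(sl₂)`. -/
lemma exists_algHom {A : Type*} [Ring A] [Algebra 𝕜 A] (a b c d : A)
    (h1 : c * d = 1) (h2 : d * c = 1)
    (h3 : c * a = (q : 𝕜) ^ 2 • (a * c)) (h4 : c * b = ((q : 𝕜)⁻¹) ^ 2 • (b * c))
    (h5 : a * b - b * a = ((q : 𝕜) - (q : 𝕜)⁻¹)⁻¹ • (c - d)) :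
    ∃ φ : Uq q →ₐ[𝕜] A, φ (E q) = a ∧ φ (F q) = b ∧ φ (K q) = c ∧ φ (Kinv q) = d := by
  let g : UqGen → A := fun | .E => a | .F => b | .K => c | .Kinv => d
  have hg : ∀ ⦃x y⦄, UqRel q x y → FreeAlgebra.lift 𝕜 g x = FreeAlgebra.lift 𝕜 g y := by
    intro x y h
    cases h <;> simp only [map_mul, map_smul, map_sub, map_one, FreeAlgebra.lift_ι_apply] <;>
      assumption
  have key : ∀ x, RingQuot.liftAlgHom 𝕜 ⟨FreeAlgebra.lift 𝕜 g, hg⟩ (gen q x) = g x := fun x =>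
    (RingQuot.liftAlgHom_mkAlgHom_apply ..).trans (FreeAlgebra.lift_ι_apply ..)
  exact ⟨RingQuot.liftAlgHom 𝕜 ⟨FreeAlgebra.lift 𝕜 g, hg⟩, key .E, key .F, key .K, key .Kinv⟩

/-- The Casimir element `Λ = (q - q⁻¹)² EF + q⁻¹ K + q K⁻¹`. -/
def Casimir : Uq q :=
  ((q : 𝕜) - (q : 𝕜)⁻¹) ^ 2 • (E q * F q) + (q : 𝕜)⁻¹ • K q + (q : 𝕜) • Kinv q

section rules
variable (x : Uq q)
lemma K_mul_Kinv' : K q * (Kinv q * x) = x := by rw [← mul_assoc, K_mul_Kinv, one_mul]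
lemma Kinv_mul_K' : Kinv q * (K q * x) = x := by rw [← mul_assoc, Kinv_mul_K, one_mul]
lemma K_mul_E' : K q * (E q * x) = (q : 𝕜) ^ 2 • (E q * (K q * x)) := by
  rw [← mul_assoc, K_mul_E, smul_mul_assoc, mul_assoc]
lemma K_mul_F' : K q * (F q * x) = ((q : 𝕜)⁻¹) ^ 2 • (F q * (K q * x)) := by
  rw [← mul_assoc, K_mul_F, smul_mul_assoc, mul_assoc]
lemma Kinv_mul_E' : Kinv q * (E q * x) = ((q : 𝕜)⁻¹) ^ 2 • (E q * (Kinv q * x)) := by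
  rw [← mul_assoc, Kinv_mul_E, smul_mul_assoc, mul_assoc]
lemma Kinv_mul_F' : Kinv q * (F q * x) = (q : 𝕜) ^ 2 • (F q * (Kinv q * x)) := by
  rw [← mul_assoc, Kinv_mul_F, smul_mul_assoc, mul_assoc]
lemma F_mul_E' : F q * (E q * x) =
    E q * (F q * x) - ((q : 𝕜) - (q : 𝕜)⁻¹)⁻¹ • (K q * x - Kinv q * x) := by
  rw [← mul_assoc, F_mul_E]; simp only [sub_mul, smul_mul_assoc, mul_assoc]
end rules

open TensorProduct in
lemma exists_comul : ∃ φ : Uq q →ₐ[𝕜] Uq q ⊗[𝕜] Uq q,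
    φ (E q) = E q ⊗ₜ 1 + K q ⊗ₜ E q ∧ φ (F q) = F q ⊗ₜ Kinv q + 1 ⊗ₜ F q ∧
    φ (K q) = K q ⊗ₜ K q ∧ φ (Kinv q) = Kinv q ⊗ₜ Kinv q := by
  apply exists_algHom q (A := Uq q ⊗[𝕜] Uq q)
  all_goals
    have hq := q.ne_zero
    simp only [mul_add, add_mul, mul_sub, sub_mul, Algebra.TensorProduct.tmul_mul_tmul,
      smul_mul_assoc, mul_smul_comm, smul_add, smul_sub, smul_smul, one_mul, mul_one,
      tmul_add, add_tmul, tmul_sub, sub_tmul, ← smul_tmul', tmul_smul, mul_assoc,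
      K_mul_Kinv, Kinv_mul_K, K_mul_E, K_mul_F, Kinv_mul_E, Kinv_mul_F, F_mul_E]
  all_goals
    first
      | rfl
      | (match_scalars <;> field_simp <;> ring)

open TensorProduct in
/-- The coproduct `Δ` of `U_q(sl₂)`: the algebra morphism with the values on the generators that
are listed in `comul_E`, `comul_F`, `comul_K`, `comul_Kinv` (these determine it). -/
def comul : Uq q →ₐ[𝕜] Uq q ⊗[𝕜] Uq q := Classical.choose (exists_comul q)

section
open TensorProduct
@[simp] lemma comul_E : comul q (E q) = E q ⊗ₜ 1 + K q ⊗ₜ E q :=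
  (Classical.choose_spec (exists_comul q)).1
@[simp] lemma comul_F : comul q (F q) = F q ⊗ₜ Kinv q + 1 ⊗ₜ F q :=
  (Classical.choose_spec (exists_comul q)).2.1
@[simp] lemma comul_K : comul q (K q) = K q ⊗ₜ K q :=
  (Classical.choose_spec (exists_comul q)).2.2.1
@[simp] lemma comul_Kinv : comul q (Kinv q) = Kinv q ⊗ₜ Kinv q :=
  (Classical.choose_spec (exists_comul q)).2.2.2
end

lemma E_Casimir (hh : (q : 𝕜) ^ 2 - 1 ≠ 0) : E q * Casimir q = Casimir q * E q := by
  have hq := q.ne_zero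
  simp only [Casimir, mul_add, add_mul, mul_sub, sub_mul, smul_mul_assoc, mul_smul_comm, smul_add,
    smul_sub, smul_smul, mul_assoc, K_mul_E, Kinv_mul_E, F_mul_E]
  match_scalars <;> field_simp <;> ring

lemma F_Casimir (hh : (q : 𝕜) ^ 2 - 1 ≠ 0) : F q * Casimir q = Casimir q * F q := by
  have hq := q.ne_zero
  simp only [Casimir, mul_add, add_mul, mul_sub, sub_mul, smul_mul_assoc, mul_smul_comm, smul_add,
    smul_sub, smul_smul, mul_assoc, K_mul_F, Kinv_mul_F, F_mul_E, F_mul_E']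
  match_scalars <;> field_simp <;> ring

lemma K_Casimir : K q * Casimir q = Casimir q * K q := by
  have hq := q.ne_zero
  simp only [Casimir, mul_add, add_mul, mul_sub, sub_mul, smul_mul_assoc, mul_smul_comm, smul_add,
    smul_sub, smul_smul, mul_assoc, K_mul_E', K_mul_F, K_mul_Kinv, Kinv_mul_K]
  match_scalars <;> field_simp

lemma Kinv_Casimir : Kinv q * Casimir q = Casimir q * Kinv q := by
  have hq := q.ne_zero
  simp only [Casimir, mul_add, add_mul, mul_sub, sub_mul, smul_mul_assoc, mul_smul_comm, smul_add,
    smul_sub, smul_smul, mul_assoc, Kinv_mul_E', Kinv_mul_F, K_mul_Kinv, Kinv_mul_K]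
  match_scalars <;> field_simp
end Uq

/-! ### A presentation of the subalgebra generated by `EK⁻¹`, `F`, `K⁻¹`, `Λ`

`IPres q` is an auxiliary algebra, only used to show that the coaction `τ_R` exists: an algebra
morphism out of `IPres q` is given by images of `e, f, k, L` that satisfy seven relations, and it is
shown below that `IPres q` maps isomorphically onto the subalgebra. -/

/-- Symbols for `EK⁻¹`, `F`, `K⁻¹`, `Λ`. -/
inductive IGen
  | e | f | k | L

open IGen FreeAlgebra in
/-- The relations between `EK⁻¹`, `F`, `K⁻¹`, `Λ`. -/
inductive IRel (q : 𝕜ˣ) : FreeAlgebra 𝕜 IGen → FreeAlgebra 𝕜 IGen → Prop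
  | k_e : IRel q (ι 𝕜 k * ι 𝕜 e) (((q : 𝕜)⁻¹) ^ 2 • (ι 𝕜 e * ι 𝕜 k))
  | k_f : IRel q (ι 𝕜 k * ι 𝕜 f) ((q : 𝕜) ^ 2 • (ι 𝕜 f * ι 𝕜 k))
  | L_e : IRel q (ι 𝕜 L * ι 𝕜 e) (ι 𝕜 e * ι 𝕜 L)
  | L_f : IRel q (ι 𝕜 L * ι 𝕜 f) (ι 𝕜 f * ι 𝕜 L)
  | L_k : IRel q (ι 𝕜 L * ι 𝕜 k) (ι 𝕜 k * ι 𝕜 L)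
  | e_f : IRel q (ι 𝕜 e * ι 𝕜 f) (((q : 𝕜) ^ 2 * (((q : 𝕜) - (q : 𝕜)⁻¹) ^ 2)⁻¹) •
      (ι 𝕜 k * ι 𝕜 L - (q : 𝕜)⁻¹ • 1 - (q : 𝕜) • (ι 𝕜 k * ι 𝕜 k)))
  | f_e : IRel q (ι 𝕜 f * ι 𝕜 e) ((((q : 𝕜) - (q : 𝕜)⁻¹) ^ 2)⁻¹ •
      (ι 𝕜 k * ι 𝕜 L - (q : 𝕜) • 1 - (q : 𝕜)⁻¹ • (ι 𝕜 k * ι 𝕜 k)))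

/-- The algebra presented by these relations (auxiliary). -/
def IPres (q : 𝕜ˣ) : Type _ := RingQuot (IRel q)

namespace IPres

instance (q : 𝕜ˣ) : Ring (IPres q) := inferInstanceAs (Ring (RingQuot (IRel q)))

instance (q : 𝕜ˣ) : Algebra 𝕜 (IPres q) := inferInstanceAs (Algebra 𝕜 (RingQuot (IRel q)))

variable (q : 𝕜ˣ)

/-- The quotient map from the free algebra. -/
def mk : FreeAlgebra 𝕜 IGen →ₐ[𝕜] IPres q := RingQuot.mkAlgHom 𝕜 (IRel q)

lemma mk_rel {x y : FreeAlgebra 𝕜 IGen} (h : IRel q x y) : mk q x = mk q y :=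
  RingQuot.mkAlgHom_rel 𝕜 h

lemma mk_surjective : Function.Surjective (mk q) := RingQuot.mkAlgHom_surjective 𝕜 (IRel q)

/-- The images of the generators. -/
def gen (x : IGen) : IPres q := mk q (FreeAlgebra.ι 𝕜 x)

abbrev e : IPres q := gen q .e
abbrev f : IPres q := gen q .f
abbrev k : IPres q := gen q .k
abbrev L : IPres q := gen q .L

lemma k_e : k q * e q = ((q : 𝕜)⁻¹) ^ 2 • (e q * k q) := by
  have h := mk_rel q IRel.k_e
  simp only [map_mul, map_smul] at h
  exact h
lemma k_f : k q * f q = (q : 𝕜) ^ 2 • (f q * k q) := by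
  have h := mk_rel q IRel.k_f
  simp only [map_mul, map_smul] at h
  exact h
lemma L_e : L q * e q = e q * L q := by
  have h := mk_rel q IRel.L_e
  simp only [map_mul, map_smul] at h
  exact h
lemma L_f : L q * f q = f q * L q := by
  have h := mk_rel q IRel.L_f
  simp only [map_mul, map_smul] at h
  exact h
lemma L_k : L q * k q = k q * L q := by
  have h := mk_rel q IRel.L_k
  simp only [map_mul, map_smul] at h
  exact h
lemma e_f : e q * f q = ((q : 𝕜) ^ 2 * (((q : 𝕜) - (q : 𝕜)⁻¹) ^ 2)⁻¹) •
      (k q * L q - (q : 𝕜)⁻¹ • 1 - (q : 𝕜) • (k q * k q)) := by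
  have h := mk_rel q IRel.e_f
  simp only [map_mul, map_smul, map_sub, map_one] at h
  exact h
lemma f_e : f q * e q = (((q : 𝕜) - (q : 𝕜)⁻¹) ^ 2)⁻¹ •
      (k q * L q - (q : 𝕜) • 1 - (q : 𝕜)⁻¹ • (k q * k q)) := by
  have h := mk_rel q IRel.f_e
  simp only [map_mul, map_smul, map_sub, map_one] at h
  exact h

lemma exists_algHom {A : Type*} [Ring A] [Algebra 𝕜 A] (a b c d : A)
    (h1 : c * a = ((q : 𝕜)⁻¹) ^ 2 • (a * c)) (h2 : c * b = (q : 𝕜) ^ 2 • (b * c))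
    (h3 : d * a = a * d) (h4 : d * b = b * d) (h5 : d * c = c * d)
    (h6 : a * b = ((q : 𝕜) ^ 2 * (((q : 𝕜) - (q : 𝕜)⁻¹) ^ 2)⁻¹) •
      (c * d - (q : 𝕜)⁻¹ • 1 - (q : 𝕜) • (c * c)))
    (h7 : b * a = (((q : 𝕜) - (q : 𝕜)⁻¹) ^ 2)⁻¹ •
      (c * d - (q : 𝕜) • 1 - (q : 𝕜)⁻¹ • (c * c))) :
    ∃ φ : IPres q →ₐ[𝕜] A, φ (e q) = a ∧ φ (f q) = b ∧ φ (k q) = c ∧ φ (L q) = d := by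
  let g : IGen → A := fun | .e => a | .f => b | .k => c | .L => d
  have hg : ∀ ⦃x y⦄, IRel q x y → FreeAlgebra.lift 𝕜 g x = FreeAlgebra.lift 𝕜 g y := by
    intro x y h
    cases h <;> simp only [map_mul, map_smul, map_sub, map_one, FreeAlgebra.lift_ι_apply] <;>
      assumption
  have key : ∀ x, RingQuot.liftAlgHom 𝕜 ⟨FreeAlgebra.lift 𝕜 g, hg⟩ (gen q x) = g x := fun x =>
    (RingQuot.liftAlgHom_mkAlgHom_apply ..).trans (FreeAlgebra.lift_ι_apply ..)
  exact ⟨RingQuot.liftAlgHom 𝕜 ⟨FreeAlgebra.lift 𝕜 g, hg⟩, key .e, key .f, key .k, key .L⟩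

section rules
variable (x : IPres q)
lemma k_e' : k q * (e q * x) = ((q : 𝕜)⁻¹) ^ 2 • (e q * (k q * x)) := by
  rw [← mul_assoc, k_e, smul_mul_assoc, mul_assoc]
lemma k_f' : k q * (f q * x) = (q : 𝕜) ^ 2 • (f q * (k q * x)) := by
  rw [← mul_assoc, k_f, smul_mul_assoc, mul_assoc]
lemma L_e' : L q * (e q * x) = e q * (L q * x) := by rw [← mul_assoc, L_e, mul_assoc]
lemma L_f' : L q * (f q * x) = f q * (L q * x) := by rw [← mul_assoc, L_f, mul_assoc]
lemma L_k' : L q * (k q * x) = k q * (L q * x) := by rw [← mul_assoc, L_k, mul_assoc]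
lemma e_f' : e q * (f q * x) = ((q : 𝕜) ^ 2 * (((q : 𝕜) - (q : 𝕜)⁻¹) ^ 2)⁻¹) •
      (k q * (L q * x) - (q : 𝕜)⁻¹ • x - (q : 𝕜) • (k q * (k q * x))) := by
  rw [← mul_assoc, e_f]; simp only [sub_mul, smul_mul_assoc, mul_assoc, one_mul]
lemma f_e' : f q * (e q * x) = (((q : 𝕜) - (q : 𝕜)⁻¹) ^ 2)⁻¹ •
      (k q * (L q * x) - (q : 𝕜) • x - (q : 𝕜)⁻¹ • (k q * (k q * x))) := by
  rw [← mul_assoc, f_e]; simp only [sub_mul, smul_mul_assoc, mul_assoc, one_mul]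
end rules

open Uq in
lemma exists_toUq (hh : (q : 𝕜) ^ 2 - 1 ≠ 0) : ∃ φ : IPres q →ₐ[𝕜] Uq q,
    φ (e q) = E q * Kinv q ∧ φ (f q) = F q ∧ φ (k q) = Kinv q ∧ φ (L q) = Casimir q := by
  have hq := q.ne_zero
  apply exists_algHom q (A := Uq q)
  · simp only [Kinv_mul_E', mul_assoc, smul_mul_assoc, mul_smul_comm]
  · simp only [Kinv_mul_F]
  · rw [← mul_assoc, ← E_Casimir q hh, mul_assoc, ← Kinv_Casimir, mul_assoc]
  · exact (F_Casimir q hh).symm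
  · exact (Kinv_Casimir q).symm
  all_goals
    simp only [Casimir, mul_add, add_mul, mul_sub, sub_mul, smul_mul_assoc, mul_smul_comm,
      smul_add, smul_sub, smul_smul, mul_assoc, Kinv_mul_E', Kinv_mul_F, K_mul_Kinv, Kinv_mul_K,
      F_mul_E']
  all_goals
    match_scalars <;> field_simp <;> ring

open TensorProduct Uq in
/-- the coaction on the presented algebra -/
lemma exists_tau (hh : (q : 𝕜) ^ 2 - 1 ≠ 0) : ∃ φ : IPres q →ₐ[𝕜] Uq q ⊗[𝕜] IPres q,
    φ (e q) = Kinv q ⊗ₜ e q ∧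
    φ (f q) = K q ⊗ₜ f q
      - (((q : 𝕜)⁻¹) ^ 3 * ((q : 𝕜) - (q : 𝕜)⁻¹) ^ 2) • ((F q ^ 2 * K q) ⊗ₜ e q)
      + ((q : 𝕜)⁻¹ * ((q : 𝕜) + (q : 𝕜)⁻¹)) • ((F q * K q) ⊗ₜ k q)
      - (q : 𝕜)⁻¹ • ((F q * K q) ⊗ₜ L q) ∧
    φ (k q) = 1 ⊗ₜ k q - ((q : 𝕜)⁻¹ * ((q : 𝕜) - (q : 𝕜)⁻¹) ^ 2) • (F q ⊗ₜ e q) ∧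
    φ (L q) = 1 ⊗ₜ L q := by
  have hq := q.ne_zero
  apply exists_algHom q (A := Uq q ⊗[𝕜] IPres q)
  all_goals
    simp only [Algebra.TensorProduct.one_def, pow_two, mul_add, add_mul, mul_sub, sub_mul,
      Algebra.TensorProduct.tmul_mul_tmul,
      smul_mul_assoc, mul_smul_comm, smul_add, smul_sub, smul_smul, one_mul, mul_one,
      tmul_add, add_tmul, tmul_sub, sub_tmul, ← smul_tmul', tmul_smul, mul_assoc,
      K_mul_Kinv, Kinv_mul_K, K_mul_F, K_mul_F', Kinv_mul_F, Kinv_mul_F',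
      k_e, k_f, L_e, L_f, L_k, e_f, f_e]
  all_goals
    match_scalars <;> field_simp <;> ring

/-! #### The map to `U_q(sl₂)` is injective: spanning monomials stay independent in a representation -/

/-- The spanning monomials `e^n k^c L^d` and `f^(n+1) k^c L^d`. -/
def mono : (Σ _ : ℤ, ℕ × ℕ) → IPres q
  | ⟨.ofNat n, c, d⟩ => e q ^ n * (k q ^ c * L q ^ d)
  | ⟨.negSucc n, c, d⟩ => f q ^ (n + 1) * (k q ^ c * L q ^ d)

lemma e_pow_mem (n c d : ℕ) :
    e q ^ n * (k q ^ c * L q ^ d) ∈ Submodule.span 𝕜 (Set.range (mono q)) :=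
  Submodule.subset_span ⟨⟨.ofNat n, c, d⟩, rfl⟩

lemma f_pow_mem (n c d : ℕ) :
    f q ^ n * (k q ^ c * L q ^ d) ∈ Submodule.span 𝕜 (Set.range (mono q)) := by
  cases n with
  | zero => simpa using e_pow_mem q 0 c d
  | succ n => exact Submodule.subset_span ⟨⟨.negSucc n, c, d⟩, rfl⟩

lemma k_e_pow (n : ℕ) : k q * e q ^ n = (((q : 𝕜)⁻¹) ^ 2) ^ n • (e q ^ n * k q) := by
  induction n with
  | zero => simp
  | succ n ih => rw [pow_succ (e q), ← mul_assoc, ih, smul_mul_assoc, mul_assoc, k_e,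
      mul_smul_comm, smul_smul, ← pow_succ, mul_assoc]

lemma k_f_pow (n : ℕ) : k q * f q ^ n = ((q : 𝕜) ^ 2) ^ n • (f q ^ n * k q) := by
  induction n with
  | zero => simp
  | succ n ih => rw [pow_succ (f q), ← mul_assoc, ih, smul_mul_assoc, mul_assoc, k_f,
      mul_smul_comm, smul_smul, ← pow_succ, mul_assoc]

lemma mul_mem_of {u : IPres q}
    (he : ∀ n c d, u * (e q ^ n * (k q ^ c * L q ^ d)) ∈ Submodule.span 𝕜 (Set.range (mono q)))
    (hf : ∀ n c d, u * (f q ^ n * (k q ^ c * L q ^ d)) ∈ Submodule.span 𝕜 (Set.range (mono q)))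
    {w : IPres q} (hw : w ∈ Submodule.span 𝕜 (Set.range (mono q))) :
    u * w ∈ Submodule.span 𝕜 (Set.range (mono q)) := by
  induction hw using Submodule.span_induction with
  | mem x hx =>
    obtain ⟨⟨a, c, d⟩, rfl⟩ := hx
    cases a with
    | ofNat n => exact he n c d
    | negSucc n => exact hf (n + 1) c d
  | zero => simp
  | add x y _ _ hx hy => rw [mul_add]; exact add_mem hx hy
  | smul r x _ hx => rw [mul_smul_comm]; exact Submodule.smul_mem _ _ hx

lemma k_mul_mem {w : IPres q} (hw : w ∈ Submodule.span 𝕜 (Set.range (mono q))) :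
    k q * w ∈ Submodule.span 𝕜 (Set.range (mono q)) := by
  refine mul_mem_of q (fun n c d => ?_) (fun n c d => ?_) hw
  · rw [← mul_assoc, k_e_pow, smul_mul_assoc, mul_assoc, ← mul_assoc (k q), ← pow_succ']
    exact Submodule.smul_mem _ _ (e_pow_mem q n (c + 1) d)
  · rw [← mul_assoc, k_f_pow, smul_mul_assoc, mul_assoc, ← mul_assoc (k q), ← pow_succ']
    exact Submodule.smul_mem _ _ (f_pow_mem q n (c + 1) d)

lemma L_mul_mem {w : IPres q} (hw : w ∈ Submodule.span 𝕜 (Set.range (mono q))) :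
    L q * w ∈ Submodule.span 𝕜 (Set.range (mono q)) := by
  have h1 : Commute (L q) (e q) := L_e q
  have h2 : Commute (L q) (f q) := L_f q
  have h3 : Commute (L q) (k q) := L_k q
  refine mul_mem_of q (fun n c d => ?_) (fun n c d => ?_) hw
  · rw [← mul_assoc, (h1.pow_right n).eq, mul_assoc, ← mul_assoc (L q), (h3.pow_right c).eq,
      mul_assoc, ← pow_succ']
    exact e_pow_mem q n c (d + 1)
  · rw [← mul_assoc, (h2.pow_right n).eq, mul_assoc, ← mul_assoc (L q), (h3.pow_right c).eq,
      mul_assoc, ← pow_succ']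
    exact f_pow_mem q n c (d + 1)

lemma e_mul_mem {w : IPres q} (hw : w ∈ Submodule.span 𝕜 (Set.range (mono q))) :
    e q * w ∈ Submodule.span 𝕜 (Set.range (mono q)) := by
  refine mul_mem_of q (fun n c d => ?_) (fun n c d => ?_) hw
  · rw [← mul_assoc, ← pow_succ']
    exact e_pow_mem q (n + 1) c d
  · cases n with
    | zero => simpa using e_pow_mem q 1 c d
    | succ n =>
      have h := f_pow_mem q n c d
      rw [pow_succ', mul_assoc, e_f']
      exact Submodule.smul_mem _ _ (sub_mem (sub_mem (k_mul_mem q (L_mul_mem q h))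
        (Submodule.smul_mem _ _ h)) (Submodule.smul_mem _ _ (k_mul_mem q (k_mul_mem q h))))

lemma f_mul_mem {w : IPres q} (hw : w ∈ Submodule.span 𝕜 (Set.range (mono q))) :
    f q * w ∈ Submodule.span 𝕜 (Set.range (mono q)) := by
  refine mul_mem_of q (fun n c d => ?_) (fun n c d => ?_) hw
  · cases n with
    | zero => simpa using f_pow_mem q 1 c d
    | succ n =>
      have h := e_pow_mem q n c d
      rw [pow_succ', mul_assoc, f_e']
      exact Submodule.smul_mem _ _ (sub_mem (sub_mem (k_mul_mem q (L_mul_mem q h))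
        (Submodule.smul_mem _ _ h)) (Submodule.smul_mem _ _ (k_mul_mem q (k_mul_mem q h))))
  · rw [← mul_assoc, ← pow_succ']
    exact f_pow_mem q (n + 1) c d

lemma gen_induction {P : IPres q → Prop} (hc : ∀ r : 𝕜, P (algebraMap 𝕜 _ r))
    (he : P (e q)) (hf : P (f q)) (hk : P (k q)) (hL : P (L q))
    (hadd : ∀ a b, P a → P b → P (a + b)) (hmul : ∀ a b, P a → P b → P (a * b))
    (u : IPres q) : P u := by
  obtain ⟨x, rfl⟩ := mk_surjective q u
  induction x using FreeAlgebra.induction with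
  | grade0 r => simpa using hc r
  | grade1 x => cases x <;> assumption
  | mul a b ha hb => rw [map_mul]; exact hmul _ _ ha hb
  | add a b ha hb => rw [map_add]; exact hadd _ _ ha hb

lemma span_mono : Submodule.span 𝕜 (Set.range (mono q)) = ⊤ := by
  rw [eq_top_iff]
  rintro u -
  have key : ∀ w ∈ Submodule.span 𝕜 (Set.range (mono q)),
      u * w ∈ Submodule.span 𝕜 (Set.range (mono q)) := by
    refine gen_induction q (P := fun u => ∀ w ∈ Submodule.span 𝕜 (Set.range (mono q)),
      u * w ∈ Submodule.span 𝕜 (Set.range (mono q))) (fun r w hw => ?_)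
      (fun w hw => e_mul_mem q hw) (fun w hw => f_mul_mem q hw) (fun w hw => k_mul_mem q hw)
      (fun w hw => L_mul_mem q hw) (fun a b ha hb w hw => ?_) (fun a b ha hb w hw => ?_) u
    · rw [← Algebra.smul_def]; exact Submodule.smul_mem _ _ hw
    · rw [add_mul]; exact add_mem (ha w hw) (hb w hw)
    · rw [mul_assoc]; exact ha _ (hb w hw)
  simpa using key 1 (by simpa using e_pow_mem q 0 0 0)

/-- The weighted shift `v ↦ (j ↦ s j * v (j + t))`. -/
def shift (𝕜 : Type*) [Field 𝕜] {A : Type*} [Field A] [Algebra 𝕜 A] (s : ℤ → A) (t : ℤ) :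
    Module.End 𝕜 (ℤ → A) where
  toFun v j := s j * v (j + t)
  map_add' v w := by ext j; simp [mul_add]
  map_smul' r v := by ext j; simp

lemma exists_rep {A : Type*} [Field A] [Algebra 𝕜 A] (hh : (q : 𝕜) ^ 2 - 1 ≠ 0) (x y : A)
    (hx : x ≠ 0) (φ : IPres q →ₐ[𝕜] Uq q) (he : φ (e q) = Uq.E q * Uq.Kinv q)
    (hf : φ (f q) = Uq.F q) (hk : φ (k q) = Uq.Kinv q) (hL : φ (L q) = Uq.Casimir q) :
    ∃ ψ : Uq q →ₐ[𝕜] Module.End 𝕜 (ℤ → A),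
      (∀ v j, ψ (φ (e q)) v j = v (j - 1)) ∧
      (∀ v j, ψ (φ (f q)) v j = algebraMap 𝕜 A (((q : 𝕜) - (q : 𝕜)⁻¹) ^ 2)⁻¹ *
        (x * y * algebraMap 𝕜 A ((q : 𝕜) ^ 2) ^ (-j) - algebraMap 𝕜 A q -
          algebraMap 𝕜 A (q : 𝕜)⁻¹ * (x * algebraMap 𝕜 A ((q : 𝕜) ^ 2) ^ (-j)) ^ 2) * v (j + 1)) ∧
      (∀ v j, ψ (φ (k q)) v j = x * algebraMap 𝕜 A ((q : 𝕜) ^ 2) ^ (-j) * v j) ∧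
      (∀ v j, ψ (φ (L q)) v j = y * v j) := by
  have hq : algebraMap 𝕜 A q ≠ 0 := by simp
  have hh' : algebraMap 𝕜 A q ^ 2 - 1 ≠ 0 := by
    rw [← map_pow, ← map_one (algebraMap 𝕜 A), ← map_sub]
    exact (map_ne_zero _).2 hh
  simp only [he, hf, hk, hL]
  set Q := algebraMap 𝕜 A q with hQ
  have hQ2 : Q ^ 2 ≠ 0 := pow_ne_zero _ hq
  have H : ∃ ψ : Uq q →ₐ[𝕜] Module.End 𝕜 (ℤ → A),
      ψ (Uq.E q) = shift 𝕜 (fun j => x⁻¹ * (Q ^ 2) ^ (j - 1)) (-1) ∧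
      ψ (Uq.F q) = shift 𝕜 (fun j => ((Q - Q⁻¹) ^ 2)⁻¹ * (x * y * ((Q ^ 2) ^ j)⁻¹ - Q -
        Q⁻¹ * (x * ((Q ^ 2) ^ j)⁻¹) ^ 2)) 1 ∧
      ψ (Uq.K q) = shift 𝕜 (fun j => x⁻¹ * (Q ^ 2) ^ j) 0 ∧
      ψ (Uq.Kinv q) = shift 𝕜 (fun j => x * ((Q ^ 2) ^ j)⁻¹) 0 := by
    apply Uq.exists_algHom q
    all_goals
      refine LinearMap.ext fun v => funext fun j => ?_
      have := zpow_ne_zero j hQ2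
      simp only [Module.End.mul_apply, LinearMap.sub_apply, LinearMap.smul_apply, Pi.sub_apply,
        Pi.smul_apply, Module.End.one_apply]
      simp [shift, Algebra.smul_def, ← hQ, ← sub_eq_add_neg, zpow_sub_one₀ hQ2, zpow_add_one₀ hQ2]
      generalize (Q ^ 2) ^ j = z at *
      field_simp
    all_goals ring
  obtain ⟨ψ, hE, hF, hK, hKi⟩ := H
  · refine ⟨ψ, fun v j => ?_, fun v j => ?_, fun v j => ?_, fun v j => ?_⟩
    · simp [hE, hKi, shift]
      have := zpow_ne_zero (j - 1) hQ2
      field_simp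
      simp [sub_eq_add_neg]
    · simp [hF, shift, ← hQ]
    · simp [hKi, shift, ← hQ]
    · simp only [Uq.Casimir, map_add, map_smul, map_mul, LinearMap.add_apply,
        LinearMap.smul_apply, Pi.add_apply, Pi.smul_apply, Module.End.mul_apply, hE, hF, hK, hKi]
      have := zpow_ne_zero j hQ2
      simp [shift, Algebra.smul_def, ← hQ, ← sub_eq_add_neg, zpow_sub_one₀ hQ2]
      generalize (Q ^ 2) ^ j = z at *
      field_simp
      ring

lemma coeff_ne_zero (c c' : 𝕜) :
    (MvPolynomial.X 0 * MvPolynomial.X 1 * MvPolynomial.C c - MvPolynomial.C (q : 𝕜) -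
      MvPolynomial.C c' * (MvPolynomial.X 0 * MvPolynomial.C c) ^ 2 :
        MvPolynomial (Fin 2) 𝕜) ≠ 0 := by
  intro h
  have := congrArg (MvPolynomial.eval (fun _ => (0 : 𝕜))) h
  simp at this

lemma linearIndependent_monomials : LinearIndependent 𝕜 fun cd : ℕ × ℕ =>
    (MvPolynomial.X 0 ^ cd.1 * MvPolynomial.X 1 ^ cd.2 : MvPolynomial (Fin 2) 𝕜) := by
  have h := (MvPolynomial.basisMonomials (Fin 2) 𝕜).linearIndependent.comp
    (fun cd : ℕ × ℕ => Finsupp.single 0 cd.1 + Finsupp.single 1 cd.2) (by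
      rintro ⟨a, b⟩ ⟨c, d⟩ h
      have h0 := DFunLike.congr_fun h 0
      have h1 := DFunLike.congr_fun h 1
      simp at h0 h1
      simp [h0, h1])
  have he : (fun cd : ℕ × ℕ =>
      (MvPolynomial.X 0 ^ cd.1 * MvPolynomial.X 1 ^ cd.2 : MvPolynomial (Fin 2) 𝕜)) =
      ⇑(MvPolynomial.basisMonomials (Fin 2) 𝕜) ∘
        fun cd : ℕ × ℕ => Finsupp.single 0 cd.1 + Finsupp.single 1 cd.2 := by
    funext cd
    simp [MvPolynomial.X_pow_eq_monomial, MvPolynomial.monomial_mul]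
  rw [he]
  exact h

lemma toUq_injective (hh : (q : 𝕜) ^ 2 - 1 ≠ 0) (φ : IPres q →ₐ[𝕜] Uq q)
    (he : φ (e q) = Uq.E q * Uq.Kinv q)
    (hf : φ (f q) = Uq.F q) (hk : φ (k q) = Uq.Kinv q) (hL : φ (L q) = Uq.Casimir q) :
    Function.Injective φ := by
  let R := MvPolynomial (Fin 2) 𝕜
  let A := FractionRing R
  have hinj : Function.Injective (algebraMap R A) := IsFractionRing.injective R A
  let x : A := algebraMap R A (MvPolynomial.X 0)
  let y : A := algebraMap R A (MvPolynomial.X 1)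
  have hx : x ≠ 0 := (map_ne_zero_iff _ hinj).2 (MvPolynomial.X_ne_zero 0)
  obtain ⟨ψ, h1, h2, h3, h4⟩ := exists_rep q (A := A) hh x y hx φ he hf hk hL
  set p : ℤ → A := fun j => algebraMap 𝕜 A (((q : 𝕜) - (q : 𝕜)⁻¹) ^ 2)⁻¹ *
        (x * y * algebraMap 𝕜 A ((q : 𝕜) ^ 2) ^ (-j) - algebraMap 𝕜 A q -
          algebraMap 𝕜 A (q : 𝕜)⁻¹ * (x * algebraMap 𝕜 A ((q : 𝕜) ^ 2) ^ (-j)) ^ 2) with hp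
  have hp0 : ∀ j, p j ≠ 0 := by
    intro j
    have hh2 : ((q : 𝕜) - (q : 𝕜)⁻¹) ^ 2 ≠ 0 := by
      have hq := q.ne_zero
      refine pow_ne_zero _ fun h => hh ?_
      field_simp at h
      simpa using h
    refine mul_ne_zero ((map_ne_zero _).2 (inv_ne_zero hh2)) ?_
    have := (map_ne_zero_iff _ hinj).2
      (coeff_ne_zero q (((q : 𝕜) ^ 2) ^ (-j)) (q : 𝕜)⁻¹)
    rw [← map_zpow₀]
    have he : ∀ c : 𝕜, algebraMap 𝕜 A c = algebraMap R A (MvPolynomial.C c) := fun c =>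
      IsScalarTower.algebraMap_apply 𝕜 R A c
    rw [he, he, he]
    simpa only [map_sub, map_mul, map_pow] using this
  have s1 : ∀ i t, ψ (φ (e q)) (Pi.single i t) = Pi.single (i + 1) t := by
    intro i t
    funext j
    rw [h1]
    by_cases hj : j = i + 1
    · subst hj; simp
    · rw [Pi.single_eq_of_ne hj, Pi.single_eq_of_ne (by omega)]
  have s2 : ∀ i t, ψ (φ (f q)) (Pi.single i t) = Pi.single (i - 1) (p (i - 1) * t) := by
    intro i t
    funext j
    rw [h2]
    by_cases hj : j = i - 1
    · subst hj; simp [hp]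
    · rw [Pi.single_eq_of_ne hj, Pi.single_eq_of_ne (by omega), mul_zero]
  have s3 : ∀ t, ψ (φ (k q)) (Pi.single 0 t) = Pi.single 0 (x * t) := by
    intro t
    funext j
    rw [h3]
    by_cases hj : j = 0
    · subst hj; simp
    · rw [Pi.single_eq_of_ne hj, Pi.single_eq_of_ne hj, mul_zero]
  have s4 : ∀ t, ψ (φ (L q)) (Pi.single 0 t) = Pi.single 0 (y * t) := by
    intro t
    funext j
    rw [h4]
    by_cases hj : j = 0
    · subst hj; simp
    · rw [Pi.single_eq_of_ne hj, Pi.single_eq_of_ne hj, mul_zero]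
  have s5 : ∀ c d, ψ (φ (k q ^ c * L q ^ d)) (Pi.single 0 1) = Pi.single 0 (x ^ c * y ^ d) := by
    intro c d
    induction c with
    | zero =>
      induction d with
      | zero => simp
      | succ d ih =>
        rw [pow_succ' (L q), pow_zero, one_mul, map_mul, map_mul, Module.End.mul_apply]
        rw [pow_zero, one_mul] at ih
        rw [ih, s4]; congr 1; ring
    | succ c ih =>
      rw [pow_succ' (k q), mul_assoc, map_mul, map_mul, Module.End.mul_apply, ih, s3]
      congr 1; ring
  have s6 : ∀ (n : ℕ) t, ψ (φ (e q ^ n)) (Pi.single 0 t) = Pi.single (n : ℤ) t := by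
    intro n t
    induction n with
    | zero => simp
    | succ n ih =>
      rw [pow_succ', map_mul, map_mul, Module.End.mul_apply, ih, s1]; simp
  have s7 : ∀ (n : ℕ), ∃ s : A, s ≠ 0 ∧ ∀ t,
      ψ (φ (f q ^ n)) (Pi.single 0 t) = Pi.single (-(n : ℤ)) (s * t) := by
    intro n
    induction n with
    | zero => exact ⟨1, one_ne_zero, fun t => by simp⟩
    | succ n ih =>
      obtain ⟨s, hs, h⟩ := ih
      refine ⟨p (-(n : ℤ) - 1) * s, mul_ne_zero (hp0 _) hs, fun t => ?_⟩
      rw [pow_succ', map_mul, map_mul, Module.End.mul_apply, h, s2, ← mul_assoc]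
      rw [show -((n + 1 : ℕ) : ℤ) = -(n : ℤ) - 1 by push_cast; ring]
  have s8 : ∀ a : ℤ, ∃ s : A, s ≠ 0 ∧ ∀ cd : ℕ × ℕ,
      ψ (φ (mono q ⟨a, cd⟩)) (Pi.single 0 1) = Pi.single a (s * (x ^ cd.1 * y ^ cd.2)) := by
    intro a
    cases a with
    | ofNat n =>
      refine ⟨1, one_ne_zero, fun cd => ?_⟩
      change ψ (φ (e q ^ n * (k q ^ cd.1 * L q ^ cd.2))) (Pi.single 0 1) = _
      rw [map_mul, map_mul, Module.End.mul_apply, s5, s6, one_mul]; rfl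
    | negSucc n =>
      obtain ⟨s, hs, h⟩ := s7 (n + 1)
      refine ⟨s, hs, fun cd => ?_⟩
      change ψ (φ (f q ^ (n + 1) * (k q ^ cd.1 * L q ^ cd.2))) (Pi.single 0 1) = _
      rw [map_mul, map_mul, Module.End.mul_apply, s5, h]; rfl
  choose s hs hs' using s8
  have hmon : LinearIndependent 𝕜 fun cd : ℕ × ℕ => x ^ cd.1 * y ^ cd.2 := by
    have := linearIndependent_monomials (𝕜 := 𝕜) |>.map' (Algebra.linearMap R A |>.restrictScalars 𝕜)
      (LinearMap.ker_eq_bot.2 hinj)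
    have he : (fun cd : ℕ × ℕ => x ^ cd.1 * y ^ cd.2) =
        ⇑(Algebra.linearMap R A |>.restrictScalars 𝕜) ∘ fun cd : ℕ × ℕ =>
          (MvPolynomial.X 0 ^ cd.1 * MvPolynomial.X 1 ^ cd.2 : MvPolynomial (Fin 2) 𝕜) := by
      funext cd
      change _ = algebraMap R A _
      rw [map_mul, map_pow, map_pow]
    rw [he]
    exact this
  have hli : LinearIndependent 𝕜 fun ji : Σ _ : ℤ, ℕ × ℕ =>
      (Pi.single ji.1 (s ji.1 * (x ^ ji.2.1 * y ^ ji.2.2)) : ℤ → A) :=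
    Pi.linearIndependent_single (fun a (cd : ℕ × ℕ) => s a * (x ^ cd.1 * y ^ cd.2)) fun a =>
      hmon.map' (LinearMap.mulLeft 𝕜 (s a))
        (LinearMap.ker_eq_bot.2 fun u v h => mul_left_cancel₀ (hs a) h)
  rw [injective_iff_map_eq_zero]
  intro u hu
  have hmem : u ∈ Submodule.span 𝕜 (Set.range (mono q)) := by rw [span_mono]; trivial
  obtain ⟨c, rfl⟩ := Finsupp.mem_span_range_iff_exists_finsupp.1 hmem
  have h0 : ψ (φ (c.sum fun i a => a • mono q i)) (Pi.single 0 1) = 0 := by rw [hu]; simp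
  have hc : c = 0 := by
    rw [linearIndependent_iff] at hli
    apply hli
    rw [Finsupp.linearCombination_apply, ← h0]
    simp only [Finsupp.sum, map_sum, map_smul, LinearMap.sum_apply, LinearMap.smul_apply, hs']
  rw [hc, Finsupp.sum_zero_index]

end IPres

/-! ### The subalgebra `I_R` and the coaction `τ_R` -/

variable (q : 𝕜ˣ)

/-- The subalgebra `I_R` of `U_q(sl₂)` generated by `EK⁻¹`, `F`, `K⁻¹` and `Λ`. -/
def IR : Subalgebra 𝕜 (Uq q) :=
  Algebra.adjoin 𝕜 {Uq.E q * Uq.Kinv q, Uq.F q, Uq.Kinv q, Uq.Casimir q}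

namespace IR
/-- `EK⁻¹` as an element of `I_R`. -/
def e : IR q := ⟨Uq.E q * Uq.Kinv q, Algebra.subset_adjoin (by simp)⟩
/-- `F` as an element of `I_R`. -/
def f : IR q := ⟨Uq.F q, Algebra.subset_adjoin (by simp)⟩
/-- `K⁻¹` as an element of `I_R`. -/
def k : IR q := ⟨Uq.Kinv q, Algebra.subset_adjoin (by simp)⟩
/-- `Λ` as an element of `I_R`. -/
def L : IR q := ⟨Uq.Casimir q, Algebra.subset_adjoin (by simp)⟩
end IR

variable {q}

lemma sq_sub_one_ne_zero (hq : ¬ IsOfFinOrder q) : (q : 𝕜) ^ 2 - 1 ≠ 0 := by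
  intro h
  refine hq (isOfFinOrder_iff_pow_eq_one.2 ⟨2, by norm_num, ?_⟩)
  ext
  push_cast
  exact sub_eq_zero.1 h

lemma exists_equivIR (hq : ¬ IsOfFinOrder q) : ∃ φ : IPres q ≃ₐ[𝕜] IR q,
    φ (IPres.e q) = IR.e q ∧ φ (IPres.f q) = IR.f q ∧ φ (IPres.k q) = IR.k q ∧
      φ (IPres.L q) = IR.L q := by
  obtain ⟨φ, he, hf, hk, hL⟩ := IPres.exists_toUq q (sq_sub_one_ne_zero hq)
  have hinj := IPres.toUq_injective q (sq_sub_one_ne_zero hq) φ he hf hk hL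
  have hmem : ∀ u, φ u ∈ IR q := by
    refine IPres.gen_induction q (fun r => ?_) ?_ ?_ ?_ ?_ (fun a b ha hb => ?_) (fun a b ha hb => ?_)
    · rw [AlgHom.commutes]; exact Subalgebra.algebraMap_mem _ r
    · rw [he]; exact (IR.e q).2
    · rw [hf]; exact (IR.f q).2
    · rw [hk]; exact (IR.k q).2
    · rw [hL]; exact (IR.L q).2
    · rw [map_add]; exact add_mem ha hb
    · rw [map_mul]; exact mul_mem ha hb
  have hrange : IR q ≤ φ.range := by
    refine Algebra.adjoin_le ?_
    rintro x (rfl | rfl | rfl | rfl)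
    exacts [⟨_, he⟩, ⟨_, hf⟩, ⟨_, hk⟩, ⟨_, hL⟩]
  refine ⟨AlgEquiv.ofBijective (φ.codRestrict (IR q) hmem) ⟨fun a b h => hinj ?_, fun y => ?_⟩,
    Subtype.ext he, Subtype.ext hf, Subtype.ext hk, Subtype.ext hL⟩
  · exact congrArg Subtype.val h
  · obtain ⟨u, hu⟩ := hrange y.2
    exact ⟨u, Subtype.ext hu⟩

open TensorProduct in
/-- There is an algebra morphism `I_R → U_q(sl₂) ⊗ I_R` with the given values on the generators. -/
theorem exists_tauR (hq : ¬ IsOfFinOrder q) : ∃ τ : IR q →ₐ[𝕜] Uq q ⊗[𝕜] IR q,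
    τ (IR.e q) = Uq.Kinv q ⊗ₜ IR.e q ∧
    τ (IR.f q) = Uq.K q ⊗ₜ IR.f q
      - (((q : 𝕜)⁻¹) ^ 3 * ((q : 𝕜) - (q : 𝕜)⁻¹) ^ 2) • ((Uq.F q ^ 2 * Uq.K q) ⊗ₜ IR.e q)
      + ((q : 𝕜)⁻¹ * ((q : 𝕜) + (q : 𝕜)⁻¹)) • ((Uq.F q * Uq.K q) ⊗ₜ IR.k q)
      - (q : 𝕜)⁻¹ • ((Uq.F q * Uq.K q) ⊗ₜ IR.L q) ∧
    τ (IR.k q) = 1 ⊗ₜ IR.k q - ((q : 𝕜)⁻¹ * ((q : 𝕜) - (q : 𝕜)⁻¹) ^ 2) • (Uq.F q ⊗ₜ IR.e q) ∧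
    τ (IR.L q) = 1 ⊗ₜ IR.L q := by
  obtain ⟨φ, he, hf, hk, hL⟩ := exists_equivIR hq
  obtain ⟨σ, se, sf, sk, sL⟩ := IPres.exists_tau q (sq_sub_one_ne_zero hq)
  refine ⟨((Algebra.TensorProduct.map (AlgHom.id 𝕜 (Uq q)) φ.toAlgHom).comp σ).comp
    φ.symm.toAlgHom, ?_, ?_, ?_, ?_⟩
  · simp [← he, se]
  · simp only [← he, ← hf, ← hk, ← hL]
    simp [sf]
  · simp only [← he, ← hk]
    simp [sk]
  · simp [← hL, sL]

open TensorProduct in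
/-- `I_R` is a left coideal subalgebra: `Δ` restricts to `I_R → U_q(sl₂) ⊗ I_R`. -/
theorem exists_comulR : ∃ δ : IR q →ₐ[𝕜] Uq q ⊗[𝕜] IR q,
    ∀ x : IR q, Algebra.TensorProduct.map (AlgHom.id 𝕜 (Uq q)) (IR q).val (δ x) =
      Uq.comul q (x : Uq q) := by
  set ι := Algebra.TensorProduct.map (AlgHom.id 𝕜 (Uq q)) (IR q).val with hι
  have hinj : Function.Injective ι :=
    Module.Flat.lTensor_preserves_injective_linearMap (M := Uq q) (IR q).val.toLinearMap
      Subtype.val_injective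
  have hmem : ∀ x : IR q, Uq.comul q (x : Uq q) ∈ ι.range := by
    have hle : IR q ≤ ι.range.comap (Uq.comul q) := by
      refine Algebra.adjoin_le ?_
      rintro x (rfl | rfl | rfl | rfl)
      · refine ⟨(Uq.E q * Uq.Kinv q) ⊗ₜ IR.k q + 1 ⊗ₜ IR.e q, ?_⟩
        simp [hι, IR.k, IR.e, add_mul, Uq.K_mul_Kinv]
      · refine ⟨Uq.F q ⊗ₜ IR.k q + 1 ⊗ₜ IR.f q, ?_⟩
        simp [hι, IR.k, IR.f]
      · refine ⟨Uq.Kinv q ⊗ₜ IR.k q, ?_⟩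
        simp [hι, IR.k]
      · refine ⟨Uq.Casimir q ⊗ₜ IR.k q + Uq.K q ⊗ₜ IR.L q
          - ((q : 𝕜) + (q : 𝕜)⁻¹) • (Uq.K q ⊗ₜ IR.k q)
          + ((q : 𝕜) - (q : 𝕜)⁻¹) ^ 2 • (Uq.E q ⊗ₜ IR.f q +
            ((q : 𝕜)⁻¹) ^ 2 • ((Uq.F q * Uq.K q) ⊗ₜ IR.e q)), ?_⟩
        have hq := q.ne_zero
        change ι _ = Uq.comul q (Uq.Casimir q)
        simp only [hι, IR.k, IR.e, IR.f, IR.L, map_add, map_sub, map_smul,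
          Algebra.TensorProduct.map_tmul, AlgHom.id_apply, Subalgebra.coe_val, Uq.Casimir,
          map_mul, Uq.comul_E, Uq.comul_F, Uq.comul_K, Uq.comul_Kinv, mul_add, add_mul,
          Algebra.TensorProduct.tmul_mul_tmul, one_mul, mul_one, Uq.K_mul_F, tmul_add, add_tmul,
          ← smul_tmul', tmul_smul, smul_add, smul_smul]
        match_scalars <;> ring
    exact fun x => hle x.2
  refine ⟨(AlgEquiv.ofInjective ι hinj).symm.toAlgHom.comp
    (((Uq.comul q).comp (IR q).val).codRestrict ι.range hmem), fun x => ?_⟩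
  exact congrArg Subtype.val ((AlgEquiv.ofInjective ι hinj).apply_symm_apply _)

open TensorProduct in
/-- The coaction `τ_R : I_R → U_q(sl₂) ⊗ I_R`: the algebra morphism that takes the prescribed values
on the generators `EK⁻¹`, `F`, `K⁻¹`, `Λ` of `I_R` (see `tauR_spec`; these determine it). -/
def tauR (hq : ¬ IsOfFinOrder q) : IR q →ₐ[𝕜] Uq q ⊗[𝕜] IR q := Classical.choose (exists_tauR hq)

open TensorProduct in
theorem tauR_spec (hq : ¬ IsOfFinOrder q) :
    tauR hq (IR.e q) = Uq.Kinv q ⊗ₜ IR.e q ∧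
    tauR hq (IR.f q) = Uq.K q ⊗ₜ IR.f q
      - (((q : 𝕜)⁻¹) ^ 3 * ((q : 𝕜) - (q : 𝕜)⁻¹) ^ 2) • ((Uq.F q ^ 2 * Uq.K q) ⊗ₜ IR.e q)
      + ((q : 𝕜)⁻¹ * ((q : 𝕜) + (q : 𝕜)⁻¹)) • ((Uq.F q * Uq.K q) ⊗ₜ IR.k q)
      - (q : 𝕜)⁻¹ • ((Uq.F q * Uq.K q) ⊗ₜ IR.L q) ∧
    tauR hq (IR.k q) = 1 ⊗ₜ IR.k q
      - ((q : 𝕜)⁻¹ * ((q : 𝕜) - (q : 𝕜)⁻¹) ^ 2) • (Uq.F q ⊗ₜ IR.e q) ∧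
    tauR hq (IR.L q) = 1 ⊗ₜ IR.L q :=
  Classical.choose_spec (exists_tauR hq)

/-- An algebra morphism out of `I_R` is determined by its values on the four generators. -/
theorem IR.algHom_ext {C : Type*} [Semiring C] [Algebra 𝕜 C] {σ τ : IR q →ₐ[𝕜] C}
    (he : σ (IR.e q) = τ (IR.e q)) (hf : σ (IR.f q) = τ (IR.f q)) (hk : σ (IR.k q) = τ (IR.k q))
    (hL : σ (IR.L q) = τ (IR.L q)) : σ = τ := by
  refine AlgHom.adjoin_ext (s := {Uq.E q * Uq.Kinv q, Uq.F q, Uq.Kinv q, Uq.Casimir q}) ?_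
  rintro x (rfl | rfl | rfl | rfl)
  exacts [he, hf, hk, hL]

open TensorProduct in
variable (q) in
/-- The restriction of `Δ` to `I_R`, as a map `I_R → U_q(sl₂) ⊗ I_R` (see `comulR_spec`). -/
def comulR : IR q →ₐ[𝕜] Uq q ⊗[𝕜] IR q := Classical.choose (exists_comulR (q := q))

open TensorProduct in
theorem comulR_spec (x : IR q) :
    Algebra.TensorProduct.map (AlgHom.id 𝕜 (Uq q)) (IR q).val (comulR q x) =
      Uq.comul q (x : Uq q) :=
  Classical.choose_spec (exists_comulR (q := q)) x

/-! ### Tensor powers -/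

variable (q) in
/-- `U_q(sl₂)^{⊗n}`, with the algebra structure of Mathlib. Position `i + 1` of the usual numbering
`1, …, n` of the tensor factors is `i : Fin n`. -/
abbrev Tens (n : ℕ) : Type _ := ⨂[𝕜] _ : Fin n, Uq q

lemma extend_update {m n : ℕ} (g : Fin m ↪ Fin n) (x : Fin m → Uq q) (i : Fin m) (a : Uq q) :
    Function.extend g (Function.update x i a) 1 =
      Function.update (Function.extend g x 1) (g i) a := by
  funext j
  by_cases hj : ∃ i', g i' = j
  · obtain ⟨i', rfl⟩ := hj
    rw [g.injective.extend_apply]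
    by_cases h : i' = i
    · subst h; simp
    · rw [Function.update_of_ne h, Function.update_of_ne (g.injective.ne h),
        g.injective.extend_apply]
  · rw [Function.extend_apply' _ _ _ hj, Function.update_of_ne (fun h => hj ⟨i, h.symm⟩),
      Function.extend_apply' _ _ _ hj]

/-- The algebra morphism `U_q(sl₂)^{⊗m} → U_q(sl₂)^{⊗n}` that puts the `i`-th factor in position
`g i` and fills the remaining positions with `1`. -/
def place {m n : ℕ} (g : Fin m ↪ Fin n) : Tens q m →ₐ[𝕜] Tens q n :=
  PiTensorProduct.liftAlgHom
    (MultilinearMap.mk' (fun x => PiTensorProduct.tprod 𝕜 (Function.extend g x 1))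
      (fun x i a b => by simp only [extend_update, MultilinearMap.map_update_add])
      (fun x i c a => by simp only [extend_update, MultilinearMap.map_update_smul]))
    (congrArg (PiTensorProduct.tprod 𝕜) (Function.extend_one g))
    (fun x y => by
      have h := Function.extend_mul g x y (1 : Fin n → Uq q) 1
      rw [mul_one] at h
      simp [h])

lemma place_tprod {m n : ℕ} (g : Fin m ↪ Fin n) (x : Fin m → Uq q) :
    place g (PiTensorProduct.tprod 𝕜 x) = PiTensorProduct.tprod 𝕜 (Function.extend g x 1) :=
  PiTensorProduct.lift.tprod _

open TensorProduct in
variable (q) in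
/-- The canonical morphism `U_q(sl₂)^{⊗m} ⊗ U_q(sl₂) → U_q(sl₂)^{⊗(m+1)}`. -/
def snoc (m : ℕ) : Tens q m ⊗[𝕜] Uq q →ₐ[𝕜] Tens q (m + 1) :=
  Algebra.TensorProduct.lift (place Fin.castSuccEmb)
    (PiTensorProduct.singleAlgHom (A := fun _ : Fin (m + 1) => Uq q) (Fin.last m)) (by
      intro x y
      induction x using PiTensorProduct.induction_on with
      | smul_tprod r x =>
        rw [map_smul, place_tprod, Algebra.smul_def]
        refine Commute.mul_left (Algebra.commute_algebraMap_left r _) (Commute.tprod ?_)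
        refine Pi.commute_iff.2 fun j => ?_
        refine Fin.lastCases ?_ (fun j => ?_) j
        · rw [Function.extend_apply' _ _ _ (fun ⟨i, hi⟩ => Fin.castSucc_ne_last i hi)]
          exact Commute.one_left _
        · simp [Pi.mulSingle_eq_of_ne (Fin.castSucc_ne_last j)]
      | add x x' hx hx' => rw [map_add]; exact hx.add_left hx')

lemma snoc_tmul_tprod (m : ℕ) (x : Fin m → Uq q) (y : Uq q) :
    snoc q m (PiTensorProduct.tprod 𝕜 x ⊗ₜ y) =
      PiTensorProduct.tprod 𝕜 (Fin.snoc (α := fun _ => Uq q) x y) := by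
  simp only [snoc, Algebra.TensorProduct.lift_tmul, place_tprod,
    PiTensorProduct.singleAlgHom_apply, PiTensorProduct.tprod_mul_tprod]
  congr 1
  funext j
  refine Fin.lastCases ?_ (fun j => ?_) j
  · rw [Pi.mul_apply, Function.extend_apply' _ _ _ (fun ⟨i, hi⟩ => Fin.castSucc_ne_last i hi)]
    simp
  · have h := Fin.castSuccEmb.injective.extend_apply x (1 : Fin (m + 1) → Uq q) j
    simp only [Fin.coe_castSuccEmb] at h
    simp [h, Pi.mulSingle_eq_of_ne (Fin.castSucc_ne_last j)]

/-! ### The right extension process -/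

open TensorProduct in
/-- `1^{⊗m} ⊗ β : U_q(sl₂)^{⊗m} ⊗ I_R → U_q(sl₂)^{⊗(m+1)} ⊗ I_R` for
`β : I_R → U_q(sl₂) ⊗ I_R`. -/
def extendBy (β : IR q →ₐ[𝕜] Uq q ⊗[𝕜] IR q) (m : ℕ) :
    Tens q m ⊗[𝕜] IR q →ₐ[𝕜] Tens q (m + 1) ⊗[𝕜] IR q :=
  (Algebra.TensorProduct.map (snoc q m) (AlgHom.id 𝕜 (IR q))).comp
    ((Algebra.TensorProduct.assoc 𝕜 𝕜 𝕜 (Tens q m) (Uq q) (IR q)).symm.toAlgHom.comp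
      (Algebra.TensorProduct.map (AlgHom.id 𝕜 (Tens q m)) β))

open TensorProduct in
/-- The successive stages of the right extension process for a set `S = {a₁ < a₂ < ⋯}` of naturals
with minimum `a = a₁`. It starts from `Λ ∈ I_R`, and the step from stage `ℓ` to stage `ℓ + 1` is
`1^{⊗ℓ} ⊗ Δ` if `a + ℓ ∈ S` and `1^{⊗ℓ} ⊗ τ_R` otherwise. So the steps
`ℓ = a_{i-1} - a₁, …, a_i - a₁ - 1` compose to
`μ_i = (1^{⊗(a_i-a₁-1)} ⊗ τ_R) ⋯ (1^{⊗(a_{i-1}-a₁+1)} ⊗ τ_R) (1^{⊗(a_{i-1}-a₁)} ⊗ Δ)`,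
and stage `a_m - a₁` is `μ_m ⋯ μ₂ (Λ)`. -/
def stage (hq : ¬ IsOfFinOrder q) (S : Finset ℕ) (a : ℕ) : (ℓ : ℕ) → Tens q ℓ ⊗[𝕜] IR q
  | 0 => 1 ⊗ₜ IR.L q
  | ℓ + 1 => extendBy (if a + ℓ ∈ S then comulR q else tauR hq) ℓ (stage hq S a ℓ)

/-- The positions `i ↦ a + i` in `Fin n` of a block that starts in `a` and ends in `b`. -/
def block {n : ℕ} (a b : Fin n) (h : a ≤ b) : Fin ((b : ℕ) - a + 1) ↪ Fin n where
  toFun i := ⟨a + i, by have := i.2; have := b.2; have : (a : ℕ) ≤ b := h; omega⟩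
  inj' i j hij := by
    have := congrArg Fin.val hij
    exact Fin.ext (by simpa using this)

/-- The generator `Λ_A ∈ U_q(sl₂)^{⊗n}` for `A ⊆ {1, …, n}` (as a set of positions in `Fin n`):
`Λ_∅ = q + q⁻¹`, and otherwise `Λ_A = 1^{⊗(a₁-1)} ⊗ μ_m ⋯ μ₂ (Λ) ⊗ 1^{⊗(n-a_m)}` with
`a₁ = min A` and `a_m = max A`. -/
def Lambda (hq : ¬ IsOfFinOrder q) {n : ℕ} (A : Finset (Fin n)) : Tens q n :=
  if h : A.Nonempty then
    place (block (A.min' h) (A.max' h) (A.min'_le_max' h))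
      (snoc q _ (Algebra.TensorProduct.map (AlgHom.id 𝕜 _) (IR q).val
        (stage hq (A.map Fin.valEmbedding) (A.min' h) ((A.max' h : ℕ) - A.min' h))))
  else algebraMap 𝕜 _ ((q : 𝕜) + (q : 𝕜)⁻¹)

end AskeyWilson

end

/-!
# Commutation of the generators `Λ_A` of the higher rank Askey–Wilson algebra

The coaction `τ_R` is conjugation by the inverse of an `R`-matrix. Algebraically this means the
following. Let `δ` be the skew derivation `y ↦ K (y EK⁻¹ - EK⁻¹ y)` and let `D_i = cⁱ δⁱ / [i]!`
be its `q`-divided powers. An element `y` of weight `j` goes to `K⁻ʲ ⊗ y` in the weight coaction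
`ω`. Then `Θ(y) = ∑ᵢ ((FK)ⁱ ⊗ 1) ω(D_i y)` is a finite sum for every `y ∈ I_R`, and `τ_R = Θ` on
`I_R` (`exists_theta_eq_tauR`): by the `q`-Leibniz rule `divPow_mul`, the map `Θ` is
multiplicative (`theta_mul`), so it is enough to compare values on generators.

The skew derivation and the weight coaction make sense on every tensor power `U_q(sl₂)^{⊗m} ⊗
I_R`, where `U_q(sl₂)` acts through the iterated coproduct, and `Θ` is natural (`theta_natural`).
Since both `Δ` and `τ_R` are equivariant for all of this structure (`comulR_equivariant`,
`tauR_equivariant`), `Θ` commutes with the steps of the extension process that defines `Λ_A`.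
Write `Λ_A` as a word in letters `Δ` (positions in `A`) and `τ_R` (positions outside `A`). Then
`Θ`, applied to the factors from position `p` on, inserts a letter `τ_R` in position `p`, or a
factor `1` if the word ends before `p` (`exists_theta_wordElt`).

Now let `B ⊆ A`. A position `p ∉ A` before `max A` is a position outside `B` as well, so both
`Λ_A` and `Λ_B` are images, under the same multiplicative map, of elements of the same kind with
one tensor factor less. By induction it is enough to treat a set `A` without holes. There `Λ_A` is
the image of the Casimir element under the iterated coproduct (`word_eq_extHom`), while `Λ_B` is
invariant under conjugation by `K` and is killed by the skew derivations of `EK⁻¹` and `F`,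
because `Λ` is and the letters are equivariant. So `Λ_B` commutes with the image of the iterated
coproduct of `U_q(sl₂)`, and in particular with `Λ_A` (`commute_wordElt_of_forall`).
-/

noncomputable section

namespace AskeyWilson

open scoped TensorProduct

variable {𝕜 : Type*} [Field 𝕜]

/-! ### Skew derivations and `q`-divided powers -/

/-- The `q`-number `1 + t + ⋯ + t ^ (n - 1)` with `t = q⁻²`. -/
def qNum (q : 𝕜ˣ) (n : ℕ) : 𝕜 := ∑ i ∈ Finset.range n, (((q : 𝕜)⁻¹) ^ 2) ^ i

/-- The coefficients `cⁿ / [n]!` with `c = q⁻² (q - q⁻¹)` and `[n] = qNum q n`. The constant `c`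
is the one for which the series `theta` takes the same value on `K⁻¹` as `τ_R`. -/
def qCoeff (q : 𝕜ˣ) : ℕ → 𝕜
  | 0 => 1
  | n + 1 => (qNum q (n + 1))⁻¹ * (((q : 𝕜)⁻¹) ^ 2 * ((q : 𝕜) - (q : 𝕜)⁻¹)) * qCoeff q n

variable {q : 𝕜ˣ}

lemma qNum_add (m n : ℕ) : qNum q (m + n) = qNum q m + (((q : 𝕜)⁻¹) ^ 2) ^ m * qNum q n := by
  simp only [qNum, Finset.sum_range_add, Finset.mul_sum, pow_add]

lemma qNum_ne_zero (hq : ¬ IsOfFinOrder q) (n : ℕ) : qNum q (n + 1) ≠ 0 := by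
  intro h
  have h1 := geom_sum_mul (((q : 𝕜)⁻¹) ^ 2) (n + 1)
  rw [show ∑ i ∈ Finset.range (n + 1), (((q : 𝕜)⁻¹) ^ 2) ^ i = 0 from h, zero_mul] at h1
  refine hq (isOfFinOrder_iff_pow_eq_one.2 ⟨2 * (n + 1), by omega, ?_⟩)
  ext
  have h2 : ((q : 𝕜)⁻¹) ^ (2 * (n + 1)) = 1 := by rw [pow_mul]; exact (sub_eq_zero.1 h1.symm)
  rw [inv_pow, inv_eq_one] at h2
  simpa using h2

section
variable {M : Type*} [Ring M] [Algebra 𝕜 M]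

/-- The `q`-divided power `cⁿ δⁿ / [n]!` of a linear map `δ`. -/
def divPow (q : 𝕜ˣ) {X : Type*} [AddCommGroup X] [Module 𝕜 X] (δ : X →ₗ[𝕜] X) (n : ℕ)
    (x : X) : X :=
  qCoeff q n • (δ ^ n) x

lemma divPow_succ (hq : ¬ IsOfFinOrder q) (δ : M →ₗ[𝕜] M) (n : ℕ) (x : M) :
    (((q : 𝕜)⁻¹) ^ 2 * ((q : 𝕜) - (q : 𝕜)⁻¹)) • δ (divPow q δ n x) =
      qNum q (n + 1) • divPow q δ (n + 1) x := by
  simp only [divPow, qCoeff, map_smul, smul_smul, pow_succ', Module.End.mul_apply]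
  congr 1
  have := qNum_ne_zero hq n
  field_simp

lemma skew_comm_pow (σ : M →ₐ[𝕜] M) (δ : M →ₗ[𝕜] M)
    (hσ : ∀ x, δ (σ x) = ((q : 𝕜)⁻¹) ^ 2 • σ (δ x)) (j : ℕ) (x : M) :
    δ ((σ ^ j) x) = (((q : 𝕜)⁻¹) ^ 2) ^ j • (σ ^ j) (δ x) := by
  induction j with
  | zero => simp
  | succ j ih => rw [pow_succ' σ, AlgHom.mul_apply, hσ, ih, map_smul, smul_smul, ← pow_succ',
      AlgHom.mul_apply]

/-- The `q`-Leibniz rule: the divided powers of a skew derivation form a twisted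
higher derivation. -/
lemma divPow_mul (hq : ¬ IsOfFinOrder q) (σ : M →ₐ[𝕜] M) (δ : M →ₗ[𝕜] M)
    (hδ : ∀ x y, δ (x * y) = σ x * δ y + δ x * y)
    (hσ : ∀ x, δ (σ x) = ((q : 𝕜)⁻¹) ^ 2 • σ (δ x)) (n : ℕ) (x y : M) :
    divPow q δ n (x * y) = ∑ ij ∈ Finset.HasAntidiagonal.antidiagonal n,
      (σ ^ ij.2) (divPow q δ ij.1 x) * divPow q δ ij.2 y := by
  induction n with
  | zero => simp [divPow, qCoeff]
  | succ n ih =>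
    have h0 := qNum_ne_zero hq n
    refine smul_right_injective M h0 ?_
    change qNum q (n + 1) • _ = qNum q (n + 1) • _
    rw [← divPow_succ hq, ih, map_sum, Finset.smul_sum, Finset.smul_sum]
    have h1 : ∀ ij ∈ Finset.HasAntidiagonal.antidiagonal (n + 1),
        qNum q (n + 1) • ((σ ^ ij.2) (divPow q δ ij.1 x) * divPow q δ ij.2 y) =
        qNum q ij.2 • ((σ ^ ij.2) (divPow q δ ij.1 x) * divPow q δ ij.2 y) +
        ((((q : 𝕜)⁻¹) ^ 2) ^ ij.2 * qNum q ij.1) •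
          ((σ ^ ij.2) (divPow q δ ij.1 x) * divPow q δ ij.2 y) := by
      intro ij hij
      rw [← add_smul, ← qNum_add, add_comm ij.2, Finset.HasAntidiagonal.mem_antidiagonal.1 hij]
    rw [Finset.sum_congr rfl h1, Finset.sum_add_distrib, Finset.Nat.sum_antidiagonal_succ',
      Finset.Nat.sum_antidiagonal_succ]
    have h2 : qNum q 0 = 0 := by simp [qNum]
    simp only [h2, zero_smul, mul_zero, zero_add, ← Finset.sum_add_distrib]
    refine Finset.sum_congr rfl fun ij _ => ?_
    have h3 := congrArg (σ ^ ij.2) (divPow_succ hq δ ij.1 x)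
    rw [map_smul, map_smul] at h3
    rw [hδ, smul_add, ← mul_smul_comm, divPow_succ hq, skew_comm_pow σ δ hσ, mul_smul_comm,
      ← smul_mul_assoc _ _ (divPow q δ ij.2 y), smul_comm, h3, smul_smul, smul_mul_assoc,
      ← AlgHom.mul_apply, ← pow_succ']

/-- Multiplicativity of `x ↦ ∑ Gⁿ ω(D_n x)`, for `D_n` the divided powers of a skew derivation and
`G` implementing `σ` through `ω`, on elements with finitely many nonzero `D_n x`. -/
lemma sum_divPow_mul {W : Type*} [Ring W] [Algebra 𝕜 W] (hq : ¬ IsOfFinOrder q)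
    (σ : M →ₐ[𝕜] M) (δ : M →ₗ[𝕜] M)
    (hδ : ∀ x y, δ (x * y) = σ x * δ y + δ x * y)
    (hσ : ∀ x, δ (σ x) = ((q : 𝕜)⁻¹) ^ 2 • σ (δ x))
    (ω : M →ₐ[𝕜] W) (G : W) (hG : ∀ y, ω y * G = G * ω (σ y)) {m m' : ℕ} (hm : 2 * m ≤ m')
    {x y : M}
    (hx : ∀ i, m ≤ i → (δ ^ i) x = 0) (hy : ∀ i, m ≤ i → (δ ^ i) y = 0) :
    (∑ i ∈ Finset.range m, G ^ i * ω (divPow q δ i x)) *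
      (∑ i ∈ Finset.range m, G ^ i * ω (divPow q δ i y)) =
    ∑ i ∈ Finset.range m', G ^ i * ω (divPow q δ i (x * y)) := by
  have hGp : ∀ (j : ℕ) (y : M), ω y * G ^ j = G ^ j * ω ((σ ^ j) y) := by
    intro j
    induction j with
    | zero => simp
    | succ j ih =>
      intro y
      rw [pow_succ, ← mul_assoc, ih, mul_assoc, hG, ← mul_assoc, pow_succ' σ, AlgHom.mul_apply]
  have hx' : ∀ i, m ≤ i → divPow q δ i x = 0 := fun i hi => by rw [divPow, hx i hi, smul_zero]
  have hy' : ∀ i, m ≤ i → divPow q δ i y = 0 := fun i hi => by rw [divPow, hy i hi, smul_zero]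
  rw [Finset.sum_mul_sum, ← Finset.sum_product']
  simp only [divPow_mul hq σ δ hδ hσ, map_sum, map_mul, Finset.mul_sum]
  rw [Finset.sum_sigma']
  symm
  -- The term of `(n, (i, j))` on the right is the product of the terms of `i` and `j` on the left.
  -- The terms with `m ≤ i` or `m ≤ j` vanish, so that `n = i + j < 2 * m` for the others.
  refine Finset.sum_bij_ne_zero (fun a _ _ => a.2) ?_ ?_ ?_ ?_
  · rintro ⟨n, i, j⟩ h h'
    simp only [Finset.mem_product, Finset.mem_range]
    constructor
    · by_contra hi
      exact h' (by simp [hx' i (by omega)])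
    · by_contra hj
      exact h' (by simp [hy' j (by omega)])
  · rintro ⟨n, i, j⟩ h _ ⟨n', i', j'⟩ h' _ he
    simp only [Finset.mem_sigma, Finset.HasAntidiagonal.mem_antidiagonal, Prod.mk.injEq] at h h' he
    obtain ⟨rfl, rfl⟩ := he
    obtain rfl : n = n' := by omega
    rfl
  · rintro ⟨i, j⟩ h h'
    simp only [Finset.mem_product, Finset.mem_range] at h
    refine ⟨⟨i + j, i, j⟩, by simp; omega, ?_, rfl⟩
    intro h0
    refine h' ?_
    rw [← h0, mul_assoc, ← mul_assoc (ω _), hGp, pow_add]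
    simp only [mul_assoc]
  · rintro ⟨n, i, j⟩ h h'
    simp only [Finset.mem_sigma, Finset.HasAntidiagonal.mem_antidiagonal] at h
    rw [← h.2, mul_assoc (G ^ i), ← mul_assoc (ω _), hGp, pow_add]
    simp only [mul_assoc]

/-- Nilpotency for a product, from the `q`-Leibniz rule. -/
lemma pow_apply_mul_eq_zero (σ : M →ₐ[𝕜] M) (δ : M →ₗ[𝕜] M)
    (hδ : ∀ x y, δ (x * y) = σ x * δ y + δ x * y)
    (hσ : ∀ x, δ (σ x) = ((q : 𝕜)⁻¹) ^ 2 • σ (δ x)) (m n : ℕ) (x y : M)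
    (hx : (δ ^ m) x = 0) (hy : (δ ^ n) y = 0) : (δ ^ (m + n)) (x * y) = 0 := by
  induction hN : m + n generalizing m n x y with
  | zero =>
    obtain rfl : m = 0 := by omega
    simp_all
  | succ N ih =>
    have hσp : ∀ i : ℕ, ∀ x, (δ ^ i) x = 0 → (δ ^ i) (σ x) = 0 := by
      intro i
      have : ∀ x, (δ ^ i) (σ x) = (((q : 𝕜)⁻¹) ^ 2) ^ i • σ ((δ ^ i) x) := by
        induction i with
        | zero => simp
        | succ i ih => intro x; rw [pow_succ', Module.End.mul_apply, ih, map_smul, hσ, smul_smul,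
            ← pow_succ, ← Module.End.mul_apply, ← pow_succ']
      intro x hx
      rw [this, hx, map_zero, smul_zero]
    rw [pow_succ, Module.End.mul_apply, hδ, map_add]
    have h1 : (δ ^ N) (σ x * δ y) = 0 := by
      cases n with
      | zero => simp only [pow_zero, Module.End.one_apply] at hy; simp [hy]
      | succ n => exact ih m n _ _ (hσp m x hx) (by rwa [pow_succ] at hy) (by omega)
    have h2 : (δ ^ N) (δ x * y) = 0 := by
      cases m with
      | zero => simp only [pow_zero, Module.End.one_apply] at hx; simp [hx]
      | succ m => exact ih m n _ _ (by rwa [pow_succ] at hx) hy (by omega)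
    rw [h1, h2, add_zero]

end

/-! ### The weight coaction and the series `Θ` -/

/-- The morphism `𝕜[T, T⁻¹] → A` with `T ↦ u`. -/
def torusLift {A : Type*} [Ring A] [Algebra 𝕜 A] (u : Aˣ) : LaurentPolynomial 𝕜 →ₐ[𝕜] A :=
  AddMonoidAlgebra.lift 𝕜 A ℤ ((Units.coeHom A).comp (zpowersHom Aˣ u))

lemma torusLift_T {A : Type*} [Ring A] [Algebra 𝕜 A] (u : Aˣ) (n : ℤ) :
    torusLift (𝕜 := 𝕜) u (LaurentPolynomial.T n) = ((u ^ n : Aˣ) : A) := by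
  rw [torusLift, LaurentPolynomial.T, AddMonoidAlgebra.lift_single]
  simp

lemma torus_induction {P : LaurentPolynomial 𝕜 → Prop} (t : LaurentPolynomial 𝕜)
    (hc : ∀ r : 𝕜, P (algebraMap 𝕜 _ r)) (hadd : ∀ a b, P a → P b → P (a + b))
    (hmul : ∀ a b, P a → P b → P (a * b)) (h1 : P (LaurentPolynomial.T 1))
    (h2 : P (LaurentPolynomial.T (-1))) : P t := by
  induction t using LaurentPolynomial.induction_on with
  | h_C a => exact hc a
  | h_add ha hb => exact hadd _ _ ha hb
  | h_C_mul_T n a ih =>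
    rw [LaurentPolynomial.T_add, ← mul_assoc]; exact hmul _ _ ih h1
  | h_C_mul_T_Z n a ih =>
    rw [sub_eq_add_neg, LaurentPolynomial.T_add, ← mul_assoc]; exact hmul _ _ ih h2

variable (q)

/-- `K` as a unit. -/
def Kunit : (Uq q)ˣ := ⟨Uq.K q, Uq.Kinv q, Uq.K_mul_Kinv q, Uq.Kinv_mul_K q⟩

/-- The inclusion `𝕜[T, T⁻¹] → U_q(sl₂)`, `T ↦ K`. -/
def torusK : LaurentPolynomial 𝕜 →ₐ[𝕜] Uq q := torusLift (Kunit q)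

@[simp] lemma torusK_T_one : torusK q (LaurentPolynomial.T 1) = Uq.K q := by
  simp [torusK, torusLift_T, Kunit]

@[simp] lemma torusK_T_neg_one : torusK q (LaurentPolynomial.T (-1)) = Uq.Kinv q := by
  simp [torusK, torusLift_T, Kunit]

/-- The rescaling `T ↦ q⁻² T` of `𝕜[T, T⁻¹]`. -/
def torusScale : LaurentPolynomial 𝕜 →ₐ[𝕜] LaurentPolynomial 𝕜 :=
  torusLift ⟨((q : 𝕜)⁻¹) ^ 2 • LaurentPolynomial.T 1, (q : 𝕜) ^ 2 • LaurentPolynomial.T (-1),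
    by rw [smul_mul_smul_comm, ← LaurentPolynomial.T_add, ← mul_pow, inv_mul_cancel₀ q.ne_zero]
       simp,
    by rw [smul_mul_smul_comm, ← LaurentPolynomial.T_add, ← mul_pow, mul_inv_cancel₀ q.ne_zero]
       simp⟩

@[simp] lemma torusScale_T_one :
    torusScale q (LaurentPolynomial.T 1) = ((q : 𝕜)⁻¹) ^ 2 • LaurentPolynomial.T 1 := by
  simp [torusScale, torusLift_T]

@[simp] lemma torusScale_T_neg_one :
    torusScale q (LaurentPolynomial.T (-1)) = (q : 𝕜) ^ 2 • LaurentPolynomial.T (-1) := by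
  simp [torusScale, torusLift_T]

lemma torusK_mul_FK (t : LaurentPolynomial 𝕜) :
    torusK q t * (Uq.F q * Uq.K q) = (Uq.F q * Uq.K q) * torusK q (torusScale q t) := by
  induction t using torus_induction with
  | hc r => simp only [AlgHom.commutes]; exact Algebra.commutes _ _
  | hadd a b ha hb => simp only [map_add, add_mul, mul_add, ha, hb]
  | hmul a b ha hb => rw [map_mul, mul_assoc, hb, ← mul_assoc, ha, mul_assoc, map_mul, map_mul]
  | h1 => simp [Uq.K_mul_F', mul_assoc]
  | h2 => simp [Uq.Kinv_mul_F', Uq.K_mul_Kinv, Uq.Kinv_mul_K, mul_assoc]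

/-- Algebra morphisms out of `U_q(sl₂)` are determined by their values on the generators. -/
lemma Uq.algHom_ext {A : Type*} [Semiring A] [Algebra 𝕜 A] {φ ψ : Uq q →ₐ[𝕜] A}
    (hE : φ (E q) = ψ (E q)) (hF : φ (F q) = ψ (F q)) (hK : φ (K q) = ψ (K q))
    (hKi : φ (Kinv q) = ψ (Kinv q)) : φ = ψ := by
  refine RingQuot.ringQuot_ext' (S := 𝕜) (s := UqRel q) φ ψ
    (FreeAlgebra.hom_ext (funext fun x => ?_))
  cases x
  exacts [hE, hF, hK, hKi]

lemma exists_wtUq : ∃ ω : Uq q →ₐ[𝕜] LaurentPolynomial 𝕜 ⊗[𝕜] Uq q,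
    ω (Uq.E q) = LaurentPolynomial.T (-1) ⊗ₜ Uq.E q ∧
    ω (Uq.F q) = LaurentPolynomial.T 1 ⊗ₜ Uq.F q ∧
    ω (Uq.K q) = 1 ⊗ₜ Uq.K q ∧ ω (Uq.Kinv q) = 1 ⊗ₜ Uq.Kinv q := by
  apply Uq.exists_algHom q
  · simp [Uq.K_mul_Kinv, Algebra.TensorProduct.one_def]
  · simp [Uq.Kinv_mul_K, Algebra.TensorProduct.one_def]
  · simp [Uq.K_mul_E]
  · simp [Uq.K_mul_F]
  · simp only [Algebra.TensorProduct.tmul_mul_tmul, ← LaurentPolynomial.T_add, neg_add_cancel,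
      add_neg_cancel, LaurentPolynomial.T_zero, ← TensorProduct.tmul_sub, Uq.E_F,
      TensorProduct.tmul_smul]

/-- The weight coaction of `U_q(sl₂)`: an element of weight `j`, that is with `K x K⁻¹ = q²ʲ x`, is
sent to `T⁻ʲ ⊗ x`. -/
def wtUq : Uq q →ₐ[𝕜] LaurentPolynomial 𝕜 ⊗[𝕜] Uq q := Classical.choose (exists_wtUq q)

@[simp] lemma wtUq_E : wtUq q (Uq.E q) = LaurentPolynomial.T (-1) ⊗ₜ Uq.E q :=
  (Classical.choose_spec (exists_wtUq q)).1
@[simp] lemma wtUq_F : wtUq q (Uq.F q) = LaurentPolynomial.T 1 ⊗ₜ Uq.F q :=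
  (Classical.choose_spec (exists_wtUq q)).2.1
@[simp] lemma wtUq_K : wtUq q (Uq.K q) = 1 ⊗ₜ Uq.K q :=
  (Classical.choose_spec (exists_wtUq q)).2.2.1
@[simp] lemma wtUq_Kinv : wtUq q (Uq.Kinv q) = 1 ⊗ₜ Uq.Kinv q :=
  (Classical.choose_spec (exists_wtUq q)).2.2.2

variable {q}

section
variable {M : Type*} [Ring M] [Algebra 𝕜 M]

/-- Conjugation by `φ K`. -/
def conjK (φ : Uq q →ₐ[𝕜] M) : M →ₐ[𝕜] M :=
  AlgHom.ofLinearMap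
    (LinearMap.mulLeft 𝕜 (φ (Uq.K q)) ∘ₗ LinearMap.mulRight 𝕜 (φ (Uq.Kinv q)))
    (by simp [← map_mul, Uq.K_mul_Kinv])
    (fun x y => by
      simp only [LinearMap.comp_apply, LinearMap.mulLeft_apply, LinearMap.mulRight_apply, mul_assoc]
      rw [← mul_assoc (φ (Uq.Kinv q)) (φ (Uq.K q)), ← map_mul, Uq.Kinv_mul_K, map_one, one_mul])

lemma conjK_apply (φ : Uq q →ₐ[𝕜] M) (y : M) :
    conjK φ y = φ (Uq.K q) * (y * φ (Uq.Kinv q)) := rfl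

/-- The skew derivation `y ↦ φ(K) (y φ(u) - φ(u) y)`. -/
def skewDer (φ : Uq q →ₐ[𝕜] M) (u : Uq q) : M →ₗ[𝕜] M :=
  LinearMap.mulLeft 𝕜 (φ (Uq.K q)) ∘ₗ
    (LinearMap.mulRight 𝕜 (φ u) - LinearMap.mulLeft 𝕜 (φ u))

lemma skewDer_apply (φ : Uq q →ₐ[𝕜] M) (u : Uq q) (y : M) :
    skewDer φ u y = φ (Uq.K q) * (y * φ u - φ u * y) := rfl

lemma skewDer_mul (φ : Uq q →ₐ[𝕜] M) (u : Uq q) (x y : M) :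
    skewDer φ u (x * y) = conjK φ x * skewDer φ u y + skewDer φ u x * y := by
  have h (z : M) : φ (Uq.Kinv q) * (φ (Uq.K q) * z) = z := by
    rw [← mul_assoc, ← map_mul, Uq.Kinv_mul_K, map_one, one_mul]
  simp only [skewDer_apply, conjK_apply, mul_sub, sub_mul, mul_assoc, h]
  abel

lemma skewDer_conjK (φ : Uq q →ₐ[𝕜] M) (u : Uq q)
    (hu : Uq.K q * u = (q : 𝕜) ^ 2 • (u * Uq.K q)) (x : M) :
    skewDer φ u (conjK φ x) = ((q : 𝕜)⁻¹) ^ 2 • conjK φ (skewDer φ u x) := by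
  have hu1 : φ (Uq.K q) * φ u = (q : 𝕜) ^ 2 • (φ u * φ (Uq.K q)) := by
    rw [← map_mul, hu, map_smul, map_mul]
  have h (z : M) : φ (Uq.Kinv q) * (φ (Uq.K q) * z) = z := by
    rw [← mul_assoc, ← map_mul, Uq.Kinv_mul_K, map_one, one_mul]
  have h' (z : M) : φ (Uq.K q) * (φ (Uq.Kinv q) * z) = z := by
    rw [← mul_assoc, ← map_mul, Uq.K_mul_Kinv, map_one, one_mul]
  have h'' : φ (Uq.K q) * φ (Uq.Kinv q) = 1 := by rw [← map_mul, Uq.K_mul_Kinv, map_one]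
  have hu2 (z : M) : φ (Uq.K q) * (φ u * z) = (q : 𝕜) ^ 2 • (φ u * (φ (Uq.K q) * z)) := by
    rw [← mul_assoc, hu1, smul_mul_assoc, mul_assoc]
  have hu3 : φ u * φ (Uq.Kinv q) = (q : 𝕜) ^ 2 • (φ (Uq.Kinv q) * φ u) := by
    rw [← h (φ u * φ (Uq.Kinv q)), hu2, h'', mul_one, mul_smul_comm]
  have hq := q.ne_zero
  simp only [skewDer_apply, conjK_apply, mul_sub, sub_mul, mul_assoc, hu2, hu3, mul_smul_comm,
    smul_mul_assoc, smul_sub, smul_smul]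
  match_scalars <;> field_simp

/-- `EK⁻¹` in `U_q(sl₂)`. -/
abbrev Uq.EKinv (q : 𝕜ˣ) : Uq q := Uq.E q * Uq.Kinv q

lemma Uq.K_mul_EKinv : Uq.K q * Uq.EKinv q = (q : 𝕜) ^ 2 • (Uq.EKinv q * Uq.K q) := by
  simp [Uq.EKinv, mul_assoc, Uq.K_mul_E', Uq.K_mul_Kinv, Uq.Kinv_mul_K]

end

section theta
variable {X Y : Type*} [AddCommGroup X] [Module 𝕜 X] [AddCommGroup Y] [Module 𝕜 Y]

variable (q) in
/-- The truncated series `x ↦ ∑_{i < m} (FK)ⁱ ω(D_i x)`, where `D_i` are the `q`-divided powers of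
`δ` and `T` is replaced by `K` in the new tensor factor. It is the result of conjugating `1 ⊗ x`
with the inverse of an `R`-matrix: the powers of `FK` come from the quasi-`R`-matrix, and `K` from
the Cartan part. -/
def theta (δ : X →ₗ[𝕜] X) (ω : X →ₗ[𝕜] LaurentPolynomial 𝕜 ⊗[𝕜] X) (m : ℕ) :
    X →ₗ[𝕜] Uq q ⊗[𝕜] X :=
  ∑ i ∈ Finset.range m, qCoeff q i •
    (((LinearMap.mulLeft 𝕜 ((Uq.F q * Uq.K q) ^ i) ∘ₗ (torusK q).toLinearMap).rTensor X) ∘ₗ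
      ω ∘ₗ δ ^ i)

lemma pow_apply_natural {δ : X →ₗ[𝕜] X} {δ' : Y →ₗ[𝕜] Y} (g : X →ₗ[𝕜] Y)
    (h : ∀ x, g (δ x) = δ' (g x)) (i : ℕ) (x : X) : (δ' ^ i) (g x) = g ((δ ^ i) x) := by
  induction i with
  | zero => simp
  | succ i ih => rw [pow_succ', Module.End.mul_apply, ih, ← h, pow_succ', Module.End.mul_apply]

/-- `Θ` is natural in the space with its skew derivation and its weight coaction. -/
lemma theta_natural {δ : X →ₗ[𝕜] X} {ω : X →ₗ[𝕜] LaurentPolynomial 𝕜 ⊗[𝕜] X}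
    {δ' : Y →ₗ[𝕜] Y} {ω' : Y →ₗ[𝕜] LaurentPolynomial 𝕜 ⊗[𝕜] Y} (g : X →ₗ[𝕜] Y)
    (hδ : ∀ x, g (δ x) = δ' (g x)) (hω : ∀ x, g.lTensor _ (ω x) = ω' (g x)) (m : ℕ) (x : X) :
    theta q δ' ω' m (g x) = g.lTensor _ (theta q δ ω m x) := by
  simp only [theta, LinearMap.sum_apply, LinearMap.smul_apply, LinearMap.comp_apply, map_sum,
    map_smul, pow_apply_natural g hδ, ← hω]
  refine Finset.sum_congr rfl fun i _ => ?_
  congr 1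
  generalize ω ((δ ^ i) x) = z
  rw [← LinearMap.comp_apply, ← LinearMap.comp_apply, LinearMap.lTensor_comp_rTensor,
    LinearMap.rTensor_comp_lTensor]

/-- Passing to a larger truncation changes nothing once the powers of `δ` vanish. -/
lemma theta_eq_of_le {δ : X →ₗ[𝕜] X} {ω : X →ₗ[𝕜] LaurentPolynomial 𝕜 ⊗[𝕜] X} {m m' : ℕ}
    (h : m ≤ m') {x : X} (hx : ∀ i, m ≤ i → (δ ^ i) x = 0) :
    theta q δ ω m' x = theta q δ ω m x := by
  simp only [theta, LinearMap.sum_apply, LinearMap.smul_apply, LinearMap.comp_apply]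
  symm
  refine Finset.sum_subset (Finset.range_subset_range.2 h) fun i _ hi => ?_
  rw [hx i (by simpa using hi)]
  simp

end theta

section thetaMul
variable {M : Type*} [Ring M] [Algebra 𝕜 M]

lemma theta_eq_sum (δ : M →ₗ[𝕜] M) (ω : M →ₐ[𝕜] LaurentPolynomial 𝕜 ⊗[𝕜] M) (m : ℕ) (x : M) :
    theta q δ ω.toLinearMap m x = ∑ i ∈ Finset.range m, ((Uq.F q * Uq.K q) ⊗ₜ[𝕜] (1 : M)) ^ i *
      ((Algebra.TensorProduct.map (torusK q) (AlgHom.id 𝕜 M)).comp ω) (divPow q δ i x) := by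
  simp only [theta, LinearMap.sum_apply, LinearMap.smul_apply, LinearMap.comp_apply, divPow,
    map_smul, mul_smul_comm, AlgHom.comp_apply, AlgHom.toLinearMap_apply]
  refine Finset.sum_congr rfl fun i _ => ?_
  congr 1
  induction ω ((δ ^ i) x) using TensorProduct.induction_on with
  | zero => simp
  | tmul t y => simp
  | add a b ha hb => rw [map_add, map_add, mul_add, ha, hb]

/-- `Θ` is multiplicative on elements that are killed by a power of the skew derivation. -/
lemma theta_mul (hq : ¬ IsOfFinOrder q) (φ : Uq q →ₐ[𝕜] M)
    (ω : M →ₐ[𝕜] LaurentPolynomial 𝕜 ⊗[𝕜] M)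
    (hω : ∀ y, ω (conjK φ y) = Algebra.TensorProduct.map (torusScale q) (AlgHom.id 𝕜 M) (ω y))
    {m m' : ℕ} (hm : 2 * m ≤ m') {x y : M}
    (hx : ∀ i, m ≤ i → (skewDer φ (Uq.EKinv q) ^ i) x = 0)
    (hy : ∀ i, m ≤ i → (skewDer φ (Uq.EKinv q) ^ i) y = 0) :
    theta q (skewDer φ (Uq.EKinv q)) ω.toLinearMap m x *
      theta q (skewDer φ (Uq.EKinv q)) ω.toLinearMap m y =
    theta q (skewDer φ (Uq.EKinv q)) ω.toLinearMap m' (x * y) := by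
  simp only [theta_eq_sum]
  refine sum_divPow_mul hq (conjK φ) _ (skewDer_mul φ _) (skewDer_conjK φ _ Uq.K_mul_EKinv) _ _
    (fun y => ?_) hm hx hy
  rw [AlgHom.comp_apply, AlgHom.comp_apply, hω]
  induction ω y using TensorProduct.induction_on with
  | zero => simp
  | tmul t y => simp [torusK_mul_FK]
  | add a b ha hb => simp only [map_add, add_mul, mul_add, ha, hb]

end thetaMul

/-! ### Tensor products of weight coactions and of skew derivations -/

section wt
variable {M C M' C' D : Type*} [Ring M] [Algebra 𝕜 M] [Ring C] [Algebra 𝕜 C] [Ring M']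
  [Algebra 𝕜 M'] [Ring C'] [Algebra 𝕜 C'] [Ring D] [Algebra 𝕜 D]

/-- The morphism `(t ⊗ m) ⊗ (t' ⊗ c) ↦ t t' ⊗ (m ⊗ c)`. -/
def wtMerge (𝕜 M C : Type*) [Field 𝕜] [Ring M] [Algebra 𝕜 M] [Ring C] [Algebra 𝕜 C] :
    (LaurentPolynomial 𝕜 ⊗[𝕜] M) ⊗[𝕜] (LaurentPolynomial 𝕜 ⊗[𝕜] C) →ₐ[𝕜]
      LaurentPolynomial 𝕜 ⊗[𝕜] (M ⊗[𝕜] C) :=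
  (Algebra.TensorProduct.map (Algebra.TensorProduct.lmul' 𝕜) (AlgHom.id 𝕜 _)).comp
    (Algebra.TensorProduct.tensorTensorTensorComm 𝕜 𝕜 𝕜 𝕜 _ _ _ _).toAlgHom

@[simp] lemma wtMerge_tmul (t t' : LaurentPolynomial 𝕜) (m : M) (c : C) :
    wtMerge 𝕜 M C ((t ⊗ₜ m) ⊗ₜ (t' ⊗ₜ c)) = (t * t') ⊗ₜ (m ⊗ₜ c) := by
  simp [wtMerge]

/-- The diagonal weight coaction on a tensor product. -/
def wtTensor (ωM : M →ₐ[𝕜] LaurentPolynomial 𝕜 ⊗[𝕜] M)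
    (ωC : C →ₐ[𝕜] LaurentPolynomial 𝕜 ⊗[𝕜] C) :
    M ⊗[𝕜] C →ₐ[𝕜] LaurentPolynomial 𝕜 ⊗[𝕜] (M ⊗[𝕜] C) :=
  (wtMerge 𝕜 M C).comp (Algebra.TensorProduct.map ωM ωC)

lemma wtTensor_tmul (ωM : M →ₐ[𝕜] LaurentPolynomial 𝕜 ⊗[𝕜] M)
    (ωC : C →ₐ[𝕜] LaurentPolynomial 𝕜 ⊗[𝕜] C) (m : M) (c : C) :
    wtTensor ωM ωC (m ⊗ₜ c) = wtMerge 𝕜 M C (ωM m ⊗ₜ ωC c) := by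
  simp [wtTensor]

lemma wtMerge_natural (f : M →ₗ[𝕜] M') (g : C →ₗ[𝕜] C') (a : LaurentPolynomial 𝕜 ⊗[𝕜] M)
    (b : LaurentPolynomial 𝕜 ⊗[𝕜] C) :
    (TensorProduct.map f g).lTensor _ (wtMerge 𝕜 M C (a ⊗ₜ b)) =
      wtMerge 𝕜 M' C' (f.lTensor _ a ⊗ₜ g.lTensor _ b) := by
  induction a using TensorProduct.induction_on with
  | zero => simp
  | add a a' ha ha' => simp only [TensorProduct.add_tmul, map_add, ha, ha']
  | tmul t m =>
    induction b using TensorProduct.induction_on with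
    | zero => simp
    | add b b' hb hb' => simp only [TensorProduct.tmul_add, map_add, hb, hb']
    | tmul t' c => simp

lemma wtTensor_natural {ωM : M →ₐ[𝕜] LaurentPolynomial 𝕜 ⊗[𝕜] M}
    {ωC : C →ₐ[𝕜] LaurentPolynomial 𝕜 ⊗[𝕜] C} {ωM' : M' →ₐ[𝕜] LaurentPolynomial 𝕜 ⊗[𝕜] M'}
    {ωC' : C' →ₐ[𝕜] LaurentPolynomial 𝕜 ⊗[𝕜] C'} (f : M →ₗ[𝕜] M') (g : C →ₗ[𝕜] C')
    (hf : ∀ m, f.lTensor _ (ωM m) = ωM' (f m)) (hg : ∀ c, g.lTensor _ (ωC c) = ωC' (g c))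
    (x : M ⊗[𝕜] C) :
    (TensorProduct.map f g).lTensor _ (wtTensor ωM ωC x) =
      wtTensor ωM' ωC' (TensorProduct.map f g x) := by
  induction x using TensorProduct.induction_on with
  | zero => simp
  | add a b ha hb => simp only [map_add, ha, hb]
  | tmul m c => rw [wtTensor_tmul, wtMerge_natural, TensorProduct.map_tmul, wtTensor_tmul, hf, hg]

lemma wtTensor_assoc (ωM : M →ₐ[𝕜] LaurentPolynomial 𝕜 ⊗[𝕜] M)
    (ωC : C →ₐ[𝕜] LaurentPolynomial 𝕜 ⊗[𝕜] C) (ωD : D →ₐ[𝕜] LaurentPolynomial 𝕜 ⊗[𝕜] D)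
    (x : M ⊗[𝕜] (C ⊗[𝕜] D)) :
    (TensorProduct.assoc 𝕜 M C D).symm.toLinearMap.lTensor _ (wtTensor ωM (wtTensor ωC ωD) x) =
      wtTensor (wtTensor ωM ωC) ωD ((TensorProduct.assoc 𝕜 M C D).symm x) := by
  induction x using TensorProduct.induction_on with
  | zero => simp
  | add a b ha hb => simp only [map_add, ha, hb]
  | tmul m x =>
    induction x using TensorProduct.induction_on with
    | zero => simp
    | add a b ha hb => simp only [TensorProduct.tmul_add, map_add, ha, hb]
    | tmul c d =>
      rw [TensorProduct.assoc_symm_tmul, wtTensor_tmul, wtTensor_tmul, wtTensor_tmul, wtTensor_tmul]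
      induction ωM m using TensorProduct.induction_on with
      | zero => simp
      | add a b ha hb => simp only [TensorProduct.add_tmul, map_add, ha, hb]
      | tmul t m =>
        induction ωC c using TensorProduct.induction_on with
        | zero => simp
        | add a b ha hb =>
          simp only [TensorProduct.add_tmul, TensorProduct.tmul_add, map_add, ha, hb]
        | tmul t' c =>
          induction ωD d using TensorProduct.induction_on with
          | zero => simp
          | add a b ha hb => simp only [TensorProduct.tmul_add, map_add, ha, hb]
          | tmul t'' d => simp [mul_assoc]

lemma wtTensor_scale (q : 𝕜ˣ) {ωM : M →ₐ[𝕜] LaurentPolynomial 𝕜 ⊗[𝕜] M}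
    {ωC : C →ₐ[𝕜] LaurentPolynomial 𝕜 ⊗[𝕜] C} (σM : M →ₗ[𝕜] M) (σC : C →ₗ[𝕜] C)
    (hM : ∀ y, ωM (σM y) = Algebra.TensorProduct.map (torusScale q) (AlgHom.id 𝕜 M) (ωM y))
    (hC : ∀ y, ωC (σC y) = Algebra.TensorProduct.map (torusScale q) (AlgHom.id 𝕜 C) (ωC y))
    (x : M ⊗[𝕜] C) :
    wtTensor ωM ωC (TensorProduct.map σM σC x) =
      Algebra.TensorProduct.map (torusScale q) (AlgHom.id 𝕜 _) (wtTensor ωM ωC x) := by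
  induction x using TensorProduct.induction_on with
  | zero => simp
  | add a b ha hb => simp only [map_add, ha, hb]
  | tmul m c =>
    rw [TensorProduct.map_tmul, wtTensor_tmul, wtTensor_tmul, hM, hC]
    induction ωM m using TensorProduct.induction_on with
    | zero => simp
    | add a b ha hb => simp only [TensorProduct.add_tmul, map_add, ha, hb]
    | tmul t m =>
      induction ωC c using TensorProduct.induction_on with
      | zero => simp
      | add a b ha hb => simp only [TensorProduct.tmul_add, map_add, ha, hb]
      | tmul t' c => simp

end wt

section skew
variable {M M' C C' : Type*} [Ring M] [Algebra 𝕜 M] [Ring M'] [Algebra 𝕜 M']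
  [AddCommGroup C] [Module 𝕜 C] [AddCommGroup C'] [Module 𝕜 C']

/-- The skew derivation that `u` with `Δ(u) = u ⊗ K⁻¹ + 1 ⊗ u` induces on `M ⊗ C`, where `U_q(sl₂)`
acts on `M` through `φ`, and `σ`, `δ` are the conjugation by `K` and the skew derivation on `C`. -/
def skewTensor (φ : Uq q →ₐ[𝕜] M) (u : Uq q) (σ δ : C →ₗ[𝕜] C) : M ⊗[𝕜] C →ₗ[𝕜] M ⊗[𝕜] C :=
  TensorProduct.map (LinearMap.mulLeft 𝕜 (φ (Uq.K q)) ∘ₗ LinearMap.mulRight 𝕜 (φ u)) σ -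
    (LinearMap.mulLeft 𝕜 (φ (Uq.K q) * φ u)).rTensor C +
    TensorProduct.map (LinearMap.mulLeft 𝕜 (φ (Uq.K q))) δ

lemma skewTensor_tmul (φ : Uq q →ₐ[𝕜] M) (u : Uq q) (σ δ : C →ₗ[𝕜] C) (m : M) (c : C) :
    skewTensor φ u σ δ (m ⊗ₜ c) = (φ (Uq.K q) * (m * φ u)) ⊗ₜ σ c - (φ (Uq.K q) * φ u * m) ⊗ₜ c +
      (φ (Uq.K q) * m) ⊗ₜ δ c := rfl

lemma skewTensor_natural (φ : Uq q →ₐ[𝕜] M) (u : Uq q) {σ δ : C →ₗ[𝕜] C} {σ' δ' : C' →ₗ[𝕜] C'}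
    (f : M →ₐ[𝕜] M') (g : C →ₗ[𝕜] C') (hσ : ∀ c, g (σ c) = σ' (g c)) (hδ : ∀ c, g (δ c) = δ' (g c))
    (x : M ⊗[𝕜] C) :
    TensorProduct.map f.toLinearMap g (skewTensor φ u σ δ x) =
      skewTensor (f.comp φ) u σ' δ' (TensorProduct.map f.toLinearMap g x) := by
  induction x using TensorProduct.induction_on with
  | zero => simp
  | add a b ha hb => simp only [map_add, ha, hb]
  | tmul m c => simp [skewTensor_tmul, hσ, hδ]

/-- The action of `U_q(sl₂)` on `M ⊗ U_q(sl₂)` through `Δ`. -/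
def extHom (φ : Uq q →ₐ[𝕜] M) : Uq q →ₐ[𝕜] M ⊗[𝕜] Uq q :=
  (Algebra.TensorProduct.map φ (AlgHom.id 𝕜 (Uq q))).comp (Uq.comul q)

lemma extHom_K (φ : Uq q →ₐ[𝕜] M) : extHom φ (Uq.K q) = φ (Uq.K q) ⊗ₜ Uq.K q := by
  simp [extHom]

lemma extHom_Kinv (φ : Uq q →ₐ[𝕜] M) : extHom φ (Uq.Kinv q) = φ (Uq.Kinv q) ⊗ₜ Uq.Kinv q := by
  simp [extHom]

lemma extHom_of_comul (φ : Uq q →ₐ[𝕜] M) {u : Uq q}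
    (hu : Uq.comul q u = u ⊗ₜ Uq.Kinv q + 1 ⊗ₜ u) :
    extHom φ u = φ u ⊗ₜ Uq.Kinv q + 1 ⊗ₜ u := by
  simp [extHom, hu]

lemma conjK_extHom (φ : Uq q →ₐ[𝕜] M) (x : M ⊗[𝕜] Uq q) :
    conjK (extHom φ) x = TensorProduct.map (conjK φ).toLinearMap
      (conjK (AlgHom.id 𝕜 (Uq q))).toLinearMap x := by
  induction x using TensorProduct.induction_on with
  | zero => simp
  | add a b ha hb => simp only [map_add, ha, hb]
  | tmul m c => simp [conjK_apply, extHom_K, extHom_Kinv]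

/-- For `C = U_q(sl₂)`, `skewTensor` is the skew derivation of the algebra `M ⊗ U_q(sl₂)`. -/
lemma skewDer_extHom (φ : Uq q →ₐ[𝕜] M) {u : Uq q}
    (hu : Uq.comul q u = u ⊗ₜ Uq.Kinv q + 1 ⊗ₜ u) (x : M ⊗[𝕜] Uq q) :
    skewDer (extHom φ) u x = skewTensor φ u (conjK (AlgHom.id 𝕜 (Uq q))).toLinearMap
      (skewDer (AlgHom.id 𝕜 (Uq q)) u) x := by
  induction x using TensorProduct.induction_on with
  | zero => simp
  | add a b ha hb => simp only [map_add, ha, hb]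
  | tmul m c =>
    simp only [skewDer_apply, extHom_K, extHom_of_comul φ hu, skewTensor_tmul, mul_add, add_mul,
      mul_sub, Algebra.TensorProduct.tmul_mul_tmul, AlgHom.toLinearMap_apply, conjK_apply,
      AlgHom.id_apply, Uq.K_mul_Kinv', mul_one, one_mul, TensorProduct.tmul_sub, mul_assoc]
    abel

/-- Compatibility of `skewTensor` with the associator, by `Δ(u) = u ⊗ K⁻¹ + 1 ⊗ u`. -/
lemma skewTensor_assoc (φ : Uq q →ₐ[𝕜] M) {u : Uq q}
    (hu : Uq.comul q u = u ⊗ₜ Uq.Kinv q + 1 ⊗ₜ u) (σ δ : C →ₗ[𝕜] C)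
    (x : M ⊗[𝕜] (Uq q ⊗[𝕜] C)) :
    (TensorProduct.assoc 𝕜 M (Uq q) C).symm (skewTensor φ u
      (TensorProduct.map (conjK (AlgHom.id 𝕜 (Uq q))).toLinearMap σ)
      (skewTensor (AlgHom.id 𝕜 (Uq q)) u σ δ) x) =
    skewTensor (extHom φ) u σ δ ((TensorProduct.assoc 𝕜 M (Uq q) C).symm x) := by
  induction x using TensorProduct.induction_on with
  | zero => simp
  | add a b ha hb => simp only [map_add, ha, hb]
  | tmul m x =>
    induction x using TensorProduct.induction_on with
    | zero => simp
    | add a b ha hb => simp only [TensorProduct.tmul_add, map_add, ha, hb]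
    | tmul v c =>
      simp only [TensorProduct.assoc_symm_tmul, skewTensor_tmul, TensorProduct.map_tmul, extHom_K,
        extHom_of_comul φ hu, mul_add, add_mul, map_add, map_sub, TensorProduct.tmul_add,
        TensorProduct.tmul_sub, TensorProduct.add_tmul, Algebra.TensorProduct.tmul_mul_tmul,
        AlgHom.toLinearMap_apply, conjK_apply, AlgHom.id_apply, Uq.K_mul_Kinv, mul_one, one_mul,
        mul_assoc]
      abel

lemma comul_EKinv : Uq.comul q (Uq.EKinv q) = Uq.EKinv q ⊗ₜ Uq.Kinv q + 1 ⊗ₜ Uq.EKinv q := by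
  simp [Uq.EKinv, add_mul, Uq.K_mul_Kinv]

lemma wtUq_conjK (y : Uq q) : wtUq q (conjK (AlgHom.id 𝕜 (Uq q)) y) =
    Algebra.TensorProduct.map (torusScale q) (AlgHom.id 𝕜 _) (wtUq q y) := by
  have : (wtUq q).comp (conjK (AlgHom.id 𝕜 (Uq q))) =
      (Algebra.TensorProduct.map (torusScale q) (AlgHom.id 𝕜 _)).comp (wtUq q) := by
    apply Uq.algHom_ext <;>
    simp [conjK_apply, Uq.K_mul_E', Uq.K_mul_F', Uq.K_mul_Kinv, Uq.K_mul_Kinv',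
      TensorProduct.smul_tmul]
  exact DFunLike.congr_fun this y

end skew

/-! ### Restriction of the structure to `I_R` -/

lemma IR_induction {P : Uq q → Prop} (hc : ∀ r : 𝕜, P (algebraMap 𝕜 _ r))
    (he : P (Uq.E q * Uq.Kinv q)) (hf : P (Uq.F q)) (hk : P (Uq.Kinv q)) (hL : P (Uq.Casimir q))
    (hadd : ∀ a ∈ IR q, ∀ b ∈ IR q, P a → P b → P (a + b))
    (hmul : ∀ a ∈ IR q, ∀ b ∈ IR q, P a → P b → P (a * b))
    {x : Uq q} (hx : x ∈ IR q) : P x := by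
  induction hx using Algebra.adjoin_induction with
  | mem x hx => rcases hx with rfl | rfl | rfl | rfl <;> assumption
  | algebraMap r => exact hc r
  | add a b ha hb h1 h2 => exact hadd a ha b hb h1 h2
  | mul a b ha hb h1 h2 => exact hmul a ha b hb h1 h2

lemma conjK_EKinv : conjK (AlgHom.id 𝕜 (Uq q)) (Uq.E q * Uq.Kinv q) =
    (q : 𝕜) ^ 2 • (Uq.E q * Uq.Kinv q) := by
  simp [conjK_apply, Uq.K_mul_E', Uq.K_mul_Kinv', mul_assoc]

lemma conjK_F : conjK (AlgHom.id 𝕜 (Uq q)) (Uq.F q) = ((q : 𝕜)⁻¹) ^ 2 • Uq.F q := by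
  simp [conjK_apply, Uq.K_mul_F', Uq.K_mul_Kinv]

lemma conjK_Kinv : conjK (AlgHom.id 𝕜 (Uq q)) (Uq.Kinv q) = Uq.Kinv q := by
  simp [conjK_apply, Uq.K_mul_Kinv']

lemma conjK_Casimir : conjK (AlgHom.id 𝕜 (Uq q)) (Uq.Casimir q) = Uq.Casimir q := by
  simp only [conjK_apply, AlgHom.id_apply]
  rw [← Uq.Kinv_Casimir, Uq.K_mul_Kinv']

lemma conjK_mem {x : Uq q} (hx : x ∈ IR q) : conjK (AlgHom.id 𝕜 (Uq q)) x ∈ IR q := by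
  refine IR_induction (P := fun x => conjK (AlgHom.id 𝕜 (Uq q)) x ∈ IR q) (fun r => ?_) ?_ ?_ ?_ ?_
    (fun a _ b _ ha hb => ?_) (fun a _ b _ ha hb => ?_) hx
  · rw [AlgHom.commutes]; exact Subalgebra.algebraMap_mem _ r
  · rw [conjK_EKinv]; exact Subalgebra.smul_mem _ (IR.e q).2 _
  · rw [conjK_F]; exact Subalgebra.smul_mem _ (IR.f q).2 _
  · rw [conjK_Kinv]; exact (IR.k q).2
  · rw [conjK_Casimir]; exact (IR.L q).2
  · rw [map_add]; exact add_mem ha hb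
  · rw [map_mul]; exact mul_mem ha hb

variable (q) in
/-- Conjugation by `K` on `I_R`. -/
def conjR : IR q →ₐ[𝕜] IR q :=
  ((conjK (AlgHom.id 𝕜 (Uq q))).comp (IR q).val).codRestrict (IR q) fun x => conjK_mem x.2

lemma coe_conjR (x : IR q) : (conjR q x : Uq q) = conjK (AlgHom.id 𝕜 (Uq q)) (x : Uq q) := rfl

lemma skewDer_EKinv_EKinv : skewDer (AlgHom.id 𝕜 (Uq q)) (Uq.EKinv q) (Uq.EKinv q) = 0 := by
  simp [skewDer_apply]

lemma skewDer_EKinv_Kinv : skewDer (AlgHom.id 𝕜 (Uq q)) (Uq.EKinv q) (Uq.Kinv q) =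
    (1 - (q : 𝕜) ^ 2) • Uq.EKinv q := by
  have hq := q.ne_zero
  simp only [skewDer_apply, AlgHom.id_apply, Uq.EKinv, mul_sub, mul_assoc, Uq.Kinv_mul_E',
    mul_smul_comm, Uq.K_mul_E', Uq.K_mul_Kinv']
  match_scalars; field_simp

lemma skewDer_EKinv_F (hh : (q : 𝕜) ^ 2 - 1 ≠ 0) :
    skewDer (AlgHom.id 𝕜 (Uq q)) (Uq.EKinv q) (Uq.F q) =
    (((q : 𝕜) - (q : 𝕜)⁻¹) ^ 2)⁻¹ • ((1 - (q : 𝕜) ^ 2) • Uq.Casimir q +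
      ((q : 𝕜) ^ 3 - (q : 𝕜)⁻¹) • Uq.Kinv q) := by
  have hq := q.ne_zero
  simp only [skewDer_apply, AlgHom.id_apply, Uq.EKinv, mul_sub, mul_assoc, Uq.F_mul_E',
    Uq.Casimir, Uq.Kinv_mul_F, mul_smul_comm, Uq.K_mul_E', Uq.K_mul_F', Uq.K_mul_Kinv',
    Uq.K_mul_Kinv, smul_sub, smul_add, smul_smul, mul_one]
  match_scalars <;> field_simp <;> ring

lemma skewDer_EKinv_Casimir (hh : (q : 𝕜) ^ 2 - 1 ≠ 0) :
    skewDer (AlgHom.id 𝕜 (Uq q)) (Uq.EKinv q) (Uq.Casimir q) = 0 := by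
  simp only [skewDer_apply, AlgHom.id_apply, Uq.EKinv, mul_assoc]
  rw [Uq.Kinv_Casimir, ← mul_assoc (Uq.E q), Uq.E_Casimir q hh, mul_assoc, sub_self, mul_zero]

lemma skewDer_F_EKinv (hh : (q : 𝕜) ^ 2 - 1 ≠ 0) :
    skewDer (AlgHom.id 𝕜 (Uq q)) (Uq.F q) (Uq.EKinv q) =
    - ((((q : 𝕜) - (q : 𝕜)⁻¹) ^ 2)⁻¹ • ((1 - (q : 𝕜) ^ 2) • Uq.Casimir q +
      ((q : 𝕜) ^ 3 - (q : 𝕜)⁻¹) • Uq.Kinv q)) := by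
  rw [← skewDer_EKinv_F hh, skewDer_apply, skewDer_apply, ← mul_neg, neg_sub]
  rfl

lemma skewDer_F_Kinv : skewDer (AlgHom.id 𝕜 (Uq q)) (Uq.F q) (Uq.Kinv q) =
    (1 - ((q : 𝕜)⁻¹) ^ 2) • Uq.F q := by
  have hq := q.ne_zero
  simp only [skewDer_apply, AlgHom.id_apply, mul_sub, Uq.Kinv_mul_F,
    mul_smul_comm, Uq.K_mul_F', Uq.K_mul_Kinv, mul_one]
  match_scalars; field_simp

lemma skewDer_F_F : skewDer (AlgHom.id 𝕜 (Uq q)) (Uq.F q) (Uq.F q) = 0 := by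
  simp [skewDer_apply]

lemma skewDer_F_Casimir (hh : (q : 𝕜) ^ 2 - 1 ≠ 0) :
    skewDer (AlgHom.id 𝕜 (Uq q)) (Uq.F q) (Uq.Casimir q) = 0 := by
  rw [skewDer_apply, AlgHom.id_apply, AlgHom.id_apply, Uq.F_Casimir q hh, sub_self, mul_zero]

lemma skewDer_algebraMap {M : Type*} [Ring M] [Algebra 𝕜 M] (φ : Uq q →ₐ[𝕜] M) (u : Uq q) (r : 𝕜) :
    skewDer φ u (algebraMap 𝕜 M r) = 0 := by
  rw [skewDer_apply, Algebra.commutes, sub_self, mul_zero]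

lemma skewDer_mem_of (u : Uq q) (he : skewDer (AlgHom.id 𝕜 (Uq q)) u (Uq.EKinv q) ∈ IR q)
    (hf : skewDer (AlgHom.id 𝕜 (Uq q)) u (Uq.F q) ∈ IR q)
    (hk : skewDer (AlgHom.id 𝕜 (Uq q)) u (Uq.Kinv q) ∈ IR q)
    (hL : skewDer (AlgHom.id 𝕜 (Uq q)) u (Uq.Casimir q) ∈ IR q) {x : Uq q} (hx : x ∈ IR q) :
    skewDer (AlgHom.id 𝕜 (Uq q)) u x ∈ IR q := by
  refine IR_induction (P := fun x => skewDer (AlgHom.id 𝕜 (Uq q)) u x ∈ IR q) (fun r => ?_) he hf hk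
    hL (fun a _ b _ ha hb => ?_) (fun a ha b hb ha' hb' => ?_) hx
  · rw [skewDer_algebraMap]; exact zero_mem _
  · rw [map_add]; exact add_mem ha hb
  · rw [skewDer_mul]
    exact add_mem (mul_mem (conjK_mem ha) hb') (mul_mem ha' hb)

lemma Casimir_mem_aux (a b c : 𝕜) : c • (a • Uq.Casimir q + b • Uq.Kinv q) ∈ IR q :=
  Subalgebra.smul_mem _ (add_mem (Subalgebra.smul_mem _ (IR.L q).2 _)
    (Subalgebra.smul_mem _ (IR.k q).2 _)) _

/-- `u` is `EK⁻¹` or `F`. -/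
def IsSkewGen (u : Uq q) : Prop := u = Uq.EKinv q ∨ u = Uq.F q

lemma IsSkewGen.comul_eq {u : Uq q} (hu : IsSkewGen u) :
    Uq.comul q u = u ⊗ₜ Uq.Kinv q + 1 ⊗ₜ u := by
  rcases hu with rfl | rfl
  · exact comul_EKinv
  · exact Uq.comul_F q

lemma skewDer_mem (hh : (q : 𝕜) ^ 2 - 1 ≠ 0) {u : Uq q} (hu : IsSkewGen u) {x : Uq q}
    (hx : x ∈ IR q) : skewDer (AlgHom.id 𝕜 (Uq q)) u x ∈ IR q := by
  rcases hu with rfl | rfl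
  · refine skewDer_mem_of _ ?_ ?_ ?_ ?_ hx
    · rw [skewDer_EKinv_EKinv]; exact zero_mem _
    · rw [skewDer_EKinv_F hh]; exact Casimir_mem_aux _ _ _
    · rw [skewDer_EKinv_Kinv]; exact Subalgebra.smul_mem _ (IR.e q).2 _
    · rw [skewDer_EKinv_Casimir hh]; exact zero_mem _
  · refine skewDer_mem_of _ ?_ ?_ ?_ ?_ hx
    · rw [skewDer_F_EKinv hh]; exact neg_mem (Casimir_mem_aux _ _ _)
    · rw [skewDer_F_F]; exact zero_mem _
    · rw [skewDer_F_Kinv]; exact Subalgebra.smul_mem _ (IR.f q).2 _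
    · rw [skewDer_F_Casimir hh]; exact zero_mem _

/-- The skew derivation of `I_R` given by `EK⁻¹` or `F`. -/
def skewR (hh : (q : 𝕜) ^ 2 - 1 ≠ 0) {u : Uq q} (hu : IsSkewGen u) : IR q →ₗ[𝕜] IR q :=
  (skewDer (AlgHom.id 𝕜 (Uq q)) u).restrict (p := Subalgebra.toSubmodule (IR q))
    (q := Subalgebra.toSubmodule (IR q)) fun _ hx => skewDer_mem hh hu hx

lemma coe_skewR (hh : (q : 𝕜) ^ 2 - 1 ≠ 0) {u : Uq q} (hu : IsSkewGen u) (x : IR q) :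
    (skewR hh hu x : Uq q) = skewDer (AlgHom.id 𝕜 (Uq q)) u (x : Uq q) := rfl

lemma lTensor_val_injective (X : Type*) [AddCommGroup X] [Module 𝕜 X] :
    Function.Injective ((IR q).val.toLinearMap.lTensor X) :=
  Module.Flat.lTensor_preserves_injective_linearMap (M := X) (IR q).val.toLinearMap
    Subtype.val_injective

lemma exists_wtR : ∃ ω : IR q →ₐ[𝕜] LaurentPolynomial 𝕜 ⊗[𝕜] IR q,
    ∀ x : IR q, (IR q).val.toLinearMap.lTensor _ (ω x) = wtUq q (x : Uq q) := by
  set ι := Algebra.TensorProduct.map (AlgHom.id 𝕜 (LaurentPolynomial 𝕜)) (IR q).val with hι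
  have hinj : Function.Injective ι := lTensor_val_injective _
  have hmem : ∀ x : IR q, wtUq q (x : Uq q) ∈ ι.range := by
    have hle : IR q ≤ ι.range.comap (wtUq q) := by
      refine Algebra.adjoin_le ?_
      rintro x (rfl | rfl | rfl | rfl)
      · exact ⟨LaurentPolynomial.T (-1) ⊗ₜ IR.e q, by simp [hι, IR.e]⟩
      · exact ⟨LaurentPolynomial.T 1 ⊗ₜ IR.f q, by simp [hι, IR.f]⟩
      · exact ⟨1 ⊗ₜ IR.k q, by simp [hι, IR.k]⟩
      · refine ⟨1 ⊗ₜ IR.L q, ?_⟩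
        change ι _ = wtUq q (Uq.Casimir q)
        have hT : LaurentPolynomial.T (-1) * LaurentPolynomial.T 1 = (1 : LaurentPolynomial 𝕜) := by
          rw [← LaurentPolynomial.T_add, neg_add_cancel, LaurentPolynomial.T_zero]
        simp [hι, IR.L, Uq.Casimir, hT, TensorProduct.tmul_add]
    exact fun x => hle x.2
  refine ⟨(AlgEquiv.ofInjective ι hinj).symm.toAlgHom.comp
    (((wtUq q).comp (IR q).val).codRestrict ι.range hmem), fun x => ?_⟩
  exact congrArg Subtype.val ((AlgEquiv.ofInjective ι hinj).apply_symm_apply _)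

variable (q) in
/-- The weight coaction of `I_R`. -/
def wtR : IR q →ₐ[𝕜] LaurentPolynomial 𝕜 ⊗[𝕜] IR q := Classical.choose (exists_wtR (q := q))

lemma wtR_spec (x : IR q) : (IR q).val.toLinearMap.lTensor _ (wtR q x) = wtUq q (x : Uq q) :=
  Classical.choose_spec (exists_wtR (q := q)) x

/-! ### `Δ` and `τ_R` are equivariant -/

/-- Induction on elements of `I_R` as a subtype. -/
lemma IR_induction' {P : IR q → Prop} (hc : ∀ r : 𝕜, P (algebraMap 𝕜 _ r))
    (he : P (IR.e q)) (hf : P (IR.f q)) (hk : P (IR.k q)) (hL : P (IR.L q))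
    (hadd : ∀ a b, P a → P b → P (a + b)) (hmul : ∀ a b, P a → P b → P (a * b)) (x : IR q) :
    P x := by
  have : ∀ y ∈ IR q, ∃ h : y ∈ IR q, P ⟨y, h⟩ := fun y hy => by
    refine IR_induction (P := fun y => ∃ h : y ∈ IR q, P ⟨y, h⟩)
      (fun r => ⟨Subalgebra.algebraMap_mem _ r, hc r⟩) ⟨_, he⟩ ⟨_, hf⟩ ⟨_, hk⟩ ⟨_, hL⟩ ?_ ?_ hy
    · rintro a - b - ⟨ha, pa⟩ ⟨hb, pb⟩
      exact ⟨add_mem ha hb, hadd _ _ pa pb⟩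
    · rintro a - b - ⟨ha, pa⟩ ⟨hb, pb⟩
      exact ⟨mul_mem ha hb, hmul _ _ pa pb⟩
  exact (this x x.2).2

/-- Compatibility of `β : I_R → U_q(sl₂) ⊗ I_R` with the conjugations by `K`, with the skew
derivations of `EK⁻¹` and `F`, and with the weight coactions. -/
structure IsEquivariant (hh : (q : 𝕜) ^ 2 - 1 ≠ 0) (β : IR q →ₐ[𝕜] Uq q ⊗[𝕜] IR q) : Prop where
  conj : ∀ x, β (conjR q x) =
    TensorProduct.map (conjK (AlgHom.id 𝕜 (Uq q))).toLinearMap (conjR q).toLinearMap (β x)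
  skew : ∀ {u : Uq q} (hu : IsSkewGen u) (x : IR q), β (skewR hh hu x) =
    skewTensor (AlgHom.id 𝕜 (Uq q)) u (conjR q).toLinearMap (skewR hh hu) (β x)
  wt : ∀ x, β.toLinearMap.lTensor _ (wtR q x) = wtTensor (wtUq q) (wtR q) (β x)

lemma extHom_id : extHom (AlgHom.id 𝕜 (Uq q)) = Uq.comul q := by
  apply Uq.algHom_ext <;> simp [extHom]

/-- Equivariance can be checked after the inclusion `I_R ⊂ U_q(sl₂)`. -/
lemma IsEquivariant.of_val (hh : (q : 𝕜) ^ 2 - 1 ≠ 0) {β : IR q →ₐ[𝕜] Uq q ⊗[𝕜] IR q}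
    (h1 : ∀ x, (IR q).val.toLinearMap.lTensor _ (β (conjR q x)) =
      conjK (Uq.comul q) ((IR q).val.toLinearMap.lTensor _ (β x)))
    (h2 : ∀ {u : Uq q} (hu : IsSkewGen u) (x : IR q),
      (IR q).val.toLinearMap.lTensor _ (β (skewR hh hu x)) =
        skewDer (Uq.comul q) u ((IR q).val.toLinearMap.lTensor _ (β x)))
    (h3 : ∀ x, β.toLinearMap.lTensor _ (wtR q x) = wtTensor (wtUq q) (wtR q) (β x)) :
    IsEquivariant hh β where
  conj x := by
    apply lTensor_val_injective
    rw [h1, ← extHom_id, conjK_extHom, ← LinearMap.comp_apply, ← LinearMap.comp_apply]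
    congr 1
    ext a b
    simp [coe_conjR]
  skew hu x := by
    apply lTensor_val_injective
    rw [h2, ← extHom_id, skewDer_extHom _ hu.comul_eq]
    exact (skewTensor_natural (AlgHom.id 𝕜 (Uq q)) _ (AlgHom.id 𝕜 (Uq q)) (IR q).val.toLinearMap
      (fun _ => rfl) (fun _ => rfl) _).symm
  wt := h3

lemma wtTensor_comul (x : Uq q) : (Uq.comul q).toLinearMap.lTensor _ (wtUq q x) =
    wtTensor (wtUq q) (wtUq q) (Uq.comul q x) := by
  have : (Algebra.TensorProduct.map (AlgHom.id 𝕜 (LaurentPolynomial 𝕜)) (Uq.comul q)).comp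
      (wtUq q) =
      (wtTensor (wtUq q) (wtUq q)).comp (Uq.comul q) := by
    apply Uq.algHom_ext <;>
    simp [wtTensor_tmul, TensorProduct.tmul_add, Algebra.TensorProduct.one_def]
  exact DFunLike.congr_fun this x

/-- `Δ : I_R → U_q(sl₂) ⊗ I_R` is equivariant, as the structure on `I_R` is given by inner maps. -/
theorem comulR_equivariant (hh : (q : 𝕜) ^ 2 - 1 ≠ 0) : IsEquivariant hh (comulR q) := by
  have hs (x : IR q) : (IR q).val.toLinearMap.lTensor _ (comulR q x) = Uq.comul q (x : Uq q) :=
    comulR_spec x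
  refine IsEquivariant.of_val hh (fun x => ?_) (fun hu x => ?_) (fun x => ?_)
  · rw [hs, hs, coe_conjR, conjK_apply, conjK_apply]
    simp
  · rw [hs, hs, coe_skewR, skewDer_apply, skewDer_apply]
    simp
  · have hinj : Function.Injective (((IR q).val.toLinearMap.lTensor (Uq q)).lTensor
        (LaurentPolynomial 𝕜)) :=
      Module.Flat.lTensor_preserves_injective_linearMap _ (lTensor_val_injective _)
    apply hinj
    rw [← LinearMap.comp_apply, ← LinearMap.lTensor_comp]
    have h2 : (IR q).val.toLinearMap.lTensor (Uq q) ∘ₗ (comulR q).toLinearMap =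
        (Uq.comul q).toLinearMap ∘ₗ (IR q).val.toLinearMap := LinearMap.ext hs
    rw [h2, LinearMap.lTensor_comp, LinearMap.comp_apply, wtR_spec, wtTensor_comul, ← hs]
    exact (wtTensor_natural LinearMap.id (IR q).val.toLinearMap (by simp) wtR_spec _).symm

lemma conjR_e : conjR q (IR.e q) = (q : 𝕜) ^ 2 • IR.e q := Subtype.ext conjK_EKinv
lemma conjR_f : conjR q (IR.f q) = ((q : 𝕜)⁻¹) ^ 2 • IR.f q := Subtype.ext conjK_F
lemma conjR_k : conjR q (IR.k q) = IR.k q := Subtype.ext conjK_Kinv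
lemma conjR_L : conjR q (IR.L q) = IR.L q := Subtype.ext conjK_Casimir

lemma skewR_mul (hh : (q : 𝕜) ^ 2 - 1 ≠ 0) {u : Uq q} (hu : IsSkewGen u) (x y : IR q) :
    skewR hh hu (x * y) = conjR q x * skewR hh hu y + skewR hh hu x * y :=
  Subtype.ext (skewDer_mul _ _ _ _)

lemma wtR_e : wtR q (IR.e q) = LaurentPolynomial.T (-1) ⊗ₜ IR.e q := by
  apply lTensor_val_injective
  rw [wtR_spec]
  simp [IR.e]

lemma wtR_f : wtR q (IR.f q) = LaurentPolynomial.T 1 ⊗ₜ IR.f q := by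
  apply lTensor_val_injective
  rw [wtR_spec]
  simp [IR.f]

lemma wtR_k : wtR q (IR.k q) = 1 ⊗ₜ IR.k q := by
  apply lTensor_val_injective
  rw [wtR_spec]
  simp [IR.k]

lemma wtUq_Casimir : wtUq q (Uq.Casimir q) = 1 ⊗ₜ Uq.Casimir q := by
  have hT : LaurentPolynomial.T (-1) * LaurentPolynomial.T 1 = (1 : LaurentPolynomial 𝕜) := by
    rw [← LaurentPolynomial.T_add, neg_add_cancel, LaurentPolynomial.T_zero]
  simp [Uq.Casimir, hT, TensorProduct.tmul_add]

lemma wtR_L : wtR q (IR.L q) = 1 ⊗ₜ IR.L q := by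
  apply lTensor_val_injective
  rw [wtR_spec]
  simp [IR.L, wtUq_Casimir]

section tau
set_option linter.unusedSimpArgs false
variable (hq : ¬ IsOfFinOrder q)

/-- `τ_R` with values in `U_q(sl₂) ⊗ U_q(sl₂)`. -/
def tauVal : IR q →ₐ[𝕜] Uq q ⊗[𝕜] Uq q :=
  (Algebra.TensorProduct.map (AlgHom.id 𝕜 (Uq q)) (IR q).val).comp (tauR hq)

lemma tauVal_e : tauVal hq (IR.e q) = Uq.Kinv q ⊗ₜ Uq.EKinv q := by
  rw [tauVal, AlgHom.comp_apply, (tauR_spec hq).1]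
  simp only [Algebra.TensorProduct.map_tmul]
  rfl

lemma tauVal_f : tauVal hq (IR.f q) = Uq.K q ⊗ₜ Uq.F q
      - (((q : 𝕜)⁻¹) ^ 3 * ((q : 𝕜) - (q : 𝕜)⁻¹) ^ 2) • ((Uq.F q ^ 2 * Uq.K q) ⊗ₜ Uq.EKinv q)
      + ((q : 𝕜)⁻¹ * ((q : 𝕜) + (q : 𝕜)⁻¹)) • ((Uq.F q * Uq.K q) ⊗ₜ Uq.Kinv q)
      - (q : 𝕜)⁻¹ • ((Uq.F q * Uq.K q) ⊗ₜ Uq.Casimir q) := by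
  rw [tauVal, AlgHom.comp_apply, (tauR_spec hq).2.1]
  simp only [map_sub, map_add, map_smul, Algebra.TensorProduct.map_tmul]
  rfl

lemma tauVal_k : tauVal hq (IR.k q) = 1 ⊗ₜ Uq.Kinv q
      - ((q : 𝕜)⁻¹ * ((q : 𝕜) - (q : 𝕜)⁻¹) ^ 2) • (Uq.F q ⊗ₜ Uq.EKinv q) := by
  rw [tauVal, AlgHom.comp_apply, (tauR_spec hq).2.2.1]
  simp only [map_sub, map_smul, Algebra.TensorProduct.map_tmul]
  rfl

lemma tauVal_L : tauVal hq (IR.L q) = 1 ⊗ₜ Uq.Casimir q := by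
  rw [tauVal, AlgHom.comp_apply, (tauR_spec hq).2.2.2]
  simp only [Algebra.TensorProduct.map_tmul]
  rfl

lemma tauVal_conjR (x : IR q) : tauVal hq (conjR q x) = conjK (Uq.comul q) (tauVal hq x) := by
  have hk : ∀ a b : Uq q, conjK (Uq.comul q) (a ⊗ₜ b) =
      conjK (AlgHom.id 𝕜 (Uq q)) a ⊗ₜ conjK (AlgHom.id 𝕜 (Uq q)) b := fun a b => by
    simp [conjK_apply]
  have hKK : conjK (AlgHom.id 𝕜 (Uq q)) (Uq.K q) = Uq.K q := by simp [conjK_apply, Uq.K_mul_Kinv]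
  have hE : conjK (AlgHom.id 𝕜 (Uq q)) (Uq.E q) = (q : 𝕜) ^ 2 • Uq.E q := by
    simp [conjK_apply, Uq.K_mul_E', Uq.K_mul_Kinv]
  have : (tauVal hq).comp (conjR q) = (conjK (Uq.comul q)).comp (tauVal hq) := by
    have h0 := q.ne_zero
    apply IR.algHom_ext
    all_goals
      simp only [AlgHom.comp_apply, conjR_e, conjR_f, conjR_k, conjR_L, tauVal_e, tauVal_f,
        tauVal_k, tauVal_L, map_smul, map_sub, map_add, hk, map_mul, map_pow, map_one, hKK,
        conjK_Kinv,
        Uq.EKinv, hE, conjK_F, conjK_Casimir, smul_sub, smul_add, smul_smul,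
        TensorProduct.tmul_smul, TensorProduct.smul_tmul, smul_pow, smul_mul_assoc]
    all_goals first | rfl | (match_scalars <;> field_simp)
  exact DFunLike.congr_fun this x

lemma skewDer_comul_tmul_Casimir (hh : (q : 𝕜) ^ 2 - 1 ≠ 0) {u : Uq q} (hu : IsSkewGen u) :
    skewDer (Uq.comul q) u (1 ⊗ₜ Uq.Casimir q) = 0 := by
  have h : u * Uq.Casimir q = Uq.Casimir q * u := by
    rcases hu with rfl | rfl
    · rw [Uq.EKinv, mul_assoc, Uq.Kinv_Casimir, ← mul_assoc, Uq.E_Casimir q hh, mul_assoc]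
    · exact Uq.F_Casimir q hh
  rw [skewDer_apply, hu.comul_eq]
  simp only [mul_add, add_mul, Algebra.TensorProduct.tmul_mul_tmul, one_mul, mul_one,
    Uq.Kinv_Casimir, h, sub_self, mul_zero]

set_option maxHeartbeats 2000000 in
lemma skewDer_EKinv_tauVal (hh : (q : 𝕜) ^ 2 - 1 ≠ 0) :
    skewDer (Uq.comul q) (Uq.EKinv q) (tauVal hq (IR.e q)) = 0 ∧
    skewDer (Uq.comul q) (Uq.EKinv q) (tauVal hq (IR.k q)) =
      (1 - (q : 𝕜) ^ 2) • tauVal hq (IR.e q) ∧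
    skewDer (Uq.comul q) (Uq.EKinv q) (tauVal hq (IR.f q)) =
      (((q : 𝕜) - (q : 𝕜)⁻¹) ^ 2)⁻¹ • ((1 - (q : 𝕜) ^ 2) • tauVal hq (IR.L q) +
        ((q : 𝕜) ^ 3 - (q : 𝕜)⁻¹) • tauVal hq (IR.k q)) := by
  have h0 := q.ne_zero
  rw [tauVal_e, tauVal_k, tauVal_f, tauVal_L]
  refine ⟨?_, ?_, ?_⟩
  all_goals
    simp only [skewDer_apply, Uq.comul_K, comul_EKinv, Uq.comul_F, Uq.Casimir, Uq.EKinv, pow_two,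
      mul_add, add_mul, mul_sub, sub_mul, Algebra.TensorProduct.tmul_mul_tmul, smul_mul_assoc,
      mul_smul_comm, smul_add, smul_sub, smul_smul, one_mul, mul_one, TensorProduct.tmul_add,
      TensorProduct.add_tmul, TensorProduct.tmul_sub, TensorProduct.sub_tmul,
      ← TensorProduct.smul_tmul', TensorProduct.tmul_smul, mul_assoc, Uq.K_mul_Kinv,
      Uq.Kinv_mul_K, Uq.K_mul_Kinv', Uq.Kinv_mul_K', Uq.K_mul_E, Uq.K_mul_E', Uq.K_mul_F,
      Uq.K_mul_F', Uq.Kinv_mul_E, Uq.Kinv_mul_E', Uq.Kinv_mul_F, Uq.Kinv_mul_F', Uq.F_mul_E,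
      Uq.F_mul_E']
    match_scalars <;> field_simp <;> ring

set_option maxHeartbeats 2000000 in
lemma skewDer_F_tauVal (hh : (q : 𝕜) ^ 2 - 1 ≠ 0) :
    skewDer (Uq.comul q) (Uq.F q) (tauVal hq (IR.f q)) = 0 ∧
    skewDer (Uq.comul q) (Uq.F q) (tauVal hq (IR.k q)) =
      (1 - ((q : 𝕜)⁻¹) ^ 2) • tauVal hq (IR.f q) ∧
    skewDer (Uq.comul q) (Uq.F q) (tauVal hq (IR.e q)) =
      - ((((q : 𝕜) - (q : 𝕜)⁻¹) ^ 2)⁻¹ • ((1 - (q : 𝕜) ^ 2) • tauVal hq (IR.L q) +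
        ((q : 𝕜) ^ 3 - (q : 𝕜)⁻¹) • tauVal hq (IR.k q))) := by
  have h0 := q.ne_zero
  rw [tauVal_e, tauVal_k, tauVal_f, tauVal_L]
  refine ⟨?_, ?_, ?_⟩
  all_goals
    simp only [skewDer_apply, Uq.comul_K, comul_EKinv, Uq.comul_F, Uq.Casimir, Uq.EKinv, pow_two,
      mul_add, add_mul, mul_sub, sub_mul, Algebra.TensorProduct.tmul_mul_tmul, smul_mul_assoc,
      mul_smul_comm, smul_add, smul_sub, smul_smul, one_mul, mul_one, TensorProduct.tmul_add,
      TensorProduct.add_tmul, TensorProduct.tmul_sub, TensorProduct.sub_tmul,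
      ← TensorProduct.smul_tmul', TensorProduct.tmul_smul, mul_assoc, Uq.K_mul_Kinv,
      Uq.Kinv_mul_K, Uq.K_mul_Kinv', Uq.Kinv_mul_K', Uq.K_mul_E, Uq.K_mul_E', Uq.K_mul_F,
      Uq.K_mul_F', Uq.Kinv_mul_E, Uq.Kinv_mul_E', Uq.Kinv_mul_F, Uq.Kinv_mul_F', Uq.F_mul_E,
      Uq.F_mul_E']
    match_scalars <;> field_simp <;> ring

lemma tauVal_skewR (hh : (q : 𝕜) ^ 2 - 1 ≠ 0) {u : Uq q} (hu : IsSkewGen u) (x : IR q) :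
    tauVal hq (skewR hh hu x) = skewDer (Uq.comul q) u (tauVal hq x) := by
  obtain ⟨h1, h2, h3⟩ := skewDer_EKinv_tauVal hq hh
  obtain ⟨h4, h5, h6⟩ := skewDer_F_tauVal hq hh
  induction x using IR_induction' with
  | hc r =>
    rw [AlgHom.commutes, skewDer_algebraMap, ← map_zero (tauVal hq)]
    congr 1
    exact Subtype.ext (skewDer_algebraMap _ _ _)
  | hadd a b ha hb => simp only [map_add, ha, hb]
  | hmul a b ha hb => rw [skewR_mul, map_add, map_mul, map_mul, map_mul, skewDer_mul, ha, hb,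
      tauVal_conjR]
  | he =>
    rcases hu with rfl | rfl
    · rw [show skewR hh (Or.inl rfl) (IR.e q) = 0 from Subtype.ext skewDer_EKinv_EKinv, map_zero,
        h1]
    · rw [show skewR hh (Or.inr rfl) (IR.e q) = - ((((q : 𝕜) - (q : 𝕜)⁻¹) ^ 2)⁻¹ •
        ((1 - (q : 𝕜) ^ 2) • IR.L q + ((q : 𝕜) ^ 3 - (q : 𝕜)⁻¹) • IR.k q)) from
        Subtype.ext (skewDer_F_EKinv hh), h6]
      simp only [map_neg, map_smul, map_add]
  | hf =>
    rcases hu with rfl | rfl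
    · rw [show skewR hh (Or.inl rfl) (IR.f q) = (((q : 𝕜) - (q : 𝕜)⁻¹) ^ 2)⁻¹ •
        ((1 - (q : 𝕜) ^ 2) • IR.L q + ((q : 𝕜) ^ 3 - (q : 𝕜)⁻¹) • IR.k q) from
        Subtype.ext (skewDer_EKinv_F hh), h3]
      simp only [map_smul, map_add]
    · rw [show skewR hh (Or.inr rfl) (IR.f q) = 0 from Subtype.ext skewDer_F_F, map_zero, h4]
  | hk =>
    rcases hu with rfl | rfl
    · rw [show skewR hh (Or.inl rfl) (IR.k q) = (1 - (q : 𝕜) ^ 2) • IR.e q from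
        Subtype.ext skewDer_EKinv_Kinv, h2, map_smul]
    · rw [show skewR hh (Or.inr rfl) (IR.k q) = (1 - ((q : 𝕜)⁻¹) ^ 2) • IR.f q from
        Subtype.ext skewDer_F_Kinv, h5, map_smul]
  | hL =>
    have : skewR hh hu (IR.L q) = 0 := by
      rcases hu with rfl | rfl
      · exact Subtype.ext (skewDer_EKinv_Casimir hh)
      · exact Subtype.ext (skewDer_F_Casimir hh)
    rw [this, map_zero, tauVal_L, skewDer_comul_tmul_Casimir hh hu]

/-- `τ_R` is equivariant: both sides of each compatibility are determined by their values on the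
generators of `I_R`, where they are compared. -/
theorem tauR_equivariant (hh : (q : 𝕜) ^ 2 - 1 ≠ 0) : IsEquivariant hh (tauR hq) := by
  refine IsEquivariant.of_val hh (tauVal_conjR hq) (tauVal_skewR hq hh) (fun x => ?_)
  have hT : LaurentPolynomial.T 1 * LaurentPolynomial.T (-1) = (1 : LaurentPolynomial 𝕜) := by
    rw [← LaurentPolynomial.T_add, add_neg_cancel, LaurentPolynomial.T_zero]
  have : (Algebra.TensorProduct.map (AlgHom.id 𝕜 (LaurentPolynomial 𝕜)) (tauR hq)).comp (wtR q) =
      (wtTensor (wtUq q) (wtR q)).comp (tauR hq) := by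
    obtain ⟨he, hf, hk, hL⟩ := tauR_spec hq
    apply IR.algHom_ext
    all_goals
      simp only [AlgHom.comp_apply, wtR_e, wtR_f, wtR_k, wtR_L, Algebra.TensorProduct.map_tmul, he,
        hf, hk, hL, map_add, map_sub, map_smul, wtTensor_tmul, map_mul, map_pow, map_one, wtUq_F,
        wtUq_K, wtUq_Kinv, Algebra.TensorProduct.tmul_mul_tmul, pow_two, wtMerge_tmul, mul_one,
        one_mul, mul_assoc, hT, AlgHom.id_apply, TensorProduct.tmul_sub, TensorProduct.tmul_add,
        TensorProduct.tmul_smul, Algebra.TensorProduct.one_def]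
  exact DFunLike.congr_fun this x

end tau

/-! ### `τ_R` as the series `Θ` -/

section
variable (hq : ¬ IsOfFinOrder q)

lemma theta_EKinv : theta q (skewDer (AlgHom.id 𝕜 (Uq q)) (Uq.EKinv q)) (wtUq q).toLinearMap 1
    (Uq.EKinv q) = tauVal hq (IR.e q) := by
  rw [theta_eq_sum, tauVal_e]
  simp [divPow, qCoeff]

lemma theta_Casimir : theta q (skewDer (AlgHom.id 𝕜 (Uq q)) (Uq.EKinv q)) (wtUq q).toLinearMap 1
    (Uq.Casimir q) = tauVal hq (IR.L q) := by
  rw [theta_eq_sum, tauVal_L]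
  simp [divPow, qCoeff, wtUq_Casimir]

lemma theta_Kinv : theta q (skewDer (AlgHom.id 𝕜 (Uq q)) (Uq.EKinv q)) (wtUq q).toLinearMap 2
    (Uq.Kinv q) = tauVal hq (IR.k q) := by
  have h0 := q.ne_zero
  rw [theta_eq_sum, tauVal_k]
  simp only [Finset.sum_range_succ, Finset.sum_range_zero, divPow, pow_zero, pow_one,
    Module.End.one_apply, skewDer_EKinv_Kinv, map_smul, AlgHom.comp_apply, qCoeff, map_mul, wtUq_E,
    wtUq_Kinv, Algebra.TensorProduct.map_tmul, Algebra.TensorProduct.tmul_mul_tmul, one_mul,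
    mul_one, torusK_T_neg_one, map_one, AlgHom.id_apply, mul_assoc, Uq.K_mul_Kinv, mul_smul_comm,
    smul_smul, qNum, one_smul, zero_add]
  match_scalars
  all_goals field_simp
  all_goals ring

lemma theta_F : theta q (skewDer (AlgHom.id 𝕜 (Uq q)) (Uq.EKinv q)) (wtUq q).toLinearMap 3
    (Uq.F q) = tauVal hq (IR.f q) := by
  have h0 := q.ne_zero
  have hh := sq_sub_one_ne_zero hq
  -- This is `[2] ≠ 0`, which `field_simp` needs for the term of degree two.
  have h1 : (q : 𝕜) ^ 2 + 1 ≠ 0 := by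
    have := qNum_ne_zero hq 1
    intro h
    refine this ?_
    simp only [qNum, Finset.sum_range_succ, Finset.sum_range_zero]
    field_simp
    simpa using h
  rw [theta_eq_sum, tauVal_f]
  simp only [Finset.sum_range_succ, Finset.sum_range_zero, divPow, pow_zero, pow_one, pow_two,
    Module.End.one_apply, Module.End.mul_apply, skewDer_EKinv_F hh, skewDer_EKinv_Casimir hh,
    skewDer_EKinv_Kinv, map_smul, map_add, AlgHom.comp_apply, qCoeff, map_mul, wtUq_E,
    wtUq_Kinv, wtUq_F, wtUq_Casimir, Algebra.TensorProduct.map_tmul,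
    Algebra.TensorProduct.tmul_mul_tmul, one_mul, mul_one, torusK_T_one,
    torusK_T_neg_one, map_one, AlgHom.id_apply, mul_assoc, Uq.K_mul_Kinv, Uq.K_mul_F', Uq.EKinv,
    mul_smul_comm, smul_mul_assoc, smul_smul, mul_add, smul_add, smul_zero,
    ← TensorProduct.smul_tmul', qNum, one_smul, zero_add]
  match_scalars
  all_goals field_simp
  all_goals ring

lemma exists_theta_eq_tauVal (x : IR q) : ∃ m,
    (skewDer (AlgHom.id 𝕜 (Uq q)) (Uq.EKinv q) ^ m) (x : Uq q) = 0 ∧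
    theta q (skewDer (AlgHom.id 𝕜 (Uq q)) (Uq.EKinv q)) (wtUq q).toLinearMap m (x : Uq q) =
      tauVal hq x := by
  have hh := sq_sub_one_ne_zero hq
  induction x using IR_induction' with
  | hc r =>
    refine ⟨1, by simpa using skewDer_algebraMap _ _ r, ?_⟩
    rw [theta_eq_sum]
    simp only [Finset.sum_range_one, pow_zero, divPow, qCoeff, one_smul, one_mul,
      Module.End.one_apply, AlgHom.commutes]
    exact AlgHom.commutes _ r
  | he => exact ⟨1, skewDer_EKinv_EKinv, theta_EKinv hq⟩
  | hf =>
    refine ⟨3, ?_, theta_F hq⟩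
    change (skewDer (AlgHom.id 𝕜 (Uq q)) (Uq.EKinv q) ^ 3) (Uq.F q) = 0
    simp only [pow_succ, pow_zero, one_mul, Module.End.mul_apply, skewDer_EKinv_F hh, map_add,
      map_smul, skewDer_EKinv_Casimir hh, skewDer_EKinv_Kinv, skewDer_EKinv_EKinv, smul_zero,
      map_zero, add_zero]
  | hk =>
    refine ⟨2, ?_, theta_Kinv hq⟩
    change (skewDer (AlgHom.id 𝕜 (Uq q)) (Uq.EKinv q) ^ 2) (Uq.Kinv q) = 0
    simp only [pow_succ, pow_zero, one_mul, Module.End.mul_apply,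
      map_smul, skewDer_EKinv_Kinv, skewDer_EKinv_EKinv, smul_zero]
  | hL => exact ⟨1, skewDer_EKinv_Casimir hh, theta_Casimir hq⟩
  | hadd a b ha hb =>
    obtain ⟨m, h1, h2⟩ := ha
    obtain ⟨n, h3, h4⟩ := hb
    refine ⟨max m n, ?_, ?_⟩
    · change (skewDer (AlgHom.id 𝕜 (Uq q)) (Uq.EKinv q) ^ _) ((a : Uq q) + b) = 0
      rw [map_add, Module.End.pow_map_zero_of_le (le_max_left _ _) h1,
        Module.End.pow_map_zero_of_le (le_max_right _ _) h3, add_zero]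
    · change theta _ _ _ _ ((a : Uq q) + b) = _
      rw [map_add, map_add, ← h2, ← h4,
        theta_eq_of_le (le_max_left _ _) fun i hi => Module.End.pow_map_zero_of_le hi h1,
        theta_eq_of_le (le_max_right _ _) fun i hi => Module.End.pow_map_zero_of_le hi h3]
  | hmul a b ha hb =>
    obtain ⟨m, h1, h2⟩ := ha
    obtain ⟨n, h3, h4⟩ := hb
    refine ⟨2 * max m n, ?_, ?_⟩
    · change (skewDer (AlgHom.id 𝕜 (Uq q)) (Uq.EKinv q) ^ _) ((a : Uq q) * b) = 0
      rw [two_mul]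
      exact pow_apply_mul_eq_zero _ _ (skewDer_mul _ _) (skewDer_conjK _ _ Uq.K_mul_EKinv) _ _ _ _
        (Module.End.pow_map_zero_of_le (le_max_left _ _) h1)
        (Module.End.pow_map_zero_of_le (le_max_right _ _) h3)
    · change theta _ _ _ _ ((a : Uq q) * b) = _
      rw [← theta_mul hq _ _ wtUq_conjK le_rfl
        (fun i hi => Module.End.pow_map_zero_of_le ((le_max_left _ _).trans hi) h1)
        (fun i hi => Module.End.pow_map_zero_of_le ((le_max_right _ _).trans hi) h3),
        map_mul, ← h2, ← h4,
        theta_eq_of_le (le_max_left _ _) fun i hi => Module.End.pow_map_zero_of_le hi h1,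
        theta_eq_of_le (le_max_right _ _) fun i hi => Module.End.pow_map_zero_of_le hi h3]

/-- The skew derivation of `I_R` given by `EK⁻¹`. -/
abbrev skewRE (hh : (q : 𝕜) ^ 2 - 1 ≠ 0) : IR q →ₗ[𝕜] IR q := skewR hh (Or.inl rfl)

/-- `τ_R` is the series `Θ` on `I_R`: both are multiplicative and they agree on the generators. The
series is finite, as every element of `I_R` is killed by a power of the skew derivation. -/
theorem exists_theta_eq_tauR (x : IR q) : ∃ m,
    (skewRE (sq_sub_one_ne_zero hq) ^ m) x = 0 ∧
    theta q (skewRE (sq_sub_one_ne_zero hq)) (wtR q).toLinearMap m x = tauR hq x := by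
  obtain ⟨m, h1, h2⟩ := exists_theta_eq_tauVal hq x
  refine ⟨m, ?_, ?_⟩
  · apply Subtype.val_injective
    have (i : ℕ) (y : IR q) : ((skewRE (sq_sub_one_ne_zero hq) ^ i) y : Uq q) =
        (skewDer (AlgHom.id 𝕜 (Uq q)) (Uq.EKinv q) ^ i) (y : Uq q) := by
      induction i with
      | zero => rfl
      | succ i ih =>
        rw [pow_succ', pow_succ', Module.End.mul_apply, Module.End.mul_apply, ← ih]
        rfl
    exact (this m x).trans h1
  · apply lTensor_val_injective
    rw [← theta_natural (δ' := skewDer (AlgHom.id 𝕜 (Uq q)) (Uq.EKinv q))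
      (ω' := (wtUq q).toLinearMap) (IR q).val.toLinearMap (fun _ => rfl) wtR_spec]
    exact h2

end

/-! ### Tensor powers -/

lemma snoc_bijective (m : ℕ) : Function.Bijective (snoc q m) := by
  let g : Tens q (m + 1) →ₗ[𝕜] Tens q m ⊗[𝕜] Uq q := PiTensorProduct.lift
    ((TensorProduct.mk 𝕜 (Tens q m) (Uq q)).compMultilinearMap
      (PiTensorProduct.tprod 𝕜)).uncurryRight
  have hg (x : Fin m → Uq q) (y : Uq q) :
      g (PiTensorProduct.tprod 𝕜 (Fin.snoc (α := fun _ => Uq q) x y)) =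
        PiTensorProduct.tprod 𝕜 x ⊗ₜ y := by
    simp [g]
  refine Function.bijective_iff_has_inverse.2 ⟨g, fun x => ?_, fun x => ?_⟩
  · have : g ∘ₗ (snoc q m).toLinearMap = LinearMap.id := by
      ext x y
      simp [snoc_tmul_tprod, hg]
    exact DFunLike.congr_fun this x
  · have : (snoc q m).toLinearMap ∘ₗ g = LinearMap.id := by
      ext x
      rw [LinearMap.compMultilinearMap_apply, LinearMap.comp_apply, ← Fin.snoc_init_self x, hg]
      exact snoc_tmul_tprod _ _ _
    exact DFunLike.congr_fun this x

variable (q) in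
/-- The isomorphism `U_q(sl₂)^{⊗m} ⊗ U_q(sl₂) ≃ U_q(sl₂)^{⊗(m+1)}`. -/
def snocEquiv (m : ℕ) : Tens q m ⊗[𝕜] Uq q ≃ₐ[𝕜] Tens q (m + 1) :=
  AlgEquiv.ofBijective (snoc q m) (snoc_bijective m)

lemma snocEquiv_symm_snoc (m : ℕ) (x : Tens q m ⊗[𝕜] Uq q) :
    (snocEquiv q m).symm (snoc q m x) = x :=
  (snocEquiv q m).symm_apply_apply x

lemma exists_counit (q : 𝕜ˣ) : ∃ ε : Uq q →ₐ[𝕜] 𝕜,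
    ε (Uq.E q) = 0 ∧ ε (Uq.F q) = 0 ∧ ε (Uq.K q) = 1 ∧ ε (Uq.Kinv q) = 1 := by
  apply Uq.exists_algHom q <;> simp

variable (q) in
/-- The counit of `U_q(sl₂)`. -/
def counit : Uq q →ₐ[𝕜] 𝕜 := Classical.choose (exists_counit q)

@[simp] lemma counit_E : counit q (Uq.E q) = 0 := (Classical.choose_spec (exists_counit q)).1
@[simp] lemma counit_F : counit q (Uq.F q) = 0 := (Classical.choose_spec (exists_counit q)).2.1
@[simp] lemma counit_K : counit q (Uq.K q) = 1 := (Classical.choose_spec (exists_counit q)).2.2.1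
@[simp] lemma counit_Kinv : counit q (Uq.Kinv q) = 1 :=
  (Classical.choose_spec (exists_counit q)).2.2.2

variable (q) in
/-- The action of `U_q(sl₂)` on the last `r` factors of `U_q(sl₂)^{⊗(p+r)}` through the iterated
coproduct; for `r = 0` this is the counit. -/
def diag (p : ℕ) : (r : ℕ) → Uq q →ₐ[𝕜] Tens q (p + r)
  | 0 => (Algebra.ofId 𝕜 _).comp (counit q)
  | r + 1 => (snoc q (p + r)).comp (extHom (diag p r))

variable (q) in
/-- The weight coaction of the last `r` factors of `U_q(sl₂)^{⊗(p+r)}`. -/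
def wtTens (p : ℕ) : (r : ℕ) → Tens q (p + r) →ₐ[𝕜] LaurentPolynomial 𝕜 ⊗[𝕜] Tens q (p + r)
  | 0 => Algebra.TensorProduct.includeRight
  | r + 1 => (Algebra.TensorProduct.map (AlgHom.id 𝕜 _) (snoc q (p + r))).comp
      ((wtTensor (wtTens p r) (wtUq q)).comp (snocEquiv q (p + r)).symm.toAlgHom)

/-- The map `U_q(sl₂) ⊗ (A ⊗ C) → B ⊗ C` given by `f : U_q(sl₂) ⊗ A → B`, an insertion of a tensor
factor in `A`. -/
def insTensor {A B : Type*} [Ring A] [Algebra 𝕜 A] [Ring B] [Algebra 𝕜 B]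
    (f : Uq q ⊗[𝕜] A →ₐ[𝕜] B) (C : Type*) [Ring C] [Algebra 𝕜 C] :
    Uq q ⊗[𝕜] (A ⊗[𝕜] C) →ₐ[𝕜] B ⊗[𝕜] C :=
  (Algebra.TensorProduct.map f (AlgHom.id 𝕜 C)).comp
    (Algebra.TensorProduct.assoc 𝕜 𝕜 𝕜 (Uq q) A C).symm.toAlgHom

@[simp] lemma insTensor_tmul {A B : Type*} [Ring A] [Algebra 𝕜 A] [Ring B] [Algebra 𝕜 B]
    (f : Uq q ⊗[𝕜] A →ₐ[𝕜] B) {C : Type*} [Ring C] [Algebra 𝕜 C] (u : Uq q) (a : A) (c : C) :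
    insTensor f C (u ⊗ₜ (a ⊗ₜ c)) = f (u ⊗ₜ a) ⊗ₜ c := by
  simp [insTensor]

variable (q) in
/-- Insertion of a tensor factor before the last `r` factors of `U_q(sl₂)^{⊗(p+r)}`. -/
def ins (p : ℕ) : (r : ℕ) → Uq q ⊗[𝕜] Tens q (p + r) →ₐ[𝕜] Tens q (p + r + 1)
  | 0 => (snoc q p).comp (Algebra.TensorProduct.comm 𝕜 (Uq q) (Tens q p)).toAlgHom
  | r + 1 => (snoc q (p + r + 1)).comp ((insTensor (ins p r) (Uq q)).comp
      (Algebra.TensorProduct.map (AlgHom.id 𝕜 _) (snocEquiv q (p + r)).symm.toAlgHom))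

lemma wtTens_snoc (p r : ℕ) (x : Tens q (p + r) ⊗[𝕜] Uq q) :
    wtTens q p (r + 1) (snoc q (p + r) x) =
      (snoc q (p + r)).toLinearMap.lTensor _ (wtTensor (wtTens q p r) (wtUq q) x) := by
  rw [wtTens, AlgHom.comp_apply, AlgHom.comp_apply]
  change _ = (Algebra.TensorProduct.map (AlgHom.id 𝕜 _) (snoc q (p + r))) _
  congr 2
  exact snocEquiv_symm_snoc _ _

lemma ins_snoc (p r : ℕ) (y : Uq q ⊗[𝕜] (Tens q (p + r) ⊗[𝕜] Uq q)) :
    ins q p (r + 1) ((snoc q (p + r)).toLinearMap.lTensor _ y) =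
      snoc q (p + r + 1) (insTensor (ins q p r) (Uq q) y) := by
  rw [ins, AlgHom.comp_apply, AlgHom.comp_apply]
  congr 2
  induction y using TensorProduct.induction_on with
  | zero => simp
  | add a b ha hb => simp only [map_add, ha, hb]
  | tmul u x =>
    simp only [LinearMap.lTensor_tmul, Algebra.TensorProduct.map_tmul]
    congr 1
    exact snocEquiv_symm_snoc _ _

lemma insTensor_lTensor {A B C D : Type*} [Ring A] [Algebra 𝕜 A] [Ring B] [Algebra 𝕜 B] [Ring C]
    [Algebra 𝕜 C] [Ring D] [Algebra 𝕜 D] (f : Uq q ⊗[𝕜] A →ₐ[𝕜] B) (g : C →ₗ[𝕜] D)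
    (y : Uq q ⊗[𝕜] (A ⊗[𝕜] C)) :
    insTensor f D ((g.lTensor A).lTensor _ y) = g.lTensor B (insTensor f C y) := by
  induction y using TensorProduct.induction_on with
  | zero => simp
  | add a b ha hb => simp only [map_add, ha, hb]
  | tmul u x =>
    induction x using TensorProduct.induction_on with
    | zero => simp
    | add a b ha hb => simp only [TensorProduct.tmul_add, map_add, ha, hb]
    | tmul a c => simp

lemma extendBy_apply (β : IR q →ₐ[𝕜] Uq q ⊗[𝕜] IR q) (m : ℕ) (X : Tens q m ⊗[𝕜] IR q) :
    extendBy β m X = TensorProduct.map (snoc q m).toLinearMap LinearMap.id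
      ((TensorProduct.assoc 𝕜 (Tens q m) (Uq q) (IR q)).symm (β.toLinearMap.lTensor _ X)) := rfl

lemma extendBy_tmul (β : IR q →ₐ[𝕜] Uq q ⊗[𝕜] IR q) (m : ℕ) (z : Tens q m) (x : IR q) :
    extendBy β m (z ⊗ₜ x) = TensorProduct.map (snoc q m).toLinearMap LinearMap.id
      ((TensorProduct.assoc 𝕜 (Tens q m) (Uq q) (IR q)).symm (z ⊗ₜ β x)) := rfl

lemma ins_extendBy (β : IR q →ₐ[𝕜] Uq q ⊗[𝕜] IR q) (p r : ℕ)
    (y : Uq q ⊗[𝕜] (Tens q (p + r) ⊗[𝕜] IR q)) :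
    insTensor (ins q p (r + 1)) (IR q) ((extendBy β (p + r)).toLinearMap.lTensor _ y) =
      extendBy β (p + r + 1) (insTensor (ins q p r) (IR q) y) := by
  induction y using TensorProduct.induction_on with
  | zero => simp
  | add a b ha hb => simp only [map_add, ha, hb]
  | tmul u x =>
    induction x using TensorProduct.induction_on with
    | zero => simp
    | add a b ha hb => simp only [TensorProduct.tmul_add, map_add, ha, hb]
    | tmul z x =>
      rw [LinearMap.lTensor_tmul, insTensor_tmul, AlgHom.toLinearMap_apply, extendBy_tmul,
        extendBy_tmul]
      induction β x using TensorProduct.induction_on with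
      | zero => rw [TensorProduct.tmul_zero, TensorProduct.tmul_zero, LinearEquiv.map_zero,
          LinearEquiv.map_zero, LinearMap.map_zero, LinearMap.map_zero, TensorProduct.tmul_zero,
          map_zero]
      | add a b ha hb => simp only [TensorProduct.tmul_add, map_add, ha, hb]
      | tmul v w =>
        have := ins_snoc p r (u ⊗ₜ (z ⊗ₜ v))
        rw [LinearMap.lTensor_tmul, insTensor_tmul] at this
        simp only [TensorProduct.assoc_symm_tmul, TensorProduct.map_tmul, insTensor_tmul,
          LinearMap.id_apply, AlgHom.toLinearMap_apply] at this ⊢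
        rw [this]

/-! ### Equivariance in tensor powers -/

section
variable {M N : Type*} [Ring M] [Algebra 𝕜 M] [Ring N] [Algebra 𝕜 N]

lemma skewDer_comp (f : M →ₐ[𝕜] N) (φ : Uq q →ₐ[𝕜] M) (u : Uq q) (x : M) :
    skewDer (f.comp φ) u (f x) = f (skewDer φ u x) := by
  simp [skewDer_apply]

lemma conjK_comp (f : M →ₐ[𝕜] N) (φ : Uq q →ₐ[𝕜] M) (x : M) :
    conjK (f.comp φ) (f x) = f (conjK φ x) := by
  simp [conjK_apply]

lemma skewDer_extHom_tmul_one (φ : Uq q →ₐ[𝕜] M) {u : Uq q} (hu : IsSkewGen u) (z : M) :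
    skewDer (extHom φ) u (z ⊗ₜ 1) = skewDer φ u z ⊗ₜ 1 := by
  simp only [skewDer_apply, extHom_K, extHom_of_comul φ hu.comul_eq, mul_add, add_mul, mul_sub,
    Algebra.TensorProduct.tmul_mul_tmul, one_mul, mul_one, Uq.K_mul_Kinv, TensorProduct.sub_tmul]
  abel

end

/-- The extension by an equivariant map intertwines the skew derivations. -/
lemma skewTensor_extendBy (hh : (q : 𝕜) ^ 2 - 1 ≠ 0) {β : IR q →ₐ[𝕜] Uq q ⊗[𝕜] IR q}
    (hβ : IsEquivariant hh β) {u : Uq q} (hu : IsSkewGen u) {m : ℕ} (φ : Uq q →ₐ[𝕜] Tens q m)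
    (X : Tens q m ⊗[𝕜] IR q) :
    extendBy β m (skewTensor φ u (conjR q).toLinearMap (skewR hh hu) X) =
      skewTensor ((snoc q m).comp (extHom φ)) u (conjR q).toLinearMap (skewR hh hu)
        (extendBy β m X) := by
  have h1 := skewTensor_natural φ u (σ := (conjR q).toLinearMap)
    (σ' := TensorProduct.map (conjK (AlgHom.id 𝕜 (Uq q))).toLinearMap (conjR q).toLinearMap)
    (AlgHom.id 𝕜 (Tens q m)) β.toLinearMap hβ.conj (hβ.skew hu) X
  rw [extendBy_apply, extendBy_apply, ← skewTensor_natural (extHom φ) u (σ := (conjR q).toLinearMap)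
    (δ := skewR hh hu) (snoc q m) LinearMap.id (fun _ => rfl) (fun _ => rfl),
    ← skewTensor_assoc φ hu.comul_eq]
  congr 2

/-- The extension by an equivariant map intertwines the weight coactions. -/
lemma wtTensor_extendBy (hh : (q : 𝕜) ^ 2 - 1 ≠ 0) {β : IR q →ₐ[𝕜] Uq q ⊗[𝕜] IR q}
    (hβ : IsEquivariant hh β) (p r : ℕ) (X : Tens q (p + r) ⊗[𝕜] IR q) :
    (extendBy β (p + r)).toLinearMap.lTensor _ (wtTensor (wtTens q p r) (wtR q) X) =
      wtTensor (wtTens q p (r + 1)) (wtR q) (extendBy β (p + r) X) := by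
  have h1 : (β.toLinearMap.lTensor (Tens q (p + r))).lTensor _
      (wtTensor (wtTens q p r) (wtR q) X) =
      wtTensor (wtTens q p r) (wtTensor (wtUq q) (wtR q)) (β.toLinearMap.lTensor _ X) :=
    wtTensor_natural LinearMap.id β.toLinearMap (by simp) hβ.wt X
  have h2 := wtTensor_assoc (wtTens q p r) (wtUq q) (wtR q) (β.toLinearMap.lTensor _ X)
  have h3 := wtTensor_natural (ωM := wtTensor (wtTens q p r) (wtUq q)) (ωC := wtR q)
    (ωM' := wtTens q p (r + 1)) (ωC' := wtR q) (snoc q (p + r)).toLinearMap LinearMap.id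
    (fun x => (wtTens_snoc p r x).symm) (by simp)
    ((TensorProduct.assoc 𝕜 _ (Uq q) (IR q)).symm (β.toLinearMap.lTensor _ X))
  rw [extendBy_apply]
  refine Eq.trans ?_ h3
  rw [← h2, ← h1, ← LinearMap.comp_apply,
    ← LinearMap.comp_apply, ← LinearMap.lTensor_comp, ← LinearMap.lTensor_comp]
  rfl

lemma skewDer_snoc_val (hh : (q : 𝕜) ^ 2 - 1 ≠ 0) {u : Uq q} (hu : IsSkewGen u) {m : ℕ}
    (φ : Uq q →ₐ[𝕜] Tens q m) (X : Tens q m ⊗[𝕜] IR q) :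
    snoc q m ((IR q).val.toLinearMap.lTensor _
      (skewTensor φ u (conjR q).toLinearMap (skewR hh hu) X)) =
      skewDer ((snoc q m).comp (extHom φ)) u (snoc q m ((IR q).val.toLinearMap.lTensor _ X)) := by
  rw [skewDer_comp, skewDer_extHom φ hu.comul_eq]
  congr 1
  exact skewTensor_natural φ u (AlgHom.id 𝕜 _) (IR q).val.toLinearMap (fun _ => rfl)
    (fun _ => rfl) X

lemma wtTens_snoc_val (p r : ℕ) (X : Tens q (p + r) ⊗[𝕜] IR q) :
    ((snoc q (p + r)).toLinearMap ∘ₗ (IR q).val.toLinearMap.lTensor _).lTensor _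
      (wtTensor (wtTens q p r) (wtR q) X) =
    wtTens q p (r + 1) (snoc q (p + r) ((IR q).val.toLinearMap.lTensor _ X)) := by
  rw [wtTens_snoc, LinearMap.lTensor_comp, LinearMap.comp_apply]
  congr 1
  exact wtTensor_natural LinearMap.id (IR q).val.toLinearMap (by simp) wtR_spec X

lemma wtTens_snoc_one (p r : ℕ) (z : Tens q (p + r)) :
    ((snoc q (p + r)).toLinearMap ∘ₗ (TensorProduct.mk 𝕜 _ (Uq q)).flip 1).lTensor _
      (wtTens q p r z) = wtTens q p (r + 1) (snoc q (p + r) (z ⊗ₜ 1)) := by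
  rw [wtTens_snoc, LinearMap.lTensor_comp, LinearMap.comp_apply]
  congr 1
  rw [wtTensor_tmul, map_one (wtUq q), Algebra.TensorProduct.one_def]
  induction wtTens q p r z using TensorProduct.induction_on with
  | zero => simp
  | add a b ha hb => simp only [TensorProduct.add_tmul, map_add, ha, hb]
  | tmul t y => simp

lemma wtTens_conjK (p r : ℕ) (y : Tens q (p + r)) : wtTens q p r (conjK (diag q p r) y) =
    Algebra.TensorProduct.map (torusScale q) (AlgHom.id 𝕜 _) (wtTens q p r y) := by
  induction r with
  | zero => simp [diag, wtTens, conjK_apply]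
  | succ r ih =>
    obtain ⟨x, rfl⟩ := (snoc_bijective (q := q) (p + r)).2 y
    rw [diag, conjK_comp, wtTens_snoc, conjK_extHom, wtTensor_scale q _ _ ih wtUq_conjK,
      wtTens_snoc]
    induction wtTensor (wtTens q p r) (wtUq q) x using TensorProduct.induction_on with
    | zero => simp
    | add a b ha hb => simp only [map_add, ha, hb]
    | tmul t y => simp

/-! ### Generators as words in `Δ` and `τ_R` -/

section words
variable (hq : ¬ IsOfFinOrder q)

open Classical in
/-- `Δ` or `τ_R`, according to whether `P` holds. -/
def letter (P : Prop) : IR q →ₐ[𝕜] Uq q ⊗[𝕜] IR q := if P then comulR q else tauR hq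

lemma letter_equivariant (P : Prop) : IsEquivariant (sq_sub_one_ne_zero hq) (letter hq P) := by
  rw [letter]
  split_ifs
  exacts [comulR_equivariant _, tauR_equivariant hq _]

/-- The stages of the extension process that starts in position `0`, with `Δ` in the positions in
`P` and `τ_R` in the others. -/
def word (P : ℕ → Prop) : (ℓ : ℕ) → Tens q ℓ ⊗[𝕜] IR q
  | 0 => 1 ⊗ₜ IR.L q
  | ℓ + 1 => extendBy (letter hq (P ℓ)) ℓ (word P ℓ)

/-- The element of `U_q(sl₂)^{⊗n}` obtained from the extension process up to position `b < n`, with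
`1` in the positions after `b`. If `n ≤ b`, it is `1`. -/
def wordElt (P : ℕ → Prop) (b : ℕ) : (n : ℕ) → Tens q n
  | 0 => 1
  | n + 1 => if b = n then snoc q n ((IR q).val.toLinearMap.lTensor _ (word hq P n))
      else snoc q n (wordElt P b n ⊗ₜ 1)

lemma word_congr {P Q : ℕ → Prop} {ℓ : ℕ} (h : ∀ i < ℓ, P i ↔ Q i) : word hq P ℓ = word hq Q ℓ := by
  induction ℓ with
  | zero => rfl
  | succ ℓ ih => rw [word, word, ih fun i hi => h i (by omega), propext (h ℓ (by omega))]

lemma wordElt_congr {P Q : ℕ → Prop} {b : ℕ} (h : ∀ i < b, P i ↔ Q i) (n : ℕ) :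
    wordElt hq P b n = wordElt hq Q b n := by
  induction n with
  | zero => rfl
  | succ n ih =>
    rw [wordElt, wordElt, ih]
    split_ifs with hb
    · subst hb
      rw [word_congr hq h]
    · rfl

/-! ### Insertion of a hole -/

/-- `Θ` for the last `r` factors of `U_q(sl₂)^{⊗(p+r)}`. -/
abbrev thetaTens (q : 𝕜ˣ) (p r m : ℕ) : Tens q (p + r) →ₗ[𝕜] Uq q ⊗[𝕜] Tens q (p + r) :=
  theta q (skewDer (diag q p r) (Uq.EKinv q)) (wtTens q p r).toLinearMap m

/-- The skew derivation on `U_q(sl₂)^{⊗(p+r)} ⊗ I_R`. -/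
abbrev skewTens (p r : ℕ) : Tens q (p + r) ⊗[𝕜] IR q →ₗ[𝕜] Tens q (p + r) ⊗[𝕜] IR q :=
  skewTensor (diag q p r) (Uq.EKinv q) (conjR q).toLinearMap (skewRE (sq_sub_one_ne_zero hq))

/-- `Θ` for the last `r + 1` factors of `U_q(sl₂)^{⊗(p+r)} ⊗ I_R`. -/
abbrev thetaTensR (p r m : ℕ) :
    Tens q (p + r) ⊗[𝕜] IR q →ₗ[𝕜] Uq q ⊗[𝕜] (Tens q (p + r) ⊗[𝕜] IR q) :=
  theta q (skewTens hq p r) (wtTensor (wtTens q p r) (wtR q)).toLinearMap m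

lemma insTensor_lTensor_mk {A B C : Type*} [Ring A] [Algebra 𝕜 A] [Ring B] [Algebra 𝕜 B] [Ring C]
    [Algebra 𝕜 C] (f : Uq q ⊗[𝕜] A →ₐ[𝕜] B) (g : A ⊗[𝕜] Uq q →ₗ[𝕜] B)
    (hfg : ∀ u z, f (u ⊗ₜ z) = g (z ⊗ₜ u)) (z : A) (y : Uq q ⊗[𝕜] C) :
    insTensor f C ((TensorProduct.mk 𝕜 A C z).lTensor _ y) =
      TensorProduct.map g LinearMap.id ((TensorProduct.assoc 𝕜 A (Uq q) C).symm (z ⊗ₜ y)) := by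
  induction y using TensorProduct.induction_on with
  | zero => simp
  | add a b ha hb => simp only [TensorProduct.tmul_add, map_add, ha, hb]
  | tmul u c => simp [hfg]

lemma ins_zero_tmul (p : ℕ) (u : Uq q) (z : Tens q p) : ins q p 0 (u ⊗ₜ z) = snoc q p (z ⊗ₜ u) := by
  simp [ins]

set_option synthInstance.maxHeartbeats 200000 in
/-- `Θ` on the factor `I_R` alone, followed by the insertion before it, is the extension by `τ_R`.
-/
lemma exists_theta_eq_extendBy_tauR (p : ℕ) (X : Tens q p ⊗[𝕜] IR q) : ∃ m,
    (skewTens hq p 0 ^ m) X = 0 ∧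
    insTensor (ins q p 0) (IR q) (thetaTensR hq p 0 m X) = extendBy (tauR hq) p X := by
  induction X using TensorProduct.induction_on with
  | zero => exact ⟨0, map_zero _, by simp only [map_zero]⟩
  | add a b ha hb =>
    obtain ⟨m, h1, h2⟩ := ha
    obtain ⟨n, h3, h4⟩ := hb
    refine ⟨max m n, ?_, ?_⟩
    · rw [map_add, Module.End.pow_map_zero_of_le (le_max_left _ _) h1,
        Module.End.pow_map_zero_of_le (le_max_right _ _) h3]
      exact add_zero (0 : Tens q p ⊗[𝕜] IR q)
    · rw [map_add, map_add, map_add, ← h2, ← h4, thetaTensR,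
        theta_eq_of_le (le_max_left m n) fun i hi => Module.End.pow_map_zero_of_le hi h1,
        theta_eq_of_le (le_max_right m n) fun i hi => Module.End.pow_map_zero_of_le hi h3]
  | tmul z x =>
    obtain ⟨m, h1, h2⟩ := exists_theta_eq_tauR hq x
    have hg (y : IR q) : TensorProduct.mk 𝕜 (Tens q p) (IR q) z
        (skewRE (sq_sub_one_ne_zero hq) y) = skewTens hq p 0 (TensorProduct.mk 𝕜 _ _ z y) := by
      simp [skewTensor_tmul, diag]
    have hω (y : IR q) : (TensorProduct.mk 𝕜 (Tens q p) (IR q) z).lTensor _ (wtR q y) =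
        wtTensor (wtTens q p 0) (wtR q) (TensorProduct.mk 𝕜 _ _ z y) := by
      rw [TensorProduct.mk_apply, wtTensor_tmul]
      induction wtR q y using TensorProduct.induction_on with
      | zero => simp
      | add a b ha hb => simp only [TensorProduct.tmul_add, map_add, ha, hb]
      | tmul t y => simp [wtTens]
    refine ⟨m, ?_, ?_⟩
    · have := pow_apply_natural _ hg m x
      rw [h1, map_zero] at this
      exact this
    · have := theta_natural (q := q) (ω := (wtR q).toLinearMap)
        (ω' := (wtTensor (wtTens q p 0) (wtR q)).toLinearMap) _ hg hω m x
      rw [h2] at this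
      rw [extendBy_tmul]
      refine (congrArg (insTensor (ins q p 0) (IR q)) this).trans ?_
      exact insTensor_lTensor_mk (A := Tens q p) (B := Tens q (p + 1)) (ins q p 0)
        (snoc q p).toLinearMap (fun u z => ins_zero_tmul p u z) z (tauR hq x)

/-- The increasing enumeration of the naturals other than `p`. -/
def skip (p i : ℕ) : ℕ := if i < p then i else i + 1

/-- `Θ` inserts the letter `τ_R` in position `p` of a word: it does so at the end of a word, since
`Θ` is `τ_R` on `I_R`, and by naturality it commutes with the extension by further letters. -/
lemma exists_theta_word {P : ℕ → Prop} {p : ℕ} (hp : ¬ P p) (r : ℕ) : ∃ m,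
    (skewTens hq p r ^ m) (word hq (fun i => P (skip p i)) (p + r)) = 0 ∧
    insTensor (ins q p r) (IR q) (thetaTensR hq p r m (word hq (fun i => P (skip p i)) (p + r))) =
      word hq P (p + r + 1) := by
  induction r with
  | zero =>
    obtain ⟨m, h1, h2⟩ := exists_theta_eq_extendBy_tauR hq p (word hq (fun i => P (skip p i)) p)
    refine ⟨m, h1, h2.trans ?_⟩
    change _ = word hq P (p + 1)
    rw [word, letter, if_neg hp]
    congr 1
    exact word_congr hq fun i hi => by simp [skip, hi]
  | succ r ih =>
    obtain ⟨m, h1, h2⟩ := ih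
    have hβ := letter_equivariant hq (P (skip p (p + r)))
    have hδ (X : Tens q (p + r) ⊗[𝕜] IR q) :
        (extendBy (letter hq (P (skip p (p + r)))) (p + r)).toLinearMap (skewTens hq p r X) =
          skewTens hq p (r + 1)
            ((extendBy (letter hq (P (skip p (p + r)))) (p + r)).toLinearMap X) :=
      skewTensor_extendBy _ hβ (Or.inl rfl) (diag q p r) X
    have hω := wtTensor_extendBy _ hβ p r
    refine ⟨m, ?_, ?_⟩
    · have := pow_apply_natural _ hδ m (word hq (fun i => P (skip p i)) (p + r))
      rw [h1, map_zero] at this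
      exact this
    · have := theta_natural (q := q) (ω := (wtTensor (wtTens q p r) (wtR q)).toLinearMap)
        (ω' := (wtTensor (wtTens q p (r + 1)) (wtR q)).toLinearMap) _ hδ hω m
        (word hq (fun i => P (skip p i)) (p + r))
      refine (congrArg _ this).trans ((ins_extendBy _ _ _ _).trans ?_)
      have hs : skip p (p + r) = p + r + 1 := by simp [skip]
      refine (congrArg _ h2).trans ?_
      rw [hs]
      rfl

lemma ins_snoc_val (p r : ℕ) (y : Uq q ⊗[𝕜] (Tens q (p + r) ⊗[𝕜] IR q)) :
    ins q p (r + 1) (((snoc q (p + r)).toLinearMap ∘ₗ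
      (IR q).val.toLinearMap.lTensor _).lTensor _ y) =
    snoc q (p + r + 1) ((IR q).val.toLinearMap.lTensor _ (insTensor (ins q p r) (IR q) y)) := by
  rw [LinearMap.lTensor_comp, LinearMap.comp_apply, ins_snoc, insTensor_lTensor]

lemma ins_snoc_one (p r : ℕ) (y : Uq q ⊗[𝕜] Tens q (p + r)) :
    ins q p (r + 1) (((snoc q (p + r)).toLinearMap ∘ₗ
      (TensorProduct.mk 𝕜 _ (Uq q)).flip 1).lTensor _ y) =
    snoc q (p + r + 1) (ins q p r y ⊗ₜ 1) := by
  rw [LinearMap.lTensor_comp, LinearMap.comp_apply, ins_snoc]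
  congr 1
  induction y using TensorProduct.induction_on with
  | zero => simp
  | add a b ha hb => simp only [TensorProduct.add_tmul, map_add, ha, hb]
  | tmul t y => simp

/-- If `p` is not in `P`, then the element of the word is obtained from the element of the word
without position `p` by `Θ` and insertion of a factor in position `p`. If the word ends before
`p`, the inserted factor is `1`. -/
theorem exists_theta_wordElt {P : ℕ → Prop} {p : ℕ} (hp : ¬ P p) (r : ℕ) {b : ℕ} (hb : b < p + r) :
    ∃ m, (skewDer (diag q p r) (Uq.EKinv q) ^ m)
      (wordElt hq (fun i => P (skip p i)) b (p + r)) = 0 ∧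
    ins q p r (thetaTens q p r m (wordElt hq (fun i => P (skip p i)) b (p + r))) =
      wordElt hq P (skip p b) (p + r + 1) := by
  induction r with
  | zero =>
    refine ⟨1, ?_, ?_⟩
    · simp [skewDer_apply, diag]
    · rw [thetaTens, theta_eq_sum, wordElt, if_neg (by simp [skip]; split_ifs <;> omega)]
      have hs : skip p b = b := by simp [skip]; omega
      rw [hs, wordElt_congr hq (P := fun i => P (skip p i)) (Q := P)
        (fun i hi => by rw [skip, if_pos (by omega)])]
      simp [divPow, qCoeff, wtTens, ins]
  | succ r ih =>
    by_cases hb' : b = p + r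
    · subst hb'
      obtain ⟨m, h1, h2⟩ := exists_theta_word hq hp r
      have hs : skip p (p + r) = p + r + 1 := by simp [skip]
      have hw : wordElt hq (fun i => P (skip p i)) (p + r) (p + (r + 1)) =
          ((snoc q (p + r)).toLinearMap ∘ₗ (IR q).val.toLinearMap.lTensor _)
            (word hq (fun i => P (skip p i)) (p + r)) := by
        change wordElt hq (fun i => P (skip p i)) (p + r) (p + r + 1) = _
        rw [wordElt, if_pos rfl]
        rfl
      have hδ (X : Tens q (p + r) ⊗[𝕜] IR q) :
          ((snoc q (p + r)).toLinearMap ∘ₗ (IR q).val.toLinearMap.lTensor _) (skewTens hq p r X) =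
          skewDer (diag q p (r + 1)) (Uq.EKinv q)
            (((snoc q (p + r)).toLinearMap ∘ₗ (IR q).val.toLinearMap.lTensor _) X) :=
        skewDer_snoc_val (sq_sub_one_ne_zero hq) (Or.inl rfl) (diag q p r) X
      refine ⟨m, ?_, ?_⟩
      · rw [hw, ← map_zero ((snoc q (p + r)).toLinearMap ∘ₗ (IR q).val.toLinearMap.lTensor _), ← h1]
        exact pow_apply_natural _ hδ m _
      · have := theta_natural (q := q) (ω := (wtTensor (wtTens q p r) (wtR q)).toLinearMap)
          (ω' := (wtTens q p (r + 1)).toLinearMap)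
          ((snoc q (p + r)).toLinearMap ∘ₗ (IR q).val.toLinearMap.lTensor _) hδ
          (wtTens_snoc_val p r) m (word hq (fun i => P (skip p i)) (p + r))
        rw [hw]
        refine (congrArg _ this).trans ((ins_snoc_val _ _ _).trans ?_)
        rw [hs]
        change _ = wordElt hq P (p + r + 1) (p + r + 1 + 1)
        rw [wordElt, if_pos rfl]
        exact congrArg _ (congrArg _ h2)
    · obtain ⟨m, h1, h2⟩ := ih (by omega)
      have hw : wordElt hq (fun i => P (skip p i)) b (p + (r + 1)) =
          ((snoc q (p + r)).toLinearMap ∘ₗ (TensorProduct.mk 𝕜 _ (Uq q)).flip 1)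
            (wordElt hq (fun i => P (skip p i)) b (p + r)) := by
        change wordElt hq (fun i => P (skip p i)) b (p + r + 1) = _
        rw [wordElt, if_neg hb']
        rfl
      have hδ (x : Tens q (p + r)) : ((snoc q (p + r)).toLinearMap ∘ₗ
          (TensorProduct.mk 𝕜 _ (Uq q)).flip 1) (skewDer (diag q p r) (Uq.EKinv q) x) =
          skewDer (diag q p (r + 1)) (Uq.EKinv q) (((snoc q (p + r)).toLinearMap ∘ₗ
            (TensorProduct.mk 𝕜 _ (Uq q)).flip 1) x) :=
        ((skewDer_comp (snoc q (p + r)) (extHom (diag q p r)) _ _).trans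
          (congrArg _ (skewDer_extHom_tmul_one _ (Or.inl rfl) x))).symm
      refine ⟨m, ?_, ?_⟩
      · rw [hw, pow_apply_natural _ hδ, h1, map_zero]
      · have := theta_natural (q := q) (ω := (wtTens q p r).toLinearMap)
          (ω' := (wtTens q p (r + 1)).toLinearMap)
          ((snoc q (p + r)).toLinearMap ∘ₗ (TensorProduct.mk 𝕜 _ (Uq q)).flip 1) hδ
          (wtTens_snoc_one p r) m (wordElt hq (fun i => P (skip p i)) b (p + r))
        rw [hw]
        refine (congrArg _ this).trans ((ins_snoc_one _ _ _).trans ?_)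
        change _ = wordElt hq P (skip p b) (p + r + 1 + 1)
        rw [wordElt, if_neg (by simp [skip]; split_ifs <;> omega)]
        exact congrArg (fun x => snoc q (p + r + 1) (x ⊗ₜ 1)) h2

end words

/-! ### Words without holes -/

section centralizer
variable (hq : ¬ IsOfFinOrder q)

set_option synthInstance.maxHeartbeats 200000 in
/-- The extension by an equivariant map intertwines the conjugations by `K`. -/
lemma conj_extendBy (hh : (q : 𝕜) ^ 2 - 1 ≠ 0) {β : IR q →ₐ[𝕜] Uq q ⊗[𝕜] IR q}
    (hβ : IsEquivariant hh β) {m : ℕ} (φ : Uq q →ₐ[𝕜] Tens q m) (X : Tens q m ⊗[𝕜] IR q) :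
    extendBy β m (TensorProduct.map (conjK φ).toLinearMap (conjR q).toLinearMap X) =
      TensorProduct.map (conjK ((snoc q m).comp (extHom φ))).toLinearMap (conjR q).toLinearMap
        (extendBy β m X) := by
  induction X using TensorProduct.induction_on with
  | zero => simp
  | add a b ha hb => simp only [map_add, ha, hb]
  | tmul z x =>
    rw [TensorProduct.map_tmul, extendBy_tmul, extendBy_tmul, AlgHom.toLinearMap_apply,
      AlgHom.toLinearMap_apply, hβ.conj]
    induction β x using TensorProduct.induction_on with
    | zero => simp
    | add a b ha hb => simp only [TensorProduct.tmul_add, map_add, ha, hb]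
    | tmul u y => simp [conjK_comp, conjK_extHom]

/-- The skew derivations kill all words, since they kill the Casimir element. The length is written
`0 + r` because `diag q 0 r` takes its values in `Tens q (0 + r)`. -/
lemma skewTensor_word (P : ℕ → Prop) {u : Uq q} (hu : IsSkewGen u) (r : ℕ) :
    skewTensor (diag q 0 r) u (conjR q).toLinearMap (skewR (sq_sub_one_ne_zero hq) hu)
      (word hq P (0 + r)) = 0 := by
  induction r with
  | zero =>
    have h1 : diag q 0 0 u = 0 := by
      rcases hu with rfl | rfl <;> simp [diag]
    have h2 : skewR (sq_sub_one_ne_zero hq) hu (IR.L q) = 0 := by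
      rcases hu with rfl | rfl
      · exact Subtype.ext (skewDer_EKinv_Casimir (sq_sub_one_ne_zero hq))
      · exact Subtype.ext (skewDer_F_Casimir (sq_sub_one_ne_zero hq))
    change skewTensor _ _ _ _ (1 ⊗ₜ IR.L q) = 0
    rw [skewTensor_tmul, h1, h2]
    simp
  | succ r ih =>
    have := skewTensor_extendBy _ (letter_equivariant hq (P (0 + r))) hu (diag q 0 r)
      (word hq P (0 + r))
    rw [ih, map_zero] at this
    exact this.symm

lemma conj_word (P : ℕ → Prop) (r : ℕ) :
    TensorProduct.map (conjK (diag q 0 r)).toLinearMap (conjR q).toLinearMap (word hq P (0 + r)) =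
      word hq P (0 + r) := by
  induction r with
  | zero =>
    change TensorProduct.map _ _ (1 ⊗ₜ IR.L q) = 1 ⊗ₜ IR.L q
    rw [TensorProduct.map_tmul, AlgHom.toLinearMap_apply, AlgHom.toLinearMap_apply, conjR_L,
      map_one]
  | succ r ih =>
    have := conj_extendBy _ (letter_equivariant hq (P (0 + r))) (diag q 0 r) (word hq P (0 + r))
    rw [ih] at this
    exact this.symm

lemma skewDer_wordElt (P : ℕ → Prop) {u : Uq q} (hu : IsSkewGen u) (b r : ℕ) :
    skewDer (diag q 0 r) u (wordElt hq P b (0 + r)) = 0 := by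
  induction r with
  | zero =>
    change skewDer _ _ 1 = 0
    rw [skewDer_apply, one_mul, mul_one, sub_self, mul_zero]
  | succ r ih =>
    change skewDer _ _ (wordElt hq P b (0 + r + 1)) = 0
    rw [wordElt]
    split_ifs
    · refine (skewDer_snoc_val (sq_sub_one_ne_zero hq) hu (diag q 0 r) _).symm.trans ?_
      rw [skewTensor_word, map_zero, map_zero]
    · refine (skewDer_comp (snoc q (0 + r)) (extHom (diag q 0 r)) _ _).trans ?_
      rw [skewDer_extHom_tmul_one _ hu, ih, TensorProduct.zero_tmul, map_zero]

lemma conjK_wordElt (P : ℕ → Prop) (b r : ℕ) :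
    conjK (diag q 0 r) (wordElt hq P b (0 + r)) = wordElt hq P b (0 + r) := by
  induction r with
  | zero => exact map_one _
  | succ r ih =>
    change conjK _ (wordElt hq P b (0 + r + 1)) = wordElt hq P b (0 + r + 1)
    rw [wordElt]
    split_ifs
    · refine (conjK_comp (snoc q (0 + r)) (extHom (diag q 0 r)) _).trans ?_
      rw [conjK_extHom]
      congr 1
      conv_rhs => rw [← conj_word]
      generalize word hq P (0 + r) = X
      induction X using TensorProduct.induction_on with
      | zero => simp
      | add a b ha hb => simp only [map_add, ha, hb]
      | tmul z x => simp [coe_conjR]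
    · refine (conjK_comp (snoc q (0 + r)) (extHom (diag q 0 r)) _).trans ?_
      rw [conjK_extHom, TensorProduct.map_tmul, AlgHom.toLinearMap_apply,
        AlgHom.toLinearMap_apply, ih, map_one]

/-- An element that is fixed by conjugation with `K` and killed by the two skew derivations commutes
with the image of the Casimir element. -/
lemma commute_Casimir {M : Type*} [Ring M] [Algebra 𝕜 M] (φ : Uq q →ₐ[𝕜] M) {y : M}
    (hK : conjK φ y = y) (hδ : ∀ u, IsSkewGen u → skewDer φ u y = 0) :
    Commute (φ (Uq.Casimir q)) y := by
  have h1 : φ (Uq.Kinv q) * φ (Uq.K q) = 1 := by rw [← map_mul, Uq.Kinv_mul_K, map_one]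
  have h2 : φ (Uq.K q) * φ (Uq.Kinv q) = 1 := by rw [← map_mul, Uq.K_mul_Kinv, map_one]
  have cK : Commute (φ (Uq.K q)) y := by
    rw [conjK_apply] at hK
    change _ * y = y * _
    conv_rhs => rw [← hK]
    simp only [mul_assoc, h1, mul_one]
  have cKi : Commute (φ (Uq.Kinv q)) y := by
    change _ * y = y * _
    calc φ (Uq.Kinv q) * y = φ (Uq.Kinv q) * (y * φ (Uq.K q)) * φ (Uq.Kinv q) := by
          rw [mul_assoc, mul_assoc, h2, mul_one]
      _ = y * φ (Uq.Kinv q) := by rw [← cK.eq, ← mul_assoc, h1, one_mul]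
  have cu (u : Uq q) (hu : IsSkewGen u) : Commute (φ u) y := by
    have h := hδ u hu
    rw [skewDer_apply] at h
    have h' := congrArg (φ (Uq.Kinv q) * ·) h
    simp only [← mul_assoc, h1, one_mul, mul_zero] at h'
    exact (sub_eq_zero.1 h').symm
  have cE : Commute (φ (Uq.E q)) y := by
    have : Uq.E q = Uq.EKinv q * Uq.K q := by rw [mul_assoc, Uq.Kinv_mul_K, mul_one]
    rw [this, map_mul]
    exact (cu _ (Or.inl rfl)).mul_left cK
  have cF := cu _ (Or.inr rfl)
  simp only [Uq.Casimir, map_add, map_smul, map_mul]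
  exact (((cE.mul_left cF).smul_left _).add_left (cK.smul_left _)).add_left (cKi.smul_left _)

lemma extHom_coassoc {M : Type*} [Ring M] [Algebra 𝕜 M] (φ : Uq q →ₐ[𝕜] M) (x : Uq q) :
    (TensorProduct.assoc 𝕜 M (Uq q) (Uq q)).symm ((Uq.comul q).toLinearMap.lTensor M (extHom φ x)) =
      extHom (extHom φ) x := by
  have : (Algebra.TensorProduct.assoc 𝕜 𝕜 𝕜 M (Uq q) (Uq q)).symm.toAlgHom.comp
      ((Algebra.TensorProduct.map (AlgHom.id 𝕜 M) (Uq.comul q)).comp (extHom φ)) =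
      extHom (extHom φ) := by
    apply Uq.algHom_ext <;>
    simp [extHom, TensorProduct.tmul_add, TensorProduct.add_tmul, Algebra.TensorProduct.one_def,
      add_assoc]
  exact DFunLike.congr_fun this x

lemma extHom_comp {M N : Type*} [Ring M] [Algebra 𝕜 M] [Ring N] [Algebra 𝕜 N] (f : M →ₐ[𝕜] N)
    (φ : Uq q →ₐ[𝕜] M) (x : Uq q) :
    extHom (f.comp φ) x = TensorProduct.map f.toLinearMap LinearMap.id (extHom φ x) := by
  have : extHom (f.comp φ) =
      (Algebra.TensorProduct.map f (AlgHom.id 𝕜 (Uq q))).comp (extHom φ) := by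
    apply Uq.algHom_ext <;> simp [extHom]
  exact DFunLike.congr_fun this x

set_option synthInstance.maxHeartbeats 200000 in
/-- A word in which all letters are `Δ` is an iterated coproduct of the Casimir element. -/
lemma word_eq_extHom {P : ℕ → Prop} (r : ℕ) (hP : ∀ i < 0 + r, P i) :
    (IR q).val.toLinearMap.lTensor _ (word hq P (0 + r)) =
      extHom (diag q 0 r) (Uq.Casimir q) := by
  induction r with
  | zero =>
    have : extHom (diag q 0 0) = Algebra.TensorProduct.includeRight := by
      apply Uq.algHom_ext <;> simp [extHom, diag]
    rw [this]
    rfl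
  | succ r ih =>
    have hl : letter hq (P (0 + r)) = comulR q := by rw [letter, if_pos (hP _ (by omega))]
    have hw : word hq P (0 + (r + 1)) = extendBy (comulR q) (0 + r) (word hq P (0 + r)) := by
      rw [← hl]; rfl
    rw [diag, extHom_comp, ← extHom_coassoc, ← ih fun i hi => hP i (by omega), hw]
    generalize word hq P (0 + r) = X
    induction X using TensorProduct.induction_on with
    | zero => simp
    | add a b ha hb => simp only [map_add, ha, hb]
    | tmul z x =>
      rw [extendBy_tmul, LinearMap.lTensor_tmul, LinearMap.lTensor_tmul,
        AlgHom.toLinearMap_apply, AlgHom.toLinearMap_apply, Subalgebra.coe_val, ← comulR_spec]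
      induction comulR q x using TensorProduct.induction_on with
      | zero => simp
      | add a b ha hb => simp only [TensorProduct.tmul_add, map_add, ha, hb]
      | tmul u y => simp

/-- The element of a word in which all letters are `Δ` is the image of the Casimir element under the
iterated coproduct, so it commutes with the elements of all words. -/
lemma commute_wordElt_of_forall {P : ℕ → Prop} {n : ℕ} (hP : ∀ i < n, P i) (Q : ℕ → Prop) (c : ℕ) :
    Commute (wordElt hq P n (n + 1)) (wordElt hq Q c (n + 1)) := by
  have key (r : ℕ) (hP : ∀ i < 0 + r, P i) :
      Commute (wordElt hq P (0 + r) (0 + r + 1)) (wordElt hq Q c (0 + r + 1)) := by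
    rw [wordElt, if_pos rfl, word_eq_extHom hq r hP]
    exact commute_Casimir (diag q 0 (r + 1)) (conjK_wordElt hq Q c (r + 1))
      fun u hu => skewDer_wordElt hq Q hu c (r + 1)
  have h := key n
  rw [Nat.zero_add] at h
  exact h hP

/-! ### The commutation theorem for words -/

/-- The commutation of `Λ_A` and `Λ_B` for `B ⊆ A`, in terms of words: `b` and `c` stand for `max
A` and `max B`, and `P` and `Q` for membership in `A` and `B`, which matters only before `b` and
`c`. The proof is by induction on the number of factors: if `A` has a hole, both elements come
from fewer factors by the insertion `Θ`, which is multiplicative. -/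
theorem commute_wordElt (n : ℕ) : ∀ (P Q : ℕ → Prop) (b c : ℕ), b < n → c ≤ b →
    (∀ i < c, Q i → P i) → (c < b → P c) → Commute (wordElt hq P b n) (wordElt hq Q c n) := by
  induction n with
  | zero => intro P Q b c hb; omega
  | succ n ih =>
    intro P Q b c hb hc hQP hPc
    by_cases hole : ∃ p < b, ¬ P p
    · obtain ⟨p, hpb, hp⟩ := hole
      obtain ⟨r, rfl⟩ : ∃ r, n = p + r := Nat.exists_eq_add_of_le (by omega)
      have hcp : c ≠ p := by
        rintro rfl
        exact hp (hPc hpb)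
      -- The letters of `Q` from `c` on do not matter; without them, `p` is a hole of `Q` as well.
      rw [wordElt_congr hq (P := Q) (Q := fun i => Q i ∧ i < c) (fun i hi => by simp [hi])]
      have hb' : skip p (b - 1) = b := by rw [skip, if_neg (by omega)]; omega
      obtain ⟨c', hc'⟩ : ∃ c', skip p c' = c := by
        rcases Nat.lt_or_ge c p with h | h
        · exact ⟨c, by rw [skip, if_pos h]⟩
        · exact ⟨c - 1, by rw [skip, if_neg (by omega)]; omega⟩
      have hc2 : c' ≤ b - 1 := by rw [skip] at hc'; split_ifs at hc' <;> omega
      have hcomm := ih (fun i => P (skip p i)) (fun i => Q (skip p i) ∧ skip p i < c) (b - 1) c'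
        (by omega) hc2 (fun i _ h => hQP _ h.2 h.1) (fun h => by
          rw [hc']
          refine hPc ?_
          rw [skip] at hc'
          split_ifs at hc' <;> omega)
      -- Both elements are images under `Θ` of commuting elements; the truncations are made equal.
      obtain ⟨m, h1, h2⟩ := exists_theta_wordElt hq hp r (b := b - 1) (by omega)
      obtain ⟨m', h3, h4⟩ := exists_theta_wordElt hq (P := fun i => Q i ∧ i < c) (p := p)
        (fun h => hp (hQP _ h.2 h.1)) r (b := c') (by omega)
      rw [hb'] at h2
      rw [hc'] at h4
      have e1 := theta_eq_of_le (q := q) (ω := (wtTens q p r).toLinearMap) (le_max_left m m')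
        fun i hi => Module.End.pow_map_zero_of_le hi h1
      have e2 := theta_eq_of_le (q := q) (ω := (wtTens q p r).toLinearMap) (le_max_right m m')
        fun i hi => Module.End.pow_map_zero_of_le hi h3
      have n1 := fun i (hi : max m m' ≤ i) =>
        Module.End.pow_map_zero_of_le ((le_max_left m m').trans hi) h1
      have n2 := fun i (hi : max m m' ≤ i) =>
        Module.End.pow_map_zero_of_le ((le_max_right m m').trans hi) h3
      rw [← h2, ← h4, thetaTens, thetaTens, ← e1, ← e2]
      refine Commute.map (f := ins q p r) ?_
      change _ * _ = _ * _
      rw [theta_mul hq _ _ (wtTens_conjK p r) le_rfl n1 n2, hcomm.eq,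
        theta_mul hq _ _ (wtTens_conjK p r) le_rfl n2 n1]
    · push Not at hole
      by_cases hbn : b = n
      · subst hbn
        exact commute_wordElt_of_forall hq hole Q c
      · -- Both elements have the factor `1` in the last position.
        rw [wordElt, if_neg hbn, wordElt, if_neg (by omega)]
        refine Commute.map (f := snoc q n) ?_
        have := ih P Q b c (by omega) hc hQP hPc
        change _ * _ = _ * _
        rw [Algebra.TensorProduct.tmul_mul_tmul, Algebra.TensorProduct.tmul_mul_tmul, this.eq]

end centralizer

/-! ### The generators `Λ_A` as word elements -/

lemma place_place {l m n : ℕ} (h : Fin l ↪ Fin m) (g : Fin m ↪ Fin n) (x : Tens q l) :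
    place g (place h x) = place (h.trans g) x := by
  have : (place g).toLinearMap ∘ₗ (place h).toLinearMap =
      (place (q := q) (h.trans g)).toLinearMap := by
    ext x
    simp only [LinearMap.compMultilinearMap_apply, LinearMap.comp_apply, AlgHom.toLinearMap_apply,
      place_tprod]
    congr 1
    funext j
    by_cases hj : ∃ i, g i = j
    · obtain ⟨i, rfl⟩ := hj
      rw [g.injective.extend_apply]
      by_cases hi : ∃ k, h k = i
      · obtain ⟨k, rfl⟩ := hi
        rw [h.injective.extend_apply, show g (h k) = (h.trans g) k from rfl,
          (h.trans g).injective.extend_apply]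
      · rw [Function.extend_apply' _ _ _ hi,
          Function.extend_apply' (f := h.trans g) _ _ _ fun ⟨k, hk⟩ => hi ⟨k, g.injective hk⟩]
        rfl
    · rw [Function.extend_apply' _ _ _ hj,
        Function.extend_apply' (f := h.trans g) _ _ _ fun ⟨k, hk⟩ => hj ⟨h k, hk⟩]
  exact DFunLike.congr_fun this x

lemma place_refl {n : ℕ} (x : Tens q n) : place (Function.Embedding.refl (Fin n)) x = x := by
  have : (place (q := q) (Function.Embedding.refl (Fin n))).toLinearMap = LinearMap.id := by
    ext x
    simp only [LinearMap.compMultilinearMap_apply, AlgHom.toLinearMap_apply, place_tprod,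
      LinearMap.id_apply]
    congr 1
    funext j
    exact (Function.Embedding.refl (Fin n)).injective.extend_apply x 1 j
  exact DFunLike.congr_fun this x

lemma snoc_tmul_one (m : ℕ) (x : Tens q m) : snoc q m (x ⊗ₜ 1) = place Fin.castSuccEmb x := by
  simp [snoc, ← PiTensorProduct.one_def]

lemma snoc_place (a ℓ : ℕ) (x : Tens q ℓ ⊗[𝕜] Uq q) :
    snoc q (a + ℓ) (TensorProduct.map (place (Fin.natAddEmb a)).toLinearMap LinearMap.id x) =
      place (Fin.natAddEmb a) (snoc q ℓ x) := by
  have : (snoc q (a + ℓ)).toLinearMap ∘ₗ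
      TensorProduct.map (place (Fin.natAddEmb a)).toLinearMap LinearMap.id =
      (place (Fin.natAddEmb a)).toLinearMap ∘ₗ (snoc q ℓ).toLinearMap := by
    ext x y
    simp only [LinearMap.compMultilinearMap_apply, LinearMap.comp_apply, AlgHom.toLinearMap_apply,
      TensorProduct.AlgebraTensorModule.curry_apply, TensorProduct.curry_apply,
      LinearMap.restrictScalars_self, TensorProduct.map_tmul, LinearMap.id_apply, place_tprod,
      snoc_tmul_tprod]
    congr 1
    funext j
    refine Fin.lastCases ?_ (fun j => ?_) j
    · rw [Fin.snoc_last, show Fin.last (a + ℓ) = Fin.natAddEmb a (Fin.last ℓ) from rfl,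
        (Fin.natAddEmb a).injective.extend_apply, Fin.snoc_last]
    · rw [Fin.snoc_castSucc]
      by_cases hj : ∃ i, Fin.natAddEmb a i = j
      · obtain ⟨i, rfl⟩ := hj
        rw [(Fin.natAddEmb a).injective.extend_apply,
          show (Fin.natAddEmb a i).castSucc = Fin.natAddEmb a i.castSucc from rfl,
          (Fin.natAddEmb a).injective.extend_apply, Fin.snoc_castSucc]
      · rw [Function.extend_apply' _ _ _ hj, Function.extend_apply' _ _ _ ?_]
        · rfl
        · rintro ⟨i, hi⟩
          have hv := congrArg Fin.val hi
          simp only [Fin.natAddEmb_apply, Fin.val_natAdd, Fin.val_castSucc] at hv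
          exact hj ⟨⟨i, by omega⟩, Fin.ext (by simpa using hv)⟩
  exact DFunLike.congr_fun this x

section
variable (hq : ¬ IsOfFinOrder q)

lemma stage_eq_word (S : Finset ℕ) (a ℓ : ℕ) : stage hq S a ℓ = word hq (fun i => a + i ∈ S) ℓ := by
  induction ℓ with
  | zero => rfl
  | succ ℓ ih =>
    rw [stage, word, ih, letter]
    by_cases h : a + ℓ ∈ S <;> simp [h]

lemma word_of_forall_not {P : ℕ → Prop} {a : ℕ} (h : ∀ i < a, ¬ P i) :
    word hq P a = 1 ⊗ₜ IR.L q := by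
  induction a with
  | zero => rfl
  | succ a ih =>
    rw [word, ih fun i hi => h i (by omega), letter, if_neg (h a (by omega)), extendBy_tmul,
      (tauR_spec hq).2.2.2]
    simp [← Algebra.TensorProduct.one_def]

set_option synthInstance.maxHeartbeats 200000 in
/-- A word that starts with letters `τ_R` is a shorter word with factors `1` on the left. -/
lemma word_add {P : ℕ → Prop} {a : ℕ} (h : ∀ i < a, ¬ P i) (ℓ : ℕ) :
    word hq P (a + ℓ) = TensorProduct.map (place (Fin.natAddEmb a)).toLinearMap LinearMap.id
      (word hq (fun i => P (a + i)) ℓ) := by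
  induction ℓ with
  | zero =>
    refine (word_of_forall_not hq h).trans ?_
    rw [word, TensorProduct.map_tmul, AlgHom.toLinearMap_apply, map_one]
    rfl
  | succ ℓ ih =>
    change extendBy (letter hq (P (a + ℓ))) (a + ℓ) (word hq P (a + ℓ)) = _
    rw [ih, word]
    generalize word hq (fun i => P (a + i)) ℓ = X
    induction X using TensorProduct.induction_on with
    | zero => simp
    | add x y hx hy => simp only [map_add, hx, hy]
    | tmul z x =>
      rw [TensorProduct.map_tmul, extendBy_tmul, extendBy_tmul, LinearMap.id_apply]
      induction letter hq (P (a + ℓ)) x using TensorProduct.induction_on with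
      | zero => simp
      | add x y hx hy => simp only [TensorProduct.tmul_add, map_add, hx, hy]
      | tmul u y =>
        simp only [TensorProduct.assoc_symm_tmul, TensorProduct.map_tmul, LinearMap.id_apply,
          AlgHom.toLinearMap_apply]
        exact congrArg (· ⊗ₜ[𝕜] y) (snoc_place a ℓ (z ⊗ₜ u))

/-- `wordElt` in terms of `place`; the embedding `g` is the inclusion of the first `b + 1`
positions. -/
lemma wordElt_eq_place (P : ℕ → Prop) {b n : ℕ} (g : Fin (b + 1) ↪ Fin n)
    (hg : ∀ i, (g i : ℕ) = i) :
    wordElt hq P b n = place g (snoc q b ((IR q).val.toLinearMap.lTensor _ (word hq P b))) := by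
  induction n with
  | zero => exact (g 0).elim0
  | succ n ih =>
    rw [wordElt]
    split_ifs with hb
    · subst hb
      have : g = Function.Embedding.refl _ := by ext i; simp [hg]
      rw [this, place_refl]
    · have hbn : b < n := by
        have := (g (Fin.last b)).2
        rw [hg] at this
        simp only [Fin.val_last] at this
        omega
      let g' : Fin (b + 1) ↪ Fin n := Fin.castLEEmb hbn
      have : g = g'.trans Fin.castSuccEmb := by ext i; simp [hg, g']
      rw [this, ← place_place, snoc_tmul_one, ih g' fun i => rfl]

/-- `Λ_A` comes from the word that starts in position `0` instead of `min A`: the letters `τ_R`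
before `min A` only put factors `1` on the left, by `τ_R(Λ) = 1 ⊗ Λ`. -/
lemma Lambda_eq_wordElt {n : ℕ} (A : Finset (Fin n)) (h : A.Nonempty) :
    Lambda hq A = wordElt hq (fun i => i ∈ A.map Fin.valEmbedding) (A.max' h) n := by
  have hab : (A.min' h : ℕ) ≤ A.max' h := A.min'_le_max' h
  have hn : (A.max' h : ℕ) < n := (A.max' h).2
  have e : wordElt hq (fun i => i ∈ A.map Fin.valEmbedding) (A.max' h) n =
      wordElt hq (fun i => i ∈ A.map Fin.valEmbedding)
        ((A.min' h : ℕ) + ((A.max' h : ℕ) - A.min' h)) n := by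
    congr 1; omega
  have hmin : ∀ i < (A.min' h : ℕ), ¬ i ∈ A.map Fin.valEmbedding := by
    intro i hi hiA
    obtain ⟨j, hj, rfl⟩ := Finset.mem_map.1 hiA
    have : (A.min' h : ℕ) ≤ j := A.min'_le j hj
    simp only [Fin.valEmbedding_apply] at hi
    omega
  rw [e, wordElt_eq_place hq _ (n := n)
      (Fin.castLEEmb (by omega)) fun i => rfl, word_add hq hmin, Lambda,
    dif_pos h, stage_eq_word]
  generalize word hq _ ((A.max' h : ℕ) - A.min' h) = X
  have hX : (IR q).val.toLinearMap.lTensor _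
      (TensorProduct.map (place (Fin.natAddEmb (A.min' h : ℕ))).toLinearMap LinearMap.id X) =
      TensorProduct.map (place (Fin.natAddEmb (A.min' h : ℕ))).toLinearMap LinearMap.id
        ((IR q).val.toLinearMap.lTensor _ X) := by
    induction X using TensorProduct.induction_on with
    | zero => simp
    | add x y hx hy => simp only [map_add, hx, hy]
    | tmul z x => simp
  rw [hX, snoc_place, place_place]
  congr 1

end

end AskeyWilson

end

open AskeyWilson in
theorem theorem3p1 {𝕜 : Type*} [Field 𝕜] (q : 𝕜ˣ) (hq : ¬ IsOfFinOrder q) (n : ℕ)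
    (A B : Finset (Fin n)) (hBA : B ⊆ A) :
    Commute (AskeyWilson.Lambda hq A) (AskeyWilson.Lambda hq B) := by
  rcases B.eq_empty_or_nonempty with rfl | hB
  · rw [AskeyWilson.Lambda.eq_def hq (∅ : Finset (Fin n)), dif_neg Finset.not_nonempty_empty]
    exact Algebra.commute_algebraMap_right _ _
  have hA : A.Nonempty := hB.mono hBA
  rw [Lambda_eq_wordElt hq A hA, Lambda_eq_wordElt hq B hB]
  exact commute_wordElt hq n _ _ _ _ (A.max' hA).2 (Finset.max'_subset hB hBA)
    (fun i _ hi => Finset.map_subset_map.2 hBA hi)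
    (fun _ => Finset.mem_map_of_mem _ (hBA (B.max'_mem hB)))
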